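/- Let $n\ge 1$ be an integer and $p\in[0,1]$. Let $G(n,p)$ be a Bernoulli random graph on the vertex set $\{1,\dots,n\}$ (each of the $\binom n2$ possible edges is present independently with probability $p$), let $I_{i,j}=I_{j,i}$ be the indicator that the edge $\{i,j\}$ is present, with $I_{i,i}=0$, and for $t\in[0,1]$ put $$\mathbf T_n(t)=\frac{\lfloor nt\rfloor-2}{2n^2}\sum_{i,j=1}^{\lfloor nt\rfloor}I_{i,j},\qquad \mathbf V_n(t)=\frac1{2n^2}\sum_{\substack{1\le i,j,k\le\lfloor nt\rfloor\\ i,j,k\text{ distinct}}}I_{i,j}I_{j,k},$$ $$\mathbf Y_n(t)=\bigl(\mathbf T_n(t)-\mathbb E\mathbf T_n(t),\ \mathbf V_n(t)-\mathbb E\mathbf V_n(t)\bigr).$$ Let $\mathbf B_1,\mathbf B_2$ be independent standard Brownian motions and let $\mathbf Z=(\mathbf Z^{(1)},\mathbf Z^{(2)})$ be given, for $t\in[0,1]$, by $$\mathbf Z^{(1)}(t)=\frac{\sqrt{p(1-p)}}{\sqrt{2+8p^2}}\,t\,\mathbf B_1(t^2)+\frac{p\sqrt{2p(1-p)}}{\sqrt{1+4p^2}}\,t\,\mathbf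 B_2(t^2),$$ $$\mathbf Z^{(2)}(t)=\frac{p\sqrt{2p(1-p)}}{\sqrt{1+4p^2}}\,t\,\mathbf B_1(t^2)+\frac{2p^2\sqrt{2p(1-p)}}{\sqrt{1+4p^2}}\,t\,\mathbf B_2(t^2).$$ Let $D^2=D([0,1],\mathbb R^2)$ be the space of càdlàg functions $w:[0,1]\to\mathbb R^2$ with the norm $\|w\|=\sup_{t\in[0,1]}|w(t)|$, where $|\cdot|$ is the Euclidean norm. For a $k$-linear form $B$ on $D^2$ let $\|B\|=\sup_{\|h\|=1}|B[h,\dots,h]|$. Let $M$ be the set of continuous functions $g:D^2\to\mathbb R$ with $\sup_w|g(w)|/(1+\|w\|^3)<\infty$ which are twice Fréchet differentiable and satisfy, for some constant $k_g$, $\|D^2g(w+h)-D^2g(w)\|\le k_g\|h\|$ for all $w,h\in D^2$. Let $M^2$ be the set of those $g\in M$ for which $$\|g\|_{M^2}:=\sup_{w}\frac{|g(w)|}{1+\|w\|^3}+\sup_{w}\frac{\|Dg(w)\|}{1+\|w\|}+\sup_{w}\frac{\|D^2g(w)\|}{1+\|w\|}+\sup_{w,\,h\ne0}\frac{\|D^2g(w+h)-D^2g(w)\|}{\|h\|}<\infty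 .$$ **Theorem.** For every $g\in M^2$ the expectations $\mathbb Eg(\mathbf Y_n)$ and $\mathbb Eg(\mathbf Z)$ exist (the random variables $g(\mathbf Y_n)$ and $g(\mathbf Z)$ are integrable) and $$\bigl|\mathbb Eg(\mathbf Y_n)-\mathbb Eg(\mathbf Z)\bigr|\le\|g\|_{M^2}\left(913\,n^{-1/2}\sqrt{\log n}+112\,n^{-1/2}\right).$$ -/

import Mathlib

open MeasureTheory ProbabilityTheory Filter Topology Set
open scoped ENNReal NNReal unitInterval

noncomputable section

/-! ### The space `D^d = D([0,1], ℝ^d)` with the supremum norm -/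

/-- `w` is càdlàg on `[0,1]`: right-continuous with left limits. (At `t = 0` the filter `𝓝[<] t`
is trivial, so nothing is required of a left limit there.) -/
def IsCadlagPath {d : ℕ} (w : I → EuclideanSpace ℝ (Fin d)) : Prop :=
  ∀ t : I, ContinuousWithinAt w (Ici t) t ∧ ∃ l, Tendsto w (𝓝[<] t) (𝓝 l)

/-- The linear space of càdlàg functions `[0,1] → ℝ^d`. -/
def cadlagSubmodule (d : ℕ) : Submodule ℝ (I → EuclideanSpace ℝ (Fin d)) where
  carrier := {w | IsCadlagPath w}
  add_mem' := fun {v w} hv hw t => by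
    obtain ⟨hv1, l, hl⟩ := hv t
    obtain ⟨hw1, m, hm⟩ := hw t
    exact ⟨hv1.add hw1, l + m, hl.add hm⟩
  zero_mem' := fun _ => ⟨continuousWithinAt_const, 0, tendsto_const_nhds⟩
  smul_mem' := fun c w hw t => by
    obtain ⟨hw1, m, hm⟩ := hw t
    exact ⟨hw1.const_smul c, c • m, hm.const_smul c⟩

/-- `D^d`, the space of càdlàg functions `[0,1] → ℝ^d`. It is a separate type, so that it carries
the supremum norm below and not the topology of pointwise convergence. -/
def SkorokhodSpace (d : ℕ) : Type := cadlagSubmodule d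

namespace SkorokhodSpace

instance (d : ℕ) : AddCommGroup (SkorokhodSpace d) :=
  inferInstanceAs (AddCommGroup (cadlagSubmodule d))

instance (d : ℕ) : Module ℝ (SkorokhodSpace d) :=
  inferInstanceAs (Module ℝ (cadlagSubmodule d))

instance (d : ℕ) : CoeFun (SkorokhodSpace d) (fun _ => I → EuclideanSpace ℝ (Fin d)) :=
  ⟨fun w => w.1⟩

/-- The element of `D^d` given by a càdlàg function. -/
def mk {d : ℕ} (w : I → EuclideanSpace ℝ (Fin d)) (hw : IsCadlagPath w) : SkorokhodSpace d :=
  ⟨w, hw⟩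

/-- Càdlàg functions on `[0,1]` are bounded. -/
theorem bddAbove_range_norm {d : ℕ} (w : SkorokhodSpace d) :
    BddAbove (range fun t => ‖w t‖) := by
  have key : ∃ C, ∀ t ∈ (univ : Set I), ‖w t‖ ≤ C := by
    refine isCompact_univ.induction_on (p := fun s => ∃ C, ∀ t ∈ s, ‖w t‖ ≤ C) ⟨0, by simp⟩
      (fun s t hst ⟨C, hC⟩ => ⟨C, fun x hx => hC x (hst hx)⟩)
      (fun s t ⟨C, hC⟩ ⟨C', hC'⟩ => ⟨max C C', fun x hx => hx.elim
        (fun h => (hC x h).trans (le_max_left _ _))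
        (fun h => (hC' x h).trans (le_max_right _ _))⟩) ?_
    intro t _
    rw [nhdsWithin_univ]
    obtain ⟨hr, l, hl⟩ := w.2 t
    have h1 : ∀ᶠ x in 𝓝[<] t, ‖w x‖ ≤ max (‖l‖ + 1) (‖w t‖ + 1) :=
      (hl.norm.eventually (ge_mem_nhds (lt_add_one _))).mono
        fun x hx => hx.trans (le_max_left _ _)
    have h2 : ∀ᶠ x in 𝓝[≥] t, ‖w x‖ ≤ max (‖l‖ + 1) (‖w t‖ + 1) :=
      (hr.norm.eventually (ge_mem_nhds (lt_add_one _))).mono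
        fun x hx => hx.trans (le_max_right _ _)
    have h3 : ∀ᶠ x in 𝓝 t, ‖w x‖ ≤ max (‖l‖ + 1) (‖w t‖ + 1) := by
      rw [← nhdsLT_sup_nhdsGE t]
      exact eventually_sup.2 ⟨h1, h2⟩
    exact ⟨_, h3, _, fun x hx => hx⟩
  obtain ⟨C, hC⟩ := key
  exact ⟨C, by rintro _ ⟨t, rfl⟩; exact hC t (mem_univ t)⟩

/-- The supremum norm `‖w‖ = sup_{t ∈ [0,1]} |w(t)|`, with `|·|` the Euclidean norm. -/
instance (d : ℕ) : Norm (SkorokhodSpace d) := ⟨fun w => ⨆ t : I, ‖w t‖⟩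

theorem norm_def {d : ℕ} (w : SkorokhodSpace d) : ‖w‖ = ⨆ t : I, ‖w t‖ := rfl

theorem normCore (d : ℕ) : NormedSpace.Core ℝ (SkorokhodSpace d) where
  norm_nonneg w := Real.iSup_nonneg fun t => norm_nonneg (w t)
  norm_smul c w := by
    rw [norm_def, norm_def, Real.mul_iSup_of_nonneg (norm_nonneg c)]
    exact iSup_congr fun t => norm_smul c (w t)
  norm_triangle v w := ciSup_le fun t => (norm_add_le (v t) (w t)).trans
    (add_le_add (le_ciSup (bddAbove_range_norm v) t) (le_ciSup (bddAbove_range_norm w) t))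
  norm_eq_zero_iff w := by
    constructor
    · intro h
      refine Subtype.ext (funext fun t => ?_)
      have ht : ‖w t‖ ≤ ‖w‖ := le_ciSup (bddAbove_range_norm w) t
      rw [h] at ht
      exact norm_le_zero_iff.1 ht
    · rintro rfl
      rw [norm_def]
      have h0 : ∀ t : I, ‖(0 : SkorokhodSpace d) t‖ = 0 := fun t => norm_zero
      simp only [h0, ciSup_const]

instance (d : ℕ) : NormedAddCommGroup (SkorokhodSpace d) := NormedAddCommGroup.ofCore (normCore d)

instance (d : ℕ) : NormedSpace ℝ (SkorokhodSpace d) := NormedSpace.ofCore (normCore d)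

end SkorokhodSpace

/-! ### The classes `M` and `M²` of test functionals -/

/-- The norm `sup_{‖h‖ = 1} |B[h, …, h]|` of a `k`-linear form `B` on `D^d`, as a function of the
map `β : h ↦ B[h, …, h]`. Suprema are taken in `[0, ∞]`. -/
def formNorm {d : ℕ} (β : SkorokhodSpace d → ℝ) : ℝ≥0∞ :=
  ⨆ (h : SkorokhodSpace d) (_ : ‖h‖ = 1), ‖β h‖ₑ

/-- The norm `‖Dg(w)‖` of the first Fréchet derivative. -/
def normD {d : ℕ} (g : SkorokhodSpace d → ℝ) (w : SkorokhodSpace d) : ℝ≥0∞ :=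
  formNorm fun v => fderiv ℝ g w v

/-- The norm `‖D²g(w)‖` of the second Fréchet derivative. -/
def normD2 {d : ℕ} (g : SkorokhodSpace d → ℝ) (w : SkorokhodSpace d) : ℝ≥0∞ :=
  formNorm fun v => fderiv ℝ (fderiv ℝ g) w v v

/-- The norm `‖D²g(w + h) - D²g(w)‖`. -/
def normD2Diff {d : ℕ} (g : SkorokhodSpace d → ℝ) (w h : SkorokhodSpace d) : ℝ≥0∞ :=
  formNorm fun v => (fderiv ℝ (fderiv ℝ g) (w + h) - fderiv ℝ (fderiv ℝ g) w) v v

/-- `‖g‖_L = sup_w |g(w)| / (1 + ‖w‖³)`, in `[0, ∞]`. -/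
def normL {d : ℕ} (g : SkorokhodSpace d → ℝ) : ℝ≥0∞ :=
  ⨆ w : SkorokhodSpace d, ‖g w‖ₑ / (1 + ‖w‖ₑ ^ 3)

/-- The class `M`: continuous functionals with `‖g‖_L < ∞` which are twice Fréchet differentiable
and whose second derivative is Lipschitz. -/
structure MemM {d : ℕ} (g : SkorokhodSpace d → ℝ) : Prop where
  continuous : Continuous g
  normL_lt_top : normL g < ∞
  differentiable : Differentiable ℝ g
  differentiable_fderiv : Differentiable ℝ (fderiv ℝ g)
  lipschitz : ∃ k : ℝ≥0, ∀ w h : SkorokhodSpace d, normD2Diff g w h ≤ k * ‖h‖ₑ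

/-- `‖g‖_{M²}`, in `[0, ∞]`. -/
def normM2 {d : ℕ} (g : SkorokhodSpace d → ℝ) : ℝ≥0∞ :=
  (⨆ w : SkorokhodSpace d, ‖g w‖ₑ / (1 + ‖w‖ₑ ^ 3))
    + (⨆ w : SkorokhodSpace d, normD g w / (1 + ‖w‖ₑ))
    + (⨆ w : SkorokhodSpace d, normD2 g w / (1 + ‖w‖ₑ))
    + ⨆ (w : SkorokhodSpace d) (h : SkorokhodSpace d) (_ : h ≠ 0), normD2Diff g w h / ‖h‖ₑ

/-- The class `M²`: functionals `g ∈ M` with `‖g‖_{M²} < ∞`. -/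
structure MemM2 {d : ℕ} (g : SkorokhodSpace d → ℝ) : Prop where
  memM : MemM g
  normM2_lt_top : normM2 g < ∞

/-! ### The edge and two-star process -/

open Classical in
/-- The indicator `I_{i,j}` that `{i, j}` is an edge of the graph (so `I_{i,i} = 0`). -/
def edgeIndicator {n : ℕ} (G : SimpleGraph (Fin n)) (i j : Fin n) : ℝ :=
  if G.Adj i j then 1 else 0

/-- The first `m` vertices. -/
def firstVertices (n m : ℕ) : Finset (Fin n) := {i | (i : ℕ) < m}

/-- The rescaled number of edges
`T_n(t) = (⌊nt⌋ - 2) / (2n²) * ∑_{i,j ≤ ⌊nt⌋} I_{i,j}`. -/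
def edgeStat {n : ℕ} (G : SimpleGraph (Fin n)) (t : I) : ℝ :=
  ((⌊(n : ℝ) * t⌋₊ : ℝ) - 2) / (2 * (n : ℝ) ^ 2) *
    ∑ i ∈ firstVertices n ⌊(n : ℝ) * t⌋₊, ∑ j ∈ firstVertices n ⌊(n : ℝ) * t⌋₊,
      edgeIndicator G i j

/-- The rescaled number of two-stars
`V_n(t) = 1 / (2n²) * ∑_{i,j,k ≤ ⌊nt⌋ distinct} I_{i,j} I_{j,k}`. -/
def twoStarStat {n : ℕ} (G : SimpleGraph (Fin n)) (t : I) : ℝ :=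
  1 / (2 * (n : ℝ) ^ 2) *
    ∑ i ∈ firstVertices n ⌊(n : ℝ) * t⌋₊, ∑ j ∈ firstVertices n ⌊(n : ℝ) * t⌋₊,
      ∑ k ∈ firstVertices n ⌊(n : ℝ) * t⌋₊,
        if i ≠ j ∧ j ≠ k ∧ i ≠ k then edgeIndicator G i j * edgeIndicator G j k else 0

/-- A function of `⌊nt⌋` is càdlàg in `t`. -/
theorem isCadlagPath_floor {d : ℕ} (n : ℕ) (f : ℕ → EuclideanSpace ℝ (Fin d)) :
    IsCadlagPath fun t : I => f ⌊(n : ℝ) * t⌋₊ := by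
  intro t
  have hcont : Continuous fun x : I => (n : ℝ) * x := by fun_prop
  constructor
  · have hev : ∀ᶠ x : I in 𝓝[≥] t, f ⌊(n : ℝ) * (x : ℝ)⌋₊ = f ⌊(n : ℝ) * (t : ℝ)⌋₊ := by
      have h1 : ∀ᶠ x : I in 𝓝[≥] t, (n : ℝ) * (x : ℝ) < (⌊(n : ℝ) * (t : ℝ)⌋₊ : ℝ) + 1 :=
        ((hcont.tendsto t).eventually_lt_const (Nat.lt_floor_add_one _)).filter_mono
          nhdsWithin_le_nhds
      filter_upwards [h1, self_mem_nhdsWithin] with x hx hxt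
      have hle : (n : ℝ) * (t : ℝ) ≤ (n : ℝ) * (x : ℝ) :=
        mul_le_mul_of_nonneg_left (Subtype.coe_le_coe.2 hxt) (Nat.cast_nonneg n)
      have hx0 : 0 ≤ (n : ℝ) * (x : ℝ) := mul_nonneg (Nat.cast_nonneg n) x.2.1
      congr 1
      refine (Nat.floor_eq_iff hx0).2 ⟨(Nat.floor_le ?_).trans hle, hx⟩
      exact mul_nonneg (Nat.cast_nonneg n) t.2.1
    exact (tendsto_congr' hev).2 tendsto_const_nhds
  · refine ⟨f (⌈(n : ℝ) * (t : ℝ)⌉₊ - 1), ?_⟩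
    refine (tendsto_congr' ?_).2 (tendsto_const_nhds (x := f (⌈(n : ℝ) * (t : ℝ)⌉₊ - 1)))
    rcases Nat.eq_zero_or_pos n with rfl | hn
    · simp
    have hn' : (0 : ℝ) < n := Nat.cast_pos.2 hn
    rcases eq_or_lt_of_le t.2.1 with h0 | h0
    · have hbot : (𝓝[<] t : Filter I) = ⊥ := by
        have : Iio t = ∅ := by
          ext x
          simp only [mem_Iio, mem_empty_iff_false, iff_false, not_lt]
          exact Subtype.coe_le_coe.1 (h0 ▸ x.2.1)
        rw [this, nhdsWithin_empty]
      rw [hbot]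
      exact eventually_bot
    have hpos : 0 < (n : ℝ) * (t : ℝ) := mul_pos hn' h0
    have hc : 0 < ⌈(n : ℝ) * (t : ℝ)⌉₊ := Nat.ceil_pos.2 hpos
    have hlt : ((⌈(n : ℝ) * (t : ℝ)⌉₊ - 1 : ℕ) : ℝ) < (n : ℝ) * (t : ℝ) :=
      Nat.lt_ceil.1 (Nat.sub_lt hc one_pos)
    have h1 : ∀ᶠ x : I in 𝓝[<] t, ((⌈(n : ℝ) * (t : ℝ)⌉₊ - 1 : ℕ) : ℝ) < (n : ℝ) * (x : ℝ) :=
      ((hcont.tendsto t).eventually_const_lt hlt).filter_mono nhdsWithin_le_nhds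
    filter_upwards [h1, self_mem_nhdsWithin] with x hx hxt
    have hxlt : (n : ℝ) * (x : ℝ) < (n : ℝ) * (t : ℝ) :=
      mul_lt_mul_of_pos_left (Subtype.coe_lt_coe.2 hxt) hn'
    have hx0 : 0 ≤ (n : ℝ) * (x : ℝ) := mul_nonneg (Nat.cast_nonneg n) x.2.1
    congr 1
    refine (Nat.floor_eq_iff hx0).2 ⟨hx.le, ?_⟩
    have : ((⌈(n : ℝ) * (t : ℝ)⌉₊ - 1 : ℕ) : ℝ) + 1 = ⌈(n : ℝ) * (t : ℝ)⌉₊ := by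
      rw [Nat.cast_sub hc]; simp
    rw [this]
    exact hxlt.trans_le (Nat.le_ceil _)

/-- The path `t ↦ (T_n(t) - E T_n(t), V_n(t) - E V_n(t))` at the outcome `ω`, for a random graph
`G` on `n` vertices defined on the probability space `(Ω, P)`. -/
def centredPath {Ω : Type*} [MeasurableSpace Ω] {n : ℕ} (P : Measure Ω)
    (G : Ω → SimpleGraph (Fin n)) (ω : Ω) (t : I) : EuclideanSpace ℝ (Fin 2) :=
  !₂[edgeStat (G ω) t - ∫ ω', edgeStat (G ω') t ∂P,
    twoStarStat (G ω) t - ∫ ω', twoStarStat (G ω') t ∂P]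

theorem isCadlagPath_centredPath {Ω : Type*} [MeasurableSpace Ω] {n : ℕ} (P : Measure Ω)
    (G : Ω → SimpleGraph (Fin n)) (ω : Ω) : IsCadlagPath (centredPath P G ω) := by
  let T : SimpleGraph (Fin n) → ℕ → ℝ := fun G m => ((m : ℝ) - 2) / (2 * (n : ℝ) ^ 2) *
    ∑ i ∈ firstVertices n m, ∑ j ∈ firstVertices n m, edgeIndicator G i j
  let V : SimpleGraph (Fin n) → ℕ → ℝ := fun G m => 1 / (2 * (n : ℝ) ^ 2) *
    ∑ i ∈ firstVertices n m, ∑ j ∈ firstVertices n m, ∑ k ∈ firstVertices n m,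
      if i ≠ j ∧ j ≠ k ∧ i ≠ k then edgeIndicator G i j * edgeIndicator G j k else 0
  exact isCadlagPath_floor n fun m =>
    !₂[T (G ω) m - ∫ ω', T (G ω') m ∂P, V (G ω) m - ∫ ω', V (G ω') m ∂P]

/-- The process `Y_n`, as a random element of `D^2`. -/
def edgeTwoStarProcess {Ω : Type*} [MeasurableSpace Ω] {n : ℕ} (P : Measure Ω)
    (G : Ω → SimpleGraph (Fin n)) (ω : Ω) : SkorokhodSpace 2 :=
  SkorokhodSpace.mk (centredPath P G ω) (isCadlagPath_centredPath P G ω)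

/-! ### The limiting Gaussian process -/

/-- The path `t ↦ Z(t)` built from the paths `b₁`, `b₂`. -/
def limitPath (p : ℝ) (b₁ b₂ : ℝ≥0 → ℝ) (t : I) : EuclideanSpace ℝ (Fin 2) :=
  let s : ℝ≥0 := unitInterval.toNNReal t ^ 2
  !₂[√(p * (1 - p)) / √(2 + 8 * p ^ 2) * t * b₁ s
      + p * √(2 * p * (1 - p)) / √(1 + 4 * p ^ 2) * t * b₂ s,
    p * √(2 * p * (1 - p)) / √(1 + 4 * p ^ 2) * t * b₁ s
      + 2 * p ^ 2 * √(2 * p * (1 - p)) / √(1 + 4 * p ^ 2) * t * b₂ s]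

open Classical in
/-- The process `Z` as a random element of `D^2`. Brownian paths are continuous, hence the path of
`Z` lies in `D^2`, almost surely; on the exceptional null set `Z` is put equal to `0`. -/
def limitProcess {Ω : Type*} (p : ℝ) (B₁ B₂ : ℝ≥0 → Ω → ℝ) (ω : Ω) : SkorokhodSpace 2 :=
  if h : IsCadlagPath (limitPath p (B₁ · ω) (B₂ · ω)) then SkorokhodSpace.mk _ h else 0

end

/-! ### Consequences of membership in `M²` -/

/-! Put x_e = I_e - p. Expanding (x_e + p)(x_f + p) over the two-stars splits Y_n into a linear and
a quadratic part (`edgeTwoStarProcess_eq`). With m = ⌊nt⌋ and S_m the sum of x_e over the edges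
among the first m vertices, the linear part is (m-2)/n² · S_m · (1, 2p): each edge extends to a
two-star by m-2 third vertices at either end, and T_n carries the same factor m-2. So both
coordinates are driven by one martingale. The limit is degenerate in the same way (`limitPath_eq`):
Z(t) = t W(t²) · √(p(1-p)/2) · (1, 2p), where W = (B₁ + 2p B₂)/√(1+4p²) is a single Brownian motion.

The comparison then has three steps.

Quadratic part: two-stars in the x_e are orthogonal unless they have the same edges, so their sum
has variance O(n³). It is a martingale as the vertices are revealed, and Doob's inequality makes its
sup norm, after division by 2n², O(n^{-1/2}) in L².

Linear part: it equals ∑ x_e h_e with fixed paths h_e of norm O(1/n). Lindeberg replacement in the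
Banach space D² exchanges the x_e for centred Gaussians of variance p(1-p), at a cost of O(n^{-3})
for each of at most n² edges, because D²g is Lipschitz. Taking the Gaussians to be scaled increments
of W over steps of length 2/n² turns the sum into (m-2)/n · W(m(m-1)/n²) in the same direction
(`edgePath_edgeIncrement`).

Discretization: t² exceeds m(m-1)/n² by at most 3/n, so the distance to Z is governed by the largest
oscillation of W over n+1 intervals of length 3/n. Its L² norm is O(√(log n / n)), by a bound on E
exp(sup B²/(4L)); the logarithm comes from here only.

Since Dg may grow linearly, closeness of paths becomes closeness of expectations through the mean
value inequality and Cauchy–Schwarz (`abs_integral_sub_le_of_norm_le`). -/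

theorem abs_le_of_formNorm_le {d : ℕ} {β : SkorokhodSpace d → ℝ} {k : ℕ} {C : ℝ} (hk : k ≠ 0)
    (hC : 0 ≤ C) (hβ : ∀ (c : ℝ) v, β (c • v) = c ^ k * β v)
    (h : formNorm β ≤ ENNReal.ofReal C) (v : SkorokhodSpace d) : |β v| ≤ C * ‖v‖ ^ k := by
  rcases eq_or_ne v 0 with rfl | hv
  · have := hβ 0 0
    rw [zero_pow hk, zero_smul, zero_mul] at this
    rw [this, abs_zero]
    positivity
  have hv' : 0 < ‖v‖ := norm_pos_iff.2 hv
  set u : SkorokhodSpace d := ‖v‖⁻¹ • v with hu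
  have hu1 : ‖u‖ = 1 := by
    rw [hu, norm_smul, norm_inv, norm_norm, inv_mul_cancel₀ hv'.ne']
  have h1 : ‖β u‖ₑ ≤ ENNReal.ofReal C :=
    (le_iSup₂ (f := fun (h : SkorokhodSpace d) (_ : ‖h‖ = 1) => ‖β h‖ₑ) u hu1).trans h
  rw [Real.enorm_eq_ofReal_abs, ENNReal.ofReal_le_ofReal_iff hC] at h1
  have h2 : v = ‖v‖ • u := by rw [hu, smul_smul, mul_inv_cancel₀ hv'.ne', one_smul]
  have h3 : β v = ‖v‖ ^ k * β u := by
    conv_lhs => rw [h2]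
    exact hβ _ _
  rw [h3, abs_mul, abs_of_nonneg (by positivity), mul_comm]
  exact mul_le_mul_of_nonneg_right h1 (by positivity)

theorem one_add_enorm_pow {d : ℕ} (w : SkorokhodSpace d) (k : ℕ) :
    1 + ‖w‖ₑ ^ k = ENNReal.ofReal (1 + ‖w‖ ^ k) := by
  rw [ENNReal.ofReal_add zero_le_one (by positivity), ENNReal.ofReal_one,
    ENNReal.ofReal_pow (norm_nonneg _), ofReal_norm]

theorem le_ofReal_mul_of_div_le {a : ℝ≥0∞} {N b : ℝ} (hN : 0 ≤ N) (hb : 0 < b)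
    (h : a / ENNReal.ofReal b ≤ ENNReal.ofReal N) : a ≤ ENNReal.ofReal (N * b) := by
  rw [ENNReal.div_le_iff (by simpa using hb) ENNReal.ofReal_ne_top] at h
  rwa [ENNReal.ofReal_mul hN]

namespace MemM2

variable {d : ℕ} {g : SkorokhodSpace d → ℝ}

theorem ofReal_toReal_normM2 (hg : MemM2 g) :
    ENNReal.ofReal (normM2 g).toReal = normM2 g :=
  ENNReal.ofReal_toReal hg.normM2_lt_top.ne

theorem abs_le (hg : MemM2 g) (w : SkorokhodSpace d) :
    |g w| ≤ (normM2 g).toReal * (1 + ‖w‖ ^ 3) := by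
  have h : ‖g w‖ₑ / ENNReal.ofReal (1 + ‖w‖ ^ 3) ≤ ENNReal.ofReal (normM2 g).toReal := by
    rw [hg.ofReal_toReal_normM2, ← one_add_enorm_pow]
    refine (le_iSup (fun w : SkorokhodSpace d => ‖g w‖ₑ / (1 + ‖w‖ₑ ^ 3)) w).trans ?_
    unfold normM2
    rw [add_assoc, add_assoc]
    exact le_self_add
  have h2 := le_ofReal_mul_of_div_le ENNReal.toReal_nonneg (by positivity) h
  rwa [Real.enorm_eq_ofReal_abs, ENNReal.ofReal_le_ofReal_iff (by positivity)] at h2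

theorem abs_fderiv_le (hg : MemM2 g) (w v : SkorokhodSpace d) :
    |fderiv ℝ g w v| ≤ (normM2 g).toReal * (1 + ‖w‖) * ‖v‖ := by
  have h : normD g w / ENNReal.ofReal (1 + ‖w‖ ^ 1) ≤ ENNReal.ofReal (normM2 g).toReal := by
    rw [hg.ofReal_toReal_normM2, ← one_add_enorm_pow, pow_one]
    refine (le_iSup (fun w : SkorokhodSpace d => normD g w / (1 + ‖w‖ₑ)) w).trans ?_
    unfold normM2
    rw [add_assoc, add_assoc]
    exact le_self_add.trans le_add_self
  have h2 := le_ofReal_mul_of_div_le ENNReal.toReal_nonneg (by positivity) h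
  rw [pow_one] at h2
  have h3 := abs_le_of_formNorm_le (k := 1) one_ne_zero (by positivity)
    (fun c v => by rw [map_smul, pow_one, smul_eq_mul]) h2 v
  rwa [pow_one] at h3

theorem abs_fderiv_fderiv_sub_le (hg : MemM2 g) (w h v : SkorokhodSpace d) :
    |(fderiv ℝ (fderiv ℝ g) (w + h) - fderiv ℝ (fderiv ℝ g) w) v v|
      ≤ (normM2 g).toReal * ‖h‖ * ‖v‖ ^ 2 := by
  rcases eq_or_ne h 0 with rfl | hh
  · simp
  have h1 : normD2Diff g w h / ENNReal.ofReal ‖h‖ ≤ ENNReal.ofReal (normM2 g).toReal := by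
    rw [hg.ofReal_toReal_normM2, ofReal_norm]
    refine (le_iSup (fun h : SkorokhodSpace d => ⨆ (_ : h ≠ 0), normD2Diff g w h / ‖h‖ₑ) h
      |>.trans' (le_iSup (fun _ : h ≠ 0 => normD2Diff g w h / ‖h‖ₑ) hh)).trans ?_
    refine (le_iSup (fun w : SkorokhodSpace d => ⨆ (h : SkorokhodSpace d) (_ : h ≠ 0),
      normD2Diff g w h / ‖h‖ₑ) w).trans ?_
    unfold normM2
    exact le_add_self
  have h2 := le_ofReal_mul_of_div_le ENNReal.toReal_nonneg (norm_pos_iff.2 hh) h1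
  exact abs_le_of_formNorm_le (k := 2) two_ne_zero (by positivity)
    (fun c v => by simp only [map_smul, smul_apply, smul_eq_mul]; ring) h2 v

/-- The mean value inequality on the ball of radius r, where the derivative has operator norm at
most N(1 + r). -/
theorem abs_sub_le (hg : MemM2 g) {w v : SkorokhodSpace d} {r : ℝ} (hw : ‖w‖ ≤ r)
    (hv : ‖v‖ ≤ r) : |g w - g v| ≤ (normM2 g).toReal * (1 + r) * ‖w - v‖ := by
  have hs : Convex ℝ (Metric.closedBall (0 : SkorokhodSpace d) r) := convex_closedBall 0 r
  refine hs.norm_image_sub_le_of_norm_fderiv_le (𝕜 := ℝ)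
    (fun x _ => hg.memM.differentiable x) (fun x hx => ?_) (x := v) (y := w)
    (by simpa using hv) (by simpa using hw)
  have hr : 0 ≤ r := (norm_nonneg _).trans hw
  refine ContinuousLinearMap.opNorm_le_bound _ (by positivity) fun u => ?_
  refine (hg.abs_fderiv_le x u).trans ?_
  have hx' : ‖x‖ ≤ r := by simpa using hx
  gcongr

/-- Second-order Taylor expansion along a line: the Lipschitz bound on D²g is integrated twice by
the mean value inequality, which loses only the factor 1/6. Along a line only diagonal values of D²g
occur, and these are what `formNorm` controls. The coefficients stay anonymous because they cancel
when two moments match. -/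
theorem exists_abs_sub_quadratic_le (hg : MemM2 g) (w h : SkorokhodSpace d) :
    ∃ a b c : ℝ, ∀ y : ℝ, |g (w + y • h) - (a + b * y + c * y ^ 2)|
      ≤ (normM2 g).toReal * ‖h‖ ^ 3 * |y| ^ 3 := by
  set N := (normM2 g).toReal with hN
  have hN0 : 0 ≤ N := ENNReal.toReal_nonneg
  have hline : ∀ y : ℝ, HasDerivAt (fun y : ℝ => w + y • h) h y := fun y => by
    simpa using ((hasDerivAt_id y).smul_const h).const_add w
  have h1 : ∀ y : ℝ, HasDerivAt (fun y : ℝ => g (w + y • h)) (fderiv ℝ g (w + y • h) h) y :=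
    fun y => (hg.memM.differentiable _).hasFDerivAt.comp_hasDerivAt y (hline y)
  have h2 : ∀ y : ℝ, HasDerivAt (fun y : ℝ => fderiv ℝ g (w + y • h) h)
      (fderiv ℝ (fderiv ℝ g) (w + y • h) h h) y := fun y => by
    have := (hg.memM.differentiable_fderiv (w + y • h)).hasFDerivAt.comp_hasDerivAt y (hline y)
    simpa using this.clm_apply (hasDerivAt_const y h)
  set c₀ := fderiv ℝ (fderiv ℝ g) w h h with hc₀
  set b := fderiv ℝ g w h with hb
  have hd2 : ∀ y : ℝ, |fderiv ℝ (fderiv ℝ g) (w + y • h) h h - c₀| ≤ N * ‖h‖ ^ 3 * |y| := fun y => by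
    have := hg.abs_fderiv_fderiv_sub_le w (y • h) h
    rw [norm_smul, Real.norm_eq_abs] at this
    refine le_trans (by simpa using this) (le_of_eq ?_)
    ring
  have hd1 : ∀ y : ℝ, |fderiv ℝ g (w + y • h) h - b - c₀ * y| ≤ N * ‖h‖ ^ 3 * |y| ^ 2 := fun y => by
    have hder : ∀ z ∈ Metric.closedBall (0 : ℝ) |y|,
        HasDerivWithinAt (fun z : ℝ => fderiv ℝ g (w + z • h) h - b - c₀ * z)
          (fderiv ℝ (fderiv ℝ g) (w + z • h) h h - c₀) (Metric.closedBall 0 |y|) z := fun z _ => by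
      have := ((h2 z).sub_const b).sub ((hasDerivAt_id z).const_mul c₀)
      rw [mul_one] at this
      exact this.hasDerivWithinAt
    have := (convex_closedBall (0 : ℝ) |y|).norm_image_sub_le_of_norm_hasDerivWithin_le
      (C := N * ‖h‖ ^ 3 * |y|) hder (fun z hz => (hd2 z).trans (by
        have : |z| ≤ |y| := by simpa using hz
        gcongr)) (x := 0) (y := y) (by simp) (by simp)
    simp only [zero_smul, add_zero, mul_zero, sub_zero, Real.norm_eq_abs, ← hb, sub_self] at this
    refine this.trans (le_of_eq ?_)
    ring
  refine ⟨g w, b, c₀ / 2, fun y => ?_⟩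
  have hder : ∀ z ∈ Metric.closedBall (0 : ℝ) |y|,
      HasDerivWithinAt (fun z : ℝ => g (w + z • h) - (g w + b * z + c₀ / 2 * z ^ 2))
        (fderiv ℝ g (w + z • h) h - b - c₀ * z) (Metric.closedBall 0 |y|) z := fun z _ => by
    have := (h1 z).sub ((((hasDerivAt_id z).const_mul b).const_add (g w)).add
      ((hasDerivAt_pow 2 z).const_mul (c₀ / 2)))
    refine (this.congr_deriv ?_).hasDerivWithinAt
    push_cast
    ring
  have := (convex_closedBall (0 : ℝ) |y|).norm_image_sub_le_of_norm_hasDerivWithin_le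
    (C := N * ‖h‖ ^ 3 * |y| ^ 2) hder (fun z hz => (hd1 z).trans (by
      have : |z| ≤ |y| := by simpa using hz
      gcongr)) (x := 0) (y := y) (by simp) (by simp)
  simp only [zero_smul, add_zero, mul_zero, sub_zero, Real.norm_eq_abs, sub_self, ne_eq,
    OfNat.ofNat_ne_zero, not_false_eq_true, zero_pow] at this
  refine this.trans (le_of_eq ?_)
  ring

end MemM2

/-! ### Paths that depend on `⌊nt⌋` only -/

theorem floor_mul_lt_succ (n : ℕ) (t : I) : ⌊(n : ℝ) * t⌋₊ < n + 1 :=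
  Nat.lt_succ_of_le (Nat.floor_le_of_le (mul_le_of_le_one_right (Nat.cast_nonneg n) t.2.2))

/-- The càdlàg path `t ↦ f ⌊nt⌋`, as a linear function of `f`. -/
noncomputable def floorPath (n d : ℕ) :
    (Fin (n + 1) → EuclideanSpace ℝ (Fin d)) →ₗ[ℝ] SkorokhodSpace d where
  toFun f := SkorokhodSpace.mk (fun t => f ⟨⌊(n : ℝ) * t⌋₊, floor_mul_lt_succ n t⟩) (by
    -- The value 0 beyond n is never read, since ⌊nt⌋ ≤ n.
    have := isCadlagPath_floor n fun m => if h : m < n + 1 then f ⟨m, h⟩ else 0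
    refine (congrArg IsCadlagPath (funext fun t => ?_)).mp this
    exact dif_pos (floor_mul_lt_succ n t))
  map_add' _ _ := rfl
  map_smul' _ _ := rfl

theorem floorPath_apply {n d : ℕ} (f : Fin (n + 1) → EuclideanSpace ℝ (Fin d)) (t : I) :
    floorPath n d f t = f ⟨⌊(n : ℝ) * t⌋₊, floor_mul_lt_succ n t⟩ := rfl

/-- This is the source of strong measurability in D^d, which is not separable: discretized paths
factor through a finite-dimensional space. -/
theorem continuous_floorPath (n d : ℕ) : Continuous (floorPath n d) :=
  LinearMap.continuous_of_finiteDimensional _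

theorem SkorokhodSpace.norm_le {d : ℕ} {w : SkorokhodSpace d} {C : ℝ} (h : ∀ t, ‖w t‖ ≤ C) :
    ‖w‖ ≤ C := ciSup_le h

theorem norm_floorPath_le {n d : ℕ} {f : Fin (n + 1) → EuclideanSpace ℝ (Fin d)} {C : ℝ}
    (h : ∀ m, ‖f m‖ ≤ C) : ‖floorPath n d f‖ ≤ C :=
  SkorokhodSpace.norm_le fun _ => h _

/-! ### Lindeberg's replacement method -/

section Lindeberg

theorem integrable_pow_of_integrable_abs_cube {μ : Measure ℝ} [IsFiniteMeasure μ]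
    (h : Integrable (fun y : ℝ => |y| ^ 3) μ) {k : ℕ} (hk : k ≤ 3) :
    Integrable (fun y : ℝ => y ^ k) μ := by
  refine ((integrable_const (1 : ℝ)).add h).mono' (by fun_prop) (ae_of_all _ fun y => ?_)
  rw [Real.norm_eq_abs, abs_pow, Pi.add_apply]
  rcases le_total |y| 1 with h1 | h1
  · exact (pow_le_one₀ (abs_nonneg y) h1).trans (le_add_of_nonneg_right (by positivity))
  · exact (pow_le_pow_right₀ h1 hk).trans (le_add_of_nonneg_left zero_le_one)

theorem abs_integral_le_of_abs_le {α : Type*} [MeasurableSpace α] {μ : Measure α}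
    [IsProbabilityMeasure μ] {f : α → ℝ} {C : ℝ} (h : ∀ x, |f x| ≤ C) : |∫ x, f x ∂μ| ≤ C := by
  have := norm_integral_le_of_norm_le_const (μ := μ) (f := f) (C := C) (ae_of_all _ h)
  rwa [probReal_univ, mul_one] at this

/-- Both integrals are close to the same number, the integral of the quadratic, which sees only the
first two moments. -/
theorem abs_integral_sub_le_of_matching_moments {μ ν : Measure ℝ} [IsProbabilityMeasure μ]
    [IsProbabilityMeasure ν] (hμ : Integrable (fun y : ℝ => |y| ^ 3) μ)
    (hν : Integrable (fun y : ℝ => |y| ^ 3) ν) (h1 : ∫ y, y ∂μ = ∫ y, y ∂ν)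
    (h2 : ∫ y, y ^ 2 ∂μ = ∫ y, y ^ 2 ∂ν) {f : ℝ → ℝ} (hf : Continuous f) {a b c K : ℝ}
    (hK : ∀ y, |f y - (a + b * y + c * y ^ 2)| ≤ K * |y| ^ 3) :
    |∫ y, f y ∂μ - ∫ y, f y ∂ν| ≤ K * (∫ y, |y| ^ 3 ∂μ + ∫ y, |y| ^ 3 ∂ν) := by
  have key : ∀ ρ : Measure ℝ, IsProbabilityMeasure ρ → Integrable (fun y : ℝ => |y| ^ 3) ρ →
      |∫ y, f y ∂ρ - (a + b * ∫ y, y ∂ρ + c * ∫ y, y ^ 2 ∂ρ)| ≤ K * ∫ y, |y| ^ 3 ∂ρ := by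
    intro ρ _ hρ
    have i1 : Integrable (fun y : ℝ => y) ρ := by
      simpa using integrable_pow_of_integrable_abs_cube hρ (k := 1) (by norm_num)
    have i2 : Integrable (fun y : ℝ => y ^ 2) ρ :=
      integrable_pow_of_integrable_abs_cube hρ (by norm_num)
    have ia : Integrable (fun y : ℝ => a + b * y) ρ :=
      (integrable_const a).add (i1.const_mul b)
    have iq : Integrable (fun y : ℝ => a + b * y + c * y ^ 2) ρ := ia.add (i2.const_mul c)
    have ie : Integrable (fun y : ℝ => f y - (a + b * y + c * y ^ 2)) ρ :=
      (hρ.const_mul K).mono' (by fun_prop) (ae_of_all _ hK)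
    have hfi : Integrable f ρ := by
      refine (ie.add iq).congr (ae_of_all _ fun y => ?_)
      simp
    have hK' : ∀ y, ‖f y - (a + b * y + c * y ^ 2)‖ ≤ K * |y| ^ 3 := hK
    have : ∫ y, f y ∂ρ - (a + b * ∫ y, y ∂ρ + c * ∫ y, y ^ 2 ∂ρ)
        = ∫ y, (f y - (a + b * y + c * y ^ 2)) ∂ρ := by
      rw [integral_sub hfi iq, integral_add ia (i2.const_mul c),
        integral_add (integrable_const a) (i1.const_mul b), integral_const_mul,
        integral_const_mul]
      simp
    rw [this, ← integral_const_mul]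
    exact norm_integral_le_of_norm_le (hρ.const_mul K) (ae_of_all _ hK')
  have e1 := abs_le.1 (key μ inferInstance hμ)
  have e2 := abs_le.1 (key ν inferInstance hν)
  rw [h1, h2] at e1
  rw [abs_le, mul_add]
  constructor <;> linarith [e1.1, e1.2, e2.1, e2.2]

variable {V : Type*} [NormedAddCommGroup V] [NormedSpace ℝ V]

/-- Power mean inequality for n + 1 summands, with w at the index `none`. It serves integrability
only, so the factor depending on n is harmless. -/
theorem norm_add_sum_smul_pow_three_le {n : ℕ} (w : V) (h : Fin n → V) (x : Fin n → ℝ) :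
    ‖w + ∑ i, x i • h i‖ ^ 3
      ≤ ((n : ℝ) + 1) ^ 2 * (‖w‖ ^ 3 + ∑ i, ‖h i‖ ^ 3 * |x i| ^ 3) := by
  have h1 : ‖w + ∑ i, x i • h i‖ ≤ ∑ o : Option (Fin n), o.elim ‖w‖ fun i => |x i| * ‖h i‖ := by
    rw [Fintype.sum_option]
    refine (norm_add_le _ _).trans (add_le_add le_rfl ((norm_sum_le _ _).trans ?_))
    exact Finset.sum_le_sum fun i _ => by rw [norm_smul, Real.norm_eq_abs]; exact le_rfl
  have hnn : ∀ o ∈ (Finset.univ : Finset (Option (Fin n))),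
      0 ≤ o.elim ‖w‖ fun i => |x i| * ‖h i‖ := by
    rintro (_ | i) -
    · exact norm_nonneg w
    · exact mul_nonneg (abs_nonneg _) (norm_nonneg _)
  have h2 := pow_sum_div_card_le_sum_pow hnn 2
  rw [Finset.card_univ, Fintype.card_option, Fintype.card_fin, div_le_iff₀ (by positivity),
    Fintype.sum_option (fun o : Option (Fin n) => (o.elim ‖w‖ fun i => |x i| * ‖h i‖) ^ (2 + 1))]
    at h2
  refine (pow_le_pow_left₀ (norm_nonneg _) h1 3).trans (h2.trans (le_of_eq ?_))
  rw [mul_comm]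
  simp only [Option.elim, mul_pow, Nat.cast_add, Nat.cast_one]
  congr 2
  exact Finset.sum_congr rfl fun i _ => mul_comm _ _

theorem integrable_comp_add_sum_smul {g : V → ℝ} (hgc : Continuous g) {N : ℝ} (hN : 0 ≤ N)
    (hg : ∀ w, |g w| ≤ N * (1 + ‖w‖ ^ 3)) {n : ℕ} (h : Fin n → V) (μ : Fin n → Measure ℝ)
    [∀ i, IsProbabilityMeasure (μ i)] (hμ : ∀ i, Integrable (fun y : ℝ => |y| ^ 3) (μ i)) (w : V) :
    Integrable (fun x : Fin n → ℝ => g (w + ∑ i, x i • h i)) (Measure.pi μ) := by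
  have hi : ∀ i, Integrable (fun x : Fin n → ℝ => |x i| ^ 3) (Measure.pi μ) := fun i =>
    (measurePreserving_eval μ i).integrable_comp_of_integrable (hμ i)
  have hb : Integrable (fun x : Fin n → ℝ => N * (1 + ((n : ℝ) + 1) ^ 2 *
      (‖w‖ ^ 3 + ∑ i, ‖h i‖ ^ 3 * |x i| ^ 3))) (Measure.pi μ) :=
    (((integrable_const _).add ((integrable_const _).add (integrable_finsetSum _ fun i _ =>
      (hi i).const_mul _) |>.const_mul _)).const_mul _)
  refine hb.mono' ?_ (ae_of_all _ fun x => ?_)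
  · exact (hgc.comp (by fun_prop)).aestronglyMeasurable
  · refine (hg _).trans ?_
    gcongr
    exact norm_add_sum_smul_pow_three_le w h x

theorem measurePreserving_cons {n : ℕ} (μ : Fin (n + 1) → Measure ℝ)
    [∀ i, IsProbabilityMeasure (μ i)] :
    MeasurePreserving (fun z : ℝ × (Fin n → ℝ) => (Fin.cons z.1 z.2 : Fin (n + 1) → ℝ))
      ((μ 0).prod (Measure.pi fun i : Fin n => μ i.succ)) (Measure.pi μ) := by
  have hmp := (measurePreserving_piFinSuccAbove μ 0).symm
  simp only [Fin.succAbove_zero] at hmp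
  convert hmp using 1
  funext z
  exact (Fin.insertNth_zero' z.1 z.2).symm

theorem integral_pi_succ {n : ℕ} (μ : Fin (n + 1) → Measure ℝ) [∀ i, IsProbabilityMeasure (μ i)]
    {F : (Fin (n + 1) → ℝ) → ℝ} (hF : Integrable F (Measure.pi μ)) :
    ∫ x, F x ∂Measure.pi μ
      = ∫ z : ℝ × (Fin n → ℝ), F (Fin.cons z.1 z.2)
          ∂(μ 0).prod (Measure.pi fun i : Fin n => μ i.succ) := by
  have hmp := measurePreserving_cons μ
  rw [← hmp.map_eq, integral_map hmp.measurable.aemeasurable]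
  rw [hmp.map_eq]
  exact hF.aestronglyMeasurable

theorem integrable_pi_succ {n : ℕ} (μ : Fin (n + 1) → Measure ℝ) [∀ i, IsProbabilityMeasure (μ i)]
    {F : (Fin (n + 1) → ℝ) → ℝ} (hF : Integrable F (Measure.pi μ)) :
    Integrable (fun z : ℝ × (Fin n → ℝ) => F (Fin.cons z.1 z.2))
      ((μ 0).prod (Measure.pi fun i : Fin n => μ i.succ)) :=
  (measurePreserving_cons μ).integrable_comp_of_integrable hF

/-- **Lindeberg's replacement bound** for independent coefficients whose first two moments match. -/
theorem lindeberg_replacement {g : V → ℝ} (hgc : Continuous g) {N : ℝ} (hN : 0 ≤ N)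
    (hg : ∀ w, |g w| ≤ N * (1 + ‖w‖ ^ 3))
    (hT : ∀ w h : V, ∃ a b c : ℝ, ∀ y : ℝ,
      |g (w + y • h) - (a + b * y + c * y ^ 2)| ≤ N * ‖h‖ ^ 3 * |y| ^ 3)
    {n : ℕ} (h : Fin n → V) (μ ν : Fin n → Measure ℝ) [∀ i, IsProbabilityMeasure (μ i)]
    [∀ i, IsProbabilityMeasure (ν i)] (hμ : ∀ i, Integrable (fun y : ℝ => |y| ^ 3) (μ i))
    (hν : ∀ i, Integrable (fun y : ℝ => |y| ^ 3) (ν i)) (h1 : ∀ i, ∫ y, y ∂μ i = ∫ y, y ∂ν i)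
    (h2 : ∀ i, ∫ y, y ^ 2 ∂μ i = ∫ y, y ^ 2 ∂ν i) (w : V) :
    |∫ x, g (w + ∑ i, x i • h i) ∂Measure.pi μ - ∫ x, g (w + ∑ i, x i • h i) ∂Measure.pi ν|
      ≤ ∑ i, N * ‖h i‖ ^ 3 * (∫ y, |y| ^ 3 ∂μ i + ∫ y, |y| ^ 3 ∂ν i) := by
  -- Coordinate 0 is replaced first; its contribution is then absorbed into the base point, which
  -- must therefore be arbitrary.
  induction n generalizing w with
  | zero => simp
  | succ n ih =>
    have hcons : ∀ (y : ℝ) (x : Fin n → ℝ),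
        g (w + ∑ i, (Fin.cons y x : Fin (n + 1) → ℝ) i • h i)
          = g (w + ∑ i, x i • h i.succ + y • h 0) := fun y x => by
      rw [Fin.sum_univ_succ, add_assoc w, add_comm (∑ i, x i • h i.succ)]
      rfl
    have hcons' : ∀ (y : ℝ) (x : Fin n → ℝ),
        g (w + ∑ i, (Fin.cons y x : Fin (n + 1) → ℝ) i • h i)
          = g (w + y • h 0 + ∑ i, x i • h i.succ) := fun y x => by
      rw [hcons, add_right_comm]
    have Jμ := integrable_comp_add_sum_smul hgc hN hg h μ hμ w
    have Jν := integrable_comp_add_sum_smul hgc hN hg h ν hν w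
    have Iμ := integrable_pi_succ μ Jμ
    have Iν := integrable_pi_succ ν Jν
    have hmix : ∀ i, IsProbabilityMeasure ((Fin.cons (ν 0) (fun i : Fin n => μ i.succ) :
        Fin (n + 1) → Measure ℝ) i) := fun i => by
      refine Fin.cases ?_ (fun i => ?_) i
      · simpa using (inferInstance : IsProbabilityMeasure (ν 0))
      · simpa using (inferInstance : IsProbabilityMeasure (μ i.succ))
    have Imix : Integrable (fun z : ℝ × (Fin n → ℝ) =>
        g (w + ∑ i, (Fin.cons z.1 z.2 : Fin (n + 1) → ℝ) i • h i))
        ((ν 0).prod (Measure.pi fun i : Fin n => μ i.succ)) := by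
      refine integrable_pi_succ (Fin.cons (ν 0) (fun i : Fin n => μ i.succ))
        (integrable_comp_add_sum_smul hgc hN hg h _ (fun i => ?_) w)
      refine Fin.cases ?_ (fun i => ?_) i
      · simpa using hν 0
      · simpa using hμ i.succ
    rw [integral_pi_succ μ Jμ, integral_pi_succ ν Jν, Fin.sum_univ_succ]
    -- The intermediate expectation: coordinate 0 already has law ν 0, the others still have their
    -- laws μ.
    set Mix := ∫ z : ℝ × (Fin n → ℝ), g (w + ∑ i, (Fin.cons z.1 z.2 : Fin (n + 1) → ℝ) i • h i)
      ∂(ν 0).prod (Measure.pi fun i : Fin n => μ i.succ) with hMix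
    refine (abs_sub_le _ Mix _).trans (add_le_add ?_ ?_)
    -- Freeze the other coordinates and compare in the variable y = x 0 by Taylor expansion.
    · rw [hMix, integral_prod_symm _ Iμ, integral_prod_symm _ Imix,
        ← integral_sub Iμ.integral_prod_right Imix.integral_prod_right]
      refine abs_integral_le_of_abs_le fun x => ?_
      simp only [hcons]
      obtain ⟨a, b, c, habc⟩ := hT (w + ∑ i, x i • h i.succ) (h 0)
      exact abs_integral_sub_le_of_matching_moments (hμ 0) (hν 0) (h1 0) (h2 0)
        (hgc.comp (by fun_prop)) habc
    -- Freeze coordinate 0 at y and use the induction hypothesis at the base point w + y • h 0.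
    · rw [hMix, integral_prod _ Imix, integral_prod _ Iν,
        ← integral_sub Imix.integral_prod_left Iν.integral_prod_left]
      refine abs_integral_le_of_abs_le fun y => ?_
      simp only [hcons']
      exact ih (fun i => h i.succ) (fun i => μ i.succ) (fun i => ν i.succ) (fun i => hμ i.succ)
        (fun i => hν i.succ) (fun i => h1 i.succ) (fun i => h2 i.succ) _

end Lindeberg

/-! ### Doob's `L²` inequality in discrete time, and the Cauchy–Schwarz inequality -/

section Doob

/-- A pathwise form of Doob's inequality: the sum is a discrete integral of the running maximum
against s. Taking expectations needs only the sign of each correlation, so no filtration is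
required. -/
theorem partialSups_sq_le (s : ℕ → ℝ) (T : ℕ) :
    partialSups s T ^ 2
      ≤ 4 * s T ^ 2 - 4 * ∑ k ∈ Finset.range T, partialSups s k * (s (k + 1) - s k) := by
  have key : partialSups s T ^ 2 / 2
      ≤ partialSups s T * s T - ∑ k ∈ Finset.range T, partialSups s k * (s (k + 1) - s k) := by
    induction T with
    | zero =>
      rw [partialSups_zero, Finset.range_zero, Finset.sum_empty]
      nlinarith [sq_nonneg (s 0)]
    | succ T ih =>
      rw [Finset.sum_range_succ, partialSups_add_one]
      rcases le_total (s (T + 1)) (partialSups s T) with h | h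
      · rw [sup_eq_left.2 h]
        linarith
      · rw [sup_eq_right.2 h]
        nlinarith [sq_nonneg (s (T + 1) - partialSups s T)]
  nlinarith [sq_nonneg (partialSups s T - 2 * s T)]

variable {Ω : Type*} [MeasurableSpace Ω] {μ : Measure Ω}

theorem memLp_partialSups {s : ℕ → Ω → ℝ} {q : ℝ≥0∞} (hs : ∀ k, MemLp (s k) q μ) (T : ℕ) :
    MemLp (fun ω => partialSups (fun k => s k ω) T) q μ := by
  induction T with
  | zero => simpa only [partialSups_zero] using hs 0
  | succ T ih =>
    simp only [partialSups_add_one]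
    exact ih.sup (hs (T + 1))

/-- **Doob's `L²` inequality** for a nonnegative sequence whose increments have nonnegative
correlation with the running maximum. -/
theorem integral_partialSups_sq_le {s : ℕ → Ω → ℝ}
    (hm : ∀ k, MemLp (s k) 2 μ) {T : ℕ}
    (h : ∀ k < T, 0 ≤ ∫ ω, partialSups (fun k => s k ω) k * (s (k + 1) ω - s k ω) ∂μ) :
    ∫ ω, partialSups (fun k => s k ω) T ^ 2 ∂μ ≤ 4 * ∫ ω, s T ω ^ 2 ∂μ := by
  have hi : ∀ k, Integrable (fun ω => partialSups (fun k => s k ω) k * (s (k + 1) ω - s k ω)) μ :=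
    fun k => (memLp_partialSups hm k).integrable_mul ((hm (k + 1)).sub (hm k))
  have hi2 : Integrable (fun ω => ∑ k ∈ Finset.range T,
      partialSups (fun k => s k ω) k * (s (k + 1) ω - s k ω)) μ :=
    integrable_finsetSum _ fun k _ => hi k
  calc ∫ ω, partialSups (fun k => s k ω) T ^ 2 ∂μ
      ≤ ∫ ω, (4 * s T ω ^ 2 - 4 * ∑ k ∈ Finset.range T,
          partialSups (fun k => s k ω) k * (s (k + 1) ω - s k ω)) ∂μ :=
        integral_mono (memLp_partialSups hm T).integrable_sq
          (((hm T).integrable_sq.const_mul 4).sub (hi2.const_mul 4))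
          fun ω => partialSups_sq_le (fun k => s k ω) T
    _ = 4 * ∫ ω, s T ω ^ 2 ∂μ - 4 * ∑ k ∈ Finset.range T,
          ∫ ω, partialSups (fun k => s k ω) k * (s (k + 1) ω - s k ω) ∂μ := by
        rw [integral_sub ((hm T).integrable_sq.const_mul 4) (hi2.const_mul 4),
          integral_const_mul, integral_const_mul, integral_finsetSum _ fun k _ => hi k]
    _ ≤ 4 * ∫ ω, s T ω ^ 2 ∂μ := by
        have := Finset.sum_nonneg fun k (hk : k ∈ Finset.range T) => h k (Finset.mem_range.1 hk)
        linarith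

/-- The sign of a real number, with value `1` at `0`. -/
noncomputable def realSign (x : ℝ) : ℝ := if 0 ≤ x then 1 else -1

theorem measurable_realSign : Measurable realSign :=
  Measurable.ite measurableSet_Ici measurable_const measurable_const

theorem abs_realSign_le (x : ℝ) : |realSign x| ≤ 1 := by
  unfold realSign
  split_ifs <;> simp

theorem realSign_mul_self (x : ℝ) : realSign x * x = |x| := by
  unfold realSign
  split_ifs with h
  · rw [one_mul, abs_of_nonneg h]
  · rw [neg_one_mul, abs_of_neg (not_le.1 h)]

/-- Doob's `L²` inequality for the absolute value of a martingale. -/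
theorem integral_partialSups_abs_sq_le {M : ℕ → Ω → ℝ} (hm : ∀ k, MemLp (M k) 2 μ) {T : ℕ}
    (h : ∀ k < T, ∫ ω, partialSups (fun k => |M k ω|) k * realSign (M k ω)
      * (M (k + 1) ω - M k ω) ∂μ = 0) :
    ∫ ω, partialSups (fun k => |M k ω|) T ^ 2 ∂μ ≤ 4 * ∫ ω, M T ω ^ 2 ∂μ := by
  have hm' : ∀ k, MemLp (fun ω => |M k ω|) 2 μ := fun k => (hm k).abs
  have hP : ∀ k ω, 0 ≤ partialSups (fun k => |M k ω|) k := fun k ω =>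
    (abs_nonneg _).trans (le_partialSups (fun k => |M k ω|) k)
  refine (integral_partialSups_sq_le hm' fun k hk => ?_).trans
    (le_of_eq (by simp only [sq_abs]))
  rw [← h k hk]
  -- Convexity of the absolute value: |M (k+1)| - |M k| is at least `realSign (M k)` times the
  -- increment of M, and the running maximum is nonnegative.
  refine integral_mono_ae ?_ ?_ (ae_of_all _ fun ω => ?_)
  · have h1 : Integrable (fun ω => partialSups (fun k => |M k ω|) k * (M (k + 1) ω - M k ω)) μ :=
      (memLp_partialSups hm' k).integrable_mul ((hm (k + 1)).sub (hm k))
    have hmeas : AEStronglyMeasurable (fun ω => realSign (M k ω)) μ :=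
      (measurable_realSign.comp_aemeasurable
        (hm k).aestronglyMeasurable.aemeasurable).aestronglyMeasurable
    refine (h1.bdd_mul hmeas (c := 1) (ae_of_all _ fun ω => abs_realSign_le _)).congr
      (ae_of_all _ fun ω => ?_)
    simp only
    ring
  · exact (memLp_partialSups hm' k).integrable_mul ((hm' (k + 1)).sub (hm' k))
  · simp only
    rw [mul_assoc]
    refine mul_le_mul_of_nonneg_left ?_ (hP k ω)
    rw [mul_sub]
    have h1 : realSign (M k ω) * M k ω = |M k ω| := realSign_mul_self _
    have h2 : realSign (M k ω) * M (k + 1) ω ≤ |M (k + 1) ω| := by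
      refine (le_abs_self _).trans ?_
      rw [abs_mul]
      exact mul_le_of_le_one_left (abs_nonneg _) (abs_realSign_le _)
    linarith

theorem integral_mul_le_sqrt_mul_sqrt {f g : Ω → ℝ} (hf : MemLp f 2 μ) (hg : MemLp g 2 μ)
    (hf0 : 0 ≤ᵐ[μ] f) (hg0 : 0 ≤ᵐ[μ] g) :
    ∫ ω, f ω * g ω ∂μ ≤ √(∫ ω, f ω ^ 2 ∂μ) * √(∫ ω, g ω ^ 2 ∂μ) := by
  have := integral_mul_le_Lp_mul_Lq_of_nonneg (μ := μ) Real.HolderConjugate.two_two hf0 hg0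
    (by simpa using hf) (by simpa using hg)
  simpa only [Real.sqrt_eq_rpow, Real.rpow_two] using this

theorem integral_le_sqrt_integral_sq [IsProbabilityMeasure μ] {f : Ω → ℝ} (hf : MemLp f 2 μ)
    (hf0 : 0 ≤ᵐ[μ] f) : ∫ ω, f ω ∂μ ≤ √(∫ ω, f ω ^ 2 ∂μ) := by
  simpa using integral_mul_le_sqrt_mul_sqrt hf (memLp_const (1 : ℝ)) hf0
    (ae_of_all _ fun _ => zero_le_one)

end Doob

/-! ### Gaussian exponential moments and the maximum of Brownian motion -/

section Gaussian

theorem gaussianPDFReal_mul_exp_sq (v : ℝ≥0) (a x : ℝ) :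
    gaussianPDFReal 0 v x * Real.exp (a * x ^ 2)
      = (√(2 * Real.pi * v))⁻¹ * Real.exp (-((2 * (v : ℝ))⁻¹ - a) * x ^ 2) := by
  rw [gaussianPDFReal, mul_assoc, ← Real.exp_add]
  congr 2
  rw [sub_zero, div_eq_mul_inv]
  ring

theorem integrable_exp_mul_sq_gaussianReal {v : ℝ≥0} {a : ℝ} (h : 2 * a * v < 1) :
    Integrable (fun x => Real.exp (a * x ^ 2)) (gaussianReal 0 v) := by
  rcases eq_or_ne v 0 with rfl | hv
  · rw [gaussianReal_zero_var]
    exact integrable_dirac (by simp)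
  have hv' : (0 : ℝ) < v := by positivity
  rw [gaussianReal_of_var_ne_zero _ hv, gaussianPDF_def,
    integrable_withDensity_iff_integrable_smul' (by fun_prop) (ae_of_all _ fun _ => by simp)]
  have hb : 0 < (2 * (v : ℝ))⁻¹ - a := by
    rw [sub_pos, inv_eq_one_div, lt_div_iff₀ (by positivity)]
    linarith
  refine ((integrable_exp_neg_mul_sq hb).const_mul (√(2 * Real.pi * v))⁻¹).congr
    (ae_of_all _ fun x => ?_)
  simp only [smul_eq_mul]
  rw [ENNReal.toReal_ofReal (gaussianPDFReal_nonneg _ _ _), gaussianPDFReal_mul_exp_sq]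

theorem integral_exp_mul_sq_gaussianReal {v : ℝ≥0} {a : ℝ} (h : 2 * a * v < 1) :
    ∫ x, Real.exp (a * x ^ 2) ∂gaussianReal 0 v = √(1 - 2 * a * v)⁻¹ := by
  rcases eq_or_ne v 0 with rfl | hv
  · rw [gaussianReal_zero_var, integral_dirac]
    simp
  have hv' : (0 : ℝ) < v := by positivity
  have hb : 0 < (2 * (v : ℝ))⁻¹ - a := by
    rw [sub_pos, inv_eq_one_div, lt_div_iff₀ (by positivity)]
    linarith
  rw [integral_gaussianReal_eq_integral_smul hv]
  simp only [smul_eq_mul, gaussianPDFReal_mul_exp_sq]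
  rw [integral_const_mul, integral_gaussian, ← Real.sqrt_inv, ← Real.sqrt_mul (by positivity)]
  congr 1
  have h1 : 1 - 2 * a * v ≠ 0 := by linarith
  have h2 : (2 * (v : ℝ))⁻¹ - a = (1 - 2 * a * v) / (2 * v) := by
    field_simp
  rw [h2]
  field_simp

end Gaussian

/-! ### Brownian motion: combinations, exponential maximal bounds, oscillations -/

section Brownian

variable {Ω : Type*} [MeasurableSpace Ω] {P : Measure Ω}

/-- A normalized linear combination of independent Brownian motions is a Brownian motion. -/
theorem isBrownianReal_add {B₁ B₂ : ℝ≥0 → Ω → ℝ} (hL : IsBrownianReal B₁ P)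
    (hR : IsBrownianReal B₂ P) (h : IndepFun (fun ω t => B₁ t ω) (fun ω t => B₂ t ω) P)
    {a b : ℝ} (hab : a ^ 2 + b ^ 2 = 1) :
    IsBrownianReal (fun t ω => a * B₁ t ω + b * B₂ t ω) P := by
  have := hL.isGaussianProcess.isProbabilityMeasure
  have m₁ : ∀ t, MemLp (B₁ t) 2 P := fun t =>
    (hL.isGaussianProcess.hasGaussianLaw_eval t).memLp_two
  have m₂ : ∀ t, MemLp (B₂ t) 2 P := fun t =>
    (hR.isGaussianProcess.hasGaussianLaw_eval t).memLp_two
  have hind : ∀ s t, IndepFun (B₁ s) (B₂ t) P := fun s t =>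
    h.comp (measurable_pi_apply s) (measurable_pi_apply t)
  refine ⟨IsGaussianProcess.isPreBrownianReal_of_covariance ⟨fun J => ?_⟩ (fun t => ?_)
    (fun s t hst => ?_), ?_⟩
  · have hI := IndepFun.hasGaussianLaw (hL.isGaussianProcess.hasGaussianLaw J)
      (hR.isGaussianProcess.hasGaussianLaw J)
      (h.comp (φ := J.restrict) (ψ := J.restrict) (by fun_prop) (by fun_prop))
    exact hI.map (a • ContinuousLinearMap.fst ℝ (J → ℝ) (J → ℝ)
      + b • ContinuousLinearMap.snd ℝ (J → ℝ) (J → ℝ))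
  · rw [integral_add ((hL.integrable_eval t).const_mul a) ((hR.integrable_eval t).const_mul b),
      integral_const_mul, integral_const_mul, hL.integral_eval, hR.integral_eval]
    simp
  · change cov[(fun ω => a * B₁ s ω) + fun ω => b * B₂ s ω,
      (fun ω => a * B₁ t ω) + fun ω => b * B₂ t ω; P] = s
    rw [covariance_add_left ((m₁ s).const_mul a) ((m₂ s).const_mul b)
        (((m₁ t).const_mul a).add ((m₂ t).const_mul b)),
      covariance_add_right ((m₁ s).const_mul a) ((m₁ t).const_mul a) ((m₂ t).const_mul b),
      covariance_add_right ((m₂ s).const_mul b) ((m₁ t).const_mul a) ((m₂ t).const_mul b)]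
    simp only [covariance_const_mul_left, covariance_const_mul_right]
    rw [hL.covariance_fun_eval, hR.covariance_fun_eval,
      (hind s t).covariance_eq_zero (m₁ s) (m₂ t),
      (hind t s).symm.covariance_eq_zero (m₂ s) (m₁ t), min_eq_left hst]
    linear_combination (s : ℝ) * hab
  · filter_upwards [hL.cont, hR.cont] with ω c₁ c₂
    fun_prop

/-- The graph of the convex function exp(y²/(8L)) lies above its tangent at x. Along Brownian motion
the tangent term is a martingale increment, which gives the submartingale property. -/
theorem exp_sq_sub_le {L : ℝ} (hL : 0 < L) (x y : ℝ) :
    x / (4 * L) * Real.exp (x ^ 2 / (8 * L)) * (y - x)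
      ≤ Real.exp (y ^ 2 / (8 * L)) - Real.exp (x ^ 2 / (8 * L)) := by
  have h1 : Real.exp (x ^ 2 / (8 * L)) * (2 * x * (y - x) / (8 * L) + 1)
      ≤ Real.exp (y ^ 2 / (8 * L)) := by
    refine (mul_le_mul_of_nonneg_left (Real.add_one_le_exp _) (Real.exp_nonneg _)).trans ?_
    rw [← Real.exp_add, Real.exp_le_exp, ← add_div]
    gcongr
    nlinarith [sq_nonneg (x - y)]
  have h2 : x / (4 * L) = 2 * x / (8 * L) := by
    rw [div_eq_div_iff] <;> [ring; positivity; positivity]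
  rw [h2]
  have h3 : 2 * x / (8 * L) * Real.exp (x ^ 2 / (8 * L)) * (y - x)
      = Real.exp (x ^ 2 / (8 * L)) * (2 * x * (y - x) / (8 * L) + 1)
        - Real.exp (x ^ 2 / (8 * L)) := by ring
  linarith

theorem partialSups_congr_le {f g : ℕ → ℝ} {k : ℕ} (h : ∀ j ≤ k, f j = g j) :
    partialSups f k = partialSups g k := by
  induction k with
  | zero => simpa only [partialSups_zero] using h 0 le_rfl
  | succ k ih =>
    rw [partialSups_add_one, partialSups_add_one, h (k + 1) le_rfl, ih fun j hj => h j (by omega)]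

theorem measurable_partialSups_comp {α : Type*} [MeasurableSpace α] {f : ℕ → α → ℝ}
    (hf : ∀ k, Measurable (f k)) (k : ℕ) : Measurable fun x => partialSups (fun j => f j x) k := by
  induction k with
  | zero => simpa only [partialSups_zero] using hf 0
  | succ k ih =>
    simp only [partialSups_add_one]
    exact ih.sup (hf (k + 1))

theorem memLp_two_of_sq_le {f h : Ω → ℝ} (hf : AEMeasurable f P) (hh : Integrable h P)
    (hfh : ∀ ω, f ω ^ 2 ≤ h ω) : MemLp f 2 P :=
  (memLp_two_iff_integrable_sq hf.aestronglyMeasurable).2 <|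
    hh.mono' (hf.pow_const 2).aestronglyMeasurable
      (ae_of_all _ fun ω => by rw [Real.norm_of_nonneg (sq_nonneg _)]; exact hfh ω)

theorem integrable_exp_mul_sq_of_hasLaw {X : Ω → ℝ} {v : ℝ≥0} (hX : HasLaw X (gaussianReal 0 v) P)
    {a : ℝ} (h : 2 * a * v < 1) : Integrable (fun ω => Real.exp (a * X ω ^ 2)) P := by
  have := integrable_exp_mul_sq_gaussianReal h
  rw [← hX.map_eq] at this
  exact this.comp_aemeasurable hX.aemeasurable

/-- Doob's inequality for the exponential of the square of a pre-Brownian motion. -/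
theorem integral_partialSups_exp_sq_le {B : ℝ≥0 → Ω → ℝ} (hB : IsPreBrownianReal B P) {L : ℝ≥0}
    (hL : 0 < L) {t : ℕ → ℝ≥0} (ht : Monotone t) (htL : ∀ k, t k ≤ L) (T : ℕ) :
    Integrable (fun ω => partialSups (fun k => Real.exp (B (t k) ω ^ 2 / (8 * L))) T ^ 2) P ∧
    ∫ ω, partialSups (fun k => Real.exp (B (t k) ω ^ 2 / (8 * L))) T ^ 2 ∂P ≤ 4 * √2 := by
  have := hB.isGaussianProcess.isProbabilityMeasure
  have hL' : (0 : ℝ) < L := hL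
  set s : ℕ → Ω → ℝ := fun k ω => Real.exp (B (t k) ω ^ 2 / (8 * L)) with hs
  have hBm : ∀ u, AEMeasurable (B u) P := hB.aemeasurable
  -- For variance at most L, exp(c B²/(2L)) is integrable whenever c < 1. The value c = 1/2 gives
  -- the square of s; c = 3/4 leaves room for the extra factor B² in the square of the tangent
  -- slope.
  have hvar : ∀ (k : ℕ) (c : ℝ), 0 ≤ c → c < 1 → 2 * (c / (2 * L)) * t k < 1 := fun k c hc0 hc => by
    have h1 : (t k : ℝ) ≤ L := htL k
    calc 2 * (c / (2 * L)) * t k ≤ 2 * (c / (2 * L)) * L := by gcongr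
      _ = c := by field_simp
      _ < 1 := hc
  have hint : ∀ (k : ℕ) (c : ℝ), 0 ≤ c → c < 1 →
      Integrable (fun ω => Real.exp (c / (2 * L) * B (t k) ω ^ 2)) P := fun k c hc0 hc =>
    integrable_exp_mul_sq_of_hasLaw (hB.hasLaw_eval (t k)) (hvar k c hc0 hc)
  have hs2 : ∀ k ω, s k ω ^ 2 = Real.exp ((1 / 2) / (2 * L) * B (t k) ω ^ 2) := fun k ω => by
    rw [hs, ← Real.exp_nat_mul]
    congr 1
    field_simp
    ring
  have hsm : ∀ k, AEMeasurable (s k) P := fun k => by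
    have := hBm (t k)
    fun_prop
  have hsL : ∀ k, MemLp (s k) 2 P := fun k =>
    memLp_two_of_sq_le (hsm k) (hint k (1 / 2) (by norm_num) (by norm_num)) fun ω => (hs2 k ω).le
  have hd : ∀ k, MemLp (fun ω => B (t k) ω / (4 * L) * s k ω) 2 P := fun k => by
    have := hBm (t k)
    refine memLp_two_of_sq_le (h := fun ω => (2 * (L : ℝ))⁻¹ *
      Real.exp ((3 / 4) / (2 * L) * B (t k) ω ^ 2)) (by fun_prop)
      ((hint k (3 / 4) (by norm_num) (by norm_num)).const_mul _) fun ω => ?_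
    rw [mul_pow, hs2, div_pow]
    have h1 : B (t k) ω ^ 2 / (8 * L) ≤ Real.exp ((1 / 4) / (2 * L) * B (t k) ω ^ 2) := by
      refine le_trans (le_of_eq ?_) ((le_add_of_nonneg_right zero_le_one).trans
        (Real.add_one_le_exp _))
      field_simp
      ring
    have h2 : Real.exp ((3 / 4) / (2 * L) * B (t k) ω ^ 2)
        = Real.exp ((1 / 4) / (2 * L) * B (t k) ω ^ 2)
          * Real.exp ((1 / 2) / (2 * L) * B (t k) ω ^ 2) := by
      rw [← Real.exp_add]
      congr 1
      ring
    rw [h2, ← mul_assoc]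
    refine mul_le_mul_of_nonneg_right (le_trans (le_of_eq ?_)
      (mul_le_mul_of_nonneg_left h1 (by positivity))) (Real.exp_nonneg _)
    field_simp
    ring
  have hincr : ∀ k, MemLp (fun ω => B (t (k + 1)) ω - B (t k) ω) 2 P := fun k =>
    (hB.isGaussianProcess.hasGaussianLaw_eval _).memLp_two.sub
      (hB.isGaussianProcess.hasGaussianLaw_eval _).memLp_two
  have hind : ∀ k, IndepFun (fun ω => partialSups (fun j => s j ω) k * (B (t k) ω / (4 * L) * s k ω))
      (fun ω => B (t (k + 1)) ω - B (t k) ω) P := fun k => by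
    have hle : ∀ j, t (min j k) ≤ t k := fun j => ht (min_le_right j k)
    -- The running maximum times the tangent slope, as a functional of the path up to time t k.
    -- Truncating indices at k keeps all the times read inside `Iic (t k)`.
    let φ : (Iic (t k) → ℝ) → ℝ := fun z =>
      partialSups (fun j => Real.exp (z ⟨t (min j k), hle j⟩ ^ 2 / (8 * L))) k *
        (z ⟨t k, le_refl (t k)⟩ / (4 * L) * Real.exp (z ⟨t k, le_refl (t k)⟩ ^ 2 / (8 * L)))
    have hφ : Measurable φ :=
      (measurable_partialSups_comp (fun j => by fun_prop) k).mul (by fun_prop)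
    have h := (hB.indepFun_shift (t k)).symm.comp hφ (measurable_pi_apply (t (k + 1) - t k))
    convert h using 1
    · funext ω
      refine congrArg (· * _) (partialSups_congr_le fun j hj => ?_)
      simp only [hs, min_eq_left hj]
    · funext ω
      simp only [Function.comp_apply, add_tsub_cancel_of_le (ht (Nat.le_succ k))]
  have hprod : ∀ k, Integrable
      (fun ω => partialSups (fun j => s j ω) k * (B (t k) ω / (4 * L) * s k ω)) P := fun k =>
    (memLp_partialSups hsL k).integrable_mul (hd k)
  refine ⟨(memLp_partialSups hsL T).integrable_sq, (integral_partialSups_sq_le hsL fun k _ => ?_).trans ?_⟩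
  · have hzero : ∫ ω, partialSups (fun j => s j ω) k * (B (t k) ω / (4 * L) * s k ω)
        * (B (t (k + 1)) ω - B (t k) ω) ∂P = 0 := by
      rw [(hind k).integral_fun_mul_eq_mul_integral (hprod k).aestronglyMeasurable
        (hincr k).aestronglyMeasurable, integral_sub (hB.integrable_eval _) (hB.integrable_eval _),
        hB.integral_eval, hB.integral_eval, sub_zero, mul_zero]
    rw [← hzero]
    refine integral_mono ?_ ?_ fun ω => ?_
    · exact (hind k).integrable_mul (hprod k) ((hincr k).integrable (by norm_num))
    · exact (memLp_partialSups hsL k).integrable_mul ((hsL (k + 1)).sub (hsL k))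
    · simp only
      rw [mul_assoc]
      refine mul_le_mul_of_nonneg_left (exp_sq_sub_le hL' _ _) ?_
      exact (Real.exp_nonneg _).trans (le_partialSups (fun j => s j ω) k)
  -- With c = 1/2 the Gaussian integral is (1 - t T/(2L))^{-1/2}, which is at most √2; Doob
  -- contributes the factor 4.
  · simp only [hs2]
    have h1 := (hB.hasLaw_eval (t T)).integral_comp (f := fun x => Real.exp ((1 / 2) / (2 * L) * x ^ 2))
      (by fun_prop)
    simp only [Function.comp_def] at h1
    rw [h1, integral_exp_mul_sq_gaussianReal (hvar T (1 / 2) (by norm_num) (by norm_num))]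
    have h2 : 2 * (1 / 2 / (2 * (L : ℝ))) * t T ≤ 1 / 2 := by
      have h1 : (t T : ℝ) ≤ L := htL T
      calc 2 * (1 / 2 / (2 * (L : ℝ))) * t T ≤ 2 * (1 / 2 / (2 * (L : ℝ))) * L := by gcongr
        _ = 1 / 2 := by field_simp
    gcongr
    rw [inv_le_comm₀ (by linarith) (by norm_num)]
    linarith

/-- The exponential of the square of a Brownian motion on `[0, L]` is dominated by a random variable
with an explicit bound on its expectation. -/
theorem exists_lintegral_le_exp_sq_le {B : ℝ≥0 → Ω → ℝ} (hB : IsBrownianReal B P) {L : ℝ≥0}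
    (hL : 0 < L) : ∃ H : Ω → ℝ≥0∞, AEMeasurable H P ∧ ∫⁻ ω, H ω ∂P ≤ ENNReal.ofReal (4 * √2) ∧
      ∀ᵐ ω ∂P, ∀ u ≤ L, ENNReal.ofReal (Real.exp (B u ω ^ 2 / (4 * L))) ≤ H ω := by
  have hL' : (0 : ℝ) < L := hL
  -- Equispaced grids on [0, L], stopped at L so that each is a monotone sequence bounded by L.
  let t : ℕ → ℕ → ℝ≥0 := fun N k => min (k * (L / (N + 1))) L
  have ht : ∀ N, Monotone (t N) := fun N i j hij => by
    refine min_le_min_right L ?_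
    gcongr
  have hdoob := fun N => integral_partialSups_exp_sq_le hB.toIsPreBrownianReal hL (ht N)
    (fun k => min_le_right _ _) (N + 1)
  let S : ℕ → Ω → ℝ := fun N ω =>
    partialSups (fun k => Real.exp (B (t N k) ω ^ 2 / (8 * L))) (N + 1) ^ 2
  have hS : ∀ N, AEMeasurable (fun ω => ENNReal.ofReal (S N ω)) P := fun N =>
    (hdoob N).1.aestronglyMeasurable.aemeasurable.ennreal_ofReal
  -- These grids are not nested, so the maxima need not increase with N; Fatou's lemma replaces
  -- monotone convergence.
  refine ⟨fun ω => liminf (fun N => ENNReal.ofReal (S N ω)) atTop, ?_, ?_, ?_⟩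
  · simp only [liminf_eq_iSup_iInf_of_nat]
    exact .iSup fun N => .biInf _ (to_countable _) fun k _ => hS k
  · refine (lintegral_liminf_le' hS).trans ?_
    refine (liminf_le_liminf (v := fun _ => ENNReal.ofReal (4 * √2)) (.of_forall fun N => ?_)).trans
      (liminf_const _).le
    rw [← ofReal_integral_eq_lintegral_ofReal (hdoob N).1 (ae_of_all _ fun ω => sq_nonneg _)]
    exact ENNReal.ofReal_le_ofReal (hdoob N).2
  · filter_upwards [hB.cont] with ω hω u hu
    -- The last grid point not exceeding u; these points tend to u, and path continuity carries the
    -- bound to time u.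
    let k : ℕ → ℕ := fun N => ⌊u / (L / (N + 1 : ℝ≥0))⌋₊
    have hpos : ∀ N : ℕ, 0 < L / (N + 1 : ℝ≥0) := fun N => by positivity
    have hkN : ∀ N, k N ≤ N + 1 := fun N => by
      refine Nat.floor_le_of_le ?_
      rw [div_le_iff₀ (hpos N)]
      refine hu.trans (le_of_eq ?_)
      push_cast
      field_simp
    have hku : ∀ N, (k N : ℝ≥0) * (L / (N + 1 : ℝ≥0)) ≤ u := fun N =>
      (le_div_iff₀ (hpos N)).1 (Nat.floor_le zero_le)
    have huk : ∀ N, u ≤ (k N : ℝ≥0) * (L / (N + 1 : ℝ≥0)) + L / (N + 1 : ℝ≥0) := fun N => by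
      have := (div_le_iff₀ (hpos N)).1 (Nat.lt_floor_add_one (u / (L / (N + 1 : ℝ≥0)))).le
      rwa [add_mul, one_mul] at this
    have htk : ∀ N, t N (k N) = (k N : ℝ≥0) * (L / (N + 1 : ℝ≥0)) := fun N =>
      min_eq_left ((hku N).trans hu)
    have hlim : Tendsto (fun N => t N (k N)) atTop (𝓝 u) := by
      have h0 : Tendsto (fun N : ℕ => (L : ℝ) / (N + 1)) atTop (𝓝 0) :=
        tendsto_const_nhds.div_atTop
          (tendsto_atTop_add_const_right _ _ tendsto_natCast_atTop_atTop)
      rw [← NNReal.tendsto_coe]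
      refine tendsto_of_tendsto_of_tendsto_of_le_of_le
        (by simpa using (tendsto_const_nhds (x := (u : ℝ))).sub h0) tendsto_const_nhds
        (fun N => ?_) (fun N => ?_)
      · have := NNReal.coe_le_coe.2 (huk N)
        rw [← htk] at this
        push_cast at this
        simp only
        linarith
      · simp only
        rw [htk]
        exact NNReal.coe_le_coe.2 (hku N)
    have hlim2 : Tendsto (fun N => ENNReal.ofReal (Real.exp (B (t N (k N)) ω ^ 2 / (4 * L)))) atTop
        (𝓝 (ENNReal.ofReal (Real.exp (B u ω ^ 2 / (4 * L))))) := by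
      have hc : Continuous fun v => ENNReal.ofReal (Real.exp (B v ω ^ 2 / (4 * L))) :=
        ENNReal.continuous_ofReal.comp (by fun_prop)
      exact (hc.tendsto u).comp hlim
    rw [← hlim2.liminf_eq]
    refine liminf_le_liminf (.of_forall fun N => ENNReal.ofReal_le_ofReal ?_)
    have h1 := le_partialSups_of_le (fun k => Real.exp (B (t N k) ω ^ 2 / (8 * L))) (hkN N)
    refine le_trans (le_of_eq ?_) (pow_le_pow_left₀ (Real.exp_nonneg _) h1 2)
    rw [← Real.exp_nat_mul]
    congr 1
    field_simp
    ring

/-- The maximum of the oscillations of a Brownian motion on finitely many intervals of the same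
length. -/
theorem exists_integral_le_exp_sq_sub_le {B : ℝ≥0 → Ω → ℝ} (hB : IsBrownianReal B P) {L : ℝ≥0}
    (hL : 0 < L) {ι : Type*} [Fintype ι] (a : ι → ℝ≥0) :
    ∃ H : Ω → ℝ, Integrable H P ∧ ∫ ω, H ω ∂P ≤ Fintype.card ι * (4 * √2) ∧
      ∀ᵐ ω ∂P, ∀ i, ∀ u ≤ L, Real.exp ((B (a i + u) ω - B (a i) ω) ^ 2 / (4 * L)) ≤ H ω := by
  choose G hGm hGi hG using fun i => exists_lintegral_le_exp_sq_le (hB.shift (a i)) hL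
  have hfin : ∀ i, ∫⁻ ω, G i ω ∂P ≠ ∞ := fun i => ne_top_of_le_ne_top ENNReal.ofReal_ne_top (hGi i)
  have hInt : ∀ i, Integrable (fun ω => (G i ω).toReal) P := fun i =>
    integrable_toReal_of_lintegral_ne_top (hGm i) (hfin i)
  -- The sum dominates each term, hence the maximum. This costs a factor `card ι`, which later
  -- appears only inside a logarithm.
  refine ⟨fun ω => ∑ i, (G i ω).toReal, integrable_finsetSum _ fun i _ => hInt i, ?_, ?_⟩
  · rw [integral_finsetSum _ fun i _ => hInt i]
    refine (Finset.sum_le_card_nsmul _ _ (4 * √2) fun i _ => ?_).trans (by simp)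
    rw [integral_toReal (hGm i) (ae_lt_top' (hGm i) (hfin i))]
    exact ENNReal.toReal_le_of_le_ofReal (by positivity) (hGi i)
  · have h1 : ∀ᵐ ω ∂P, ∀ i, G i ω < ∞ := ae_all_iff.2 fun i => ae_lt_top' (hGm i) (hfin i)
    filter_upwards [ae_all_iff.2 hG, h1] with ω h2 h3 i u hu
    have h4 := (ENNReal.ofReal_le_iff_le_toReal (h3 i).ne).1 (h2 i u hu)
    exact h4.trans (Finset.single_le_sum (f := fun i => (G i ω).toReal)
      (fun j _ => ENNReal.toReal_nonneg) (Finset.mem_univ i))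

/-- The tangent to log at K gives log H ≤ H/K + log K - 1. This is Jensen's inequality in pointwise
form: if E H ≤ K, the right side has mean at most 4 L log K. -/
theorem sq_le_of_exp_sq_le {x L H K : ℝ} (hL : 0 < L) (hK : 0 < K)
    (h : Real.exp (x ^ 2 / (4 * L)) ≤ H) : x ^ 2 ≤ 4 * L * (H / K + Real.log K - 1) := by
  have hH : 0 < H := (Real.exp_pos _).trans_le h
  have h1 : x ^ 2 / (4 * L) ≤ Real.log H := (Real.le_log_iff_exp_le hH).2 h
  have h2 := Real.log_le_sub_one_of_pos (div_pos hH hK)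
  rw [Real.log_div hH.ne' hK.ne'] at h2
  rw [div_le_iff₀ (by positivity)] at h1
  nlinarith

theorem pow_four_le_of_exp_sq_le {x L H : ℝ} (hL : 0 < L)
    (h : Real.exp (x ^ 2 / (4 * L)) ≤ H) : x ^ 4 ≤ 2 * (4 * L) ^ 2 * H := by
  have h1 : (x ^ 2 / (4 * L)) ^ 2 / 2 ≤ H :=
    (Real.quadratic_le_exp_of_nonneg (by positivity)).trans' (by
      have : 0 ≤ x ^ 2 / (4 * L) := by positivity
      linarith) |>.trans h
  have h2 : x ^ 4 = 2 * (4 * L) ^ 2 * ((x ^ 2 / (4 * L)) ^ 2 / 2) := by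
    field_simp
  rw [h2]
  gcongr

end Brownian

/-! ### Coupling the limit with a Gaussian process on the grid -/

section Coupling

variable {Ω : Type*} [MeasurableSpace Ω] {P : Measure Ω}

theorem log_four_mul_sqrt_two_le : Real.log (4 * √2) ≤ 7 / 4 := by
  have h : Real.log (4 * √2) = 5 / 2 * Real.log 2 := by
    rw [Real.log_mul (by norm_num) (by positivity), Real.log_sqrt (by norm_num),
      show (4 : ℝ) = 2 ^ 2 by norm_num, Real.log_pow]
    push_cast
    ring
  rw [h]
  linarith [Real.log_two_lt_d9]

/-- Square-integrable bound on the oscillations of a Brownian motion on finitely many intervals. -/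
theorem exists_memLp_abs_sub_le {B : ℝ≥0 → Ω → ℝ} (hB : IsBrownianReal B P) {L : ℝ≥0}
    (hL : 0 < L) {ι : Type*} [Fintype ι] [Nonempty ι] (a : ι → ℝ≥0) :
    ∃ q : Ω → ℝ, MemLp q 2 P ∧ (∀ ω, 0 ≤ q ω) ∧
      ∫ ω, q ω ^ 2 ∂P ≤ 4 * L * Real.log (Fintype.card ι * (4 * √2)) ∧
      ∀ᵐ ω ∂P, ∀ i, ∀ u ≤ L, |B (a i + u) ω - B (a i) ω| ≤ q ω := by
  have := hB.isGaussianProcess.isProbabilityMeasure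
  have hL' : (0 : ℝ) < L := hL
  obtain ⟨H, hHi, hHle, hH⟩ := exists_integral_le_exp_sq_sub_le hB hL a
  set K : ℝ := Fintype.card ι * (4 * √2) with hK
  have hK0 : 0 < K := by
    have : (0 : ℝ) < Fintype.card ι := Nat.cast_pos.2 Fintype.card_pos
    positivity
  set Q : Ω → ℝ := fun ω => 4 * L * (H ω / K + Real.log K - 1) with hQ
  have hQi : Integrable Q P :=
    ((((hHi.div_const K).add (integrable_const _)).sub (integrable_const _)).const_mul _)
  have hQle : ∀ᵐ ω ∂P, ∀ i, ∀ u ≤ L, (B (a i + u) ω - B (a i) ω) ^ 2 ≤ Q ω := by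
    filter_upwards [hH] with ω hω i u hu
    exact sq_le_of_exp_sq_le hL' hK0 (hω i u hu)
  have hQ0 : ∀ᵐ ω ∂P, 0 ≤ Q ω := by
    filter_upwards [hQle] with ω hω
    exact (sq_nonneg _).trans (hω (Classical.arbitrary ι) 0 zero_le)
  have hsq : (fun ω => √(Q ω) ^ 2) =ᵐ[P] Q := by
    filter_upwards [hQ0] with ω hω
    exact Real.sq_sqrt hω
  refine ⟨fun ω => √(Q ω), ?_, fun ω => Real.sqrt_nonneg _, ?_, ?_⟩
  · exact (memLp_two_iff_integrable_sq (Real.continuous_sqrt.comp_aestronglyMeasurable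
      hQi.aestronglyMeasurable)).2 (hQi.congr hsq.symm)
  · have h2 : ∫ ω, (H ω / K + (Real.log K - 1)) ∂P = (∫ ω, H ω ∂P) / K + (Real.log K - 1) := by
      rw [integral_add (hHi.div_const K) (integrable_const _), integral_div]
      simp
    have h1 : (∫ ω, H ω ∂P) / K ≤ 1 := (div_le_one hK0).2 hHle
    rw [integral_congr_ae hsq, hQ, integral_const_mul]
    simp only [add_sub_assoc]
    rw [h2]
    refine mul_le_mul_of_nonneg_left ?_ (by positivity)
    linarith
  · filter_upwards [hQle] with ω hω i u hu
    exact Real.abs_le_sqrt (hω i u hu)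

/-- Supplies the integrable bound needed for functionals of cubic growth. The fourth power is used
because the exponential bound controls powers of B². -/
theorem exists_integrable_pow_four_abs_le {B : ℝ≥0 → Ω → ℝ} (hB : IsBrownianReal B P) :
    ∃ r : Ω → ℝ, Integrable (fun ω => r ω ^ 4) P ∧ (∀ ω, 0 ≤ r ω) ∧
      ∀ᵐ ω ∂P, ∀ u ≤ 1, |B u ω| ≤ r ω := by
  obtain ⟨H, hHi, -, hH⟩ := exists_integral_le_exp_sq_sub_le hB one_pos fun _ : Unit => 0
  have hpow : ∀ᵐ ω ∂P, ∀ u ≤ 1, B u ω ^ 4 ≤ 32 * H ω := by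
    filter_upwards [hH, hB.eval_zero_ae_eq_zero] with ω hω h0 u hu
    have h1 := pow_four_le_of_exp_sq_le (L := 1) one_pos (hω () u hu)
    rw [zero_add, h0, sub_zero] at h1
    refine h1.trans (le_of_eq ?_)
    norm_num
  refine ⟨fun ω => √√(32 * H ω), ?_, fun ω => Real.sqrt_nonneg _, ?_⟩
  · refine (hHi.const_mul 32).congr ?_
    filter_upwards [hpow] with ω hω
    have h0 : 0 ≤ 32 * H ω := (by positivity : (0 : ℝ) ≤ B 0 ω ^ 4).trans (hω 0 zero_le_one)
    rw [show √√(32 * H ω) ^ 4 = (√√(32 * H ω) ^ 2) ^ 2 by ring, Real.sq_sqrt (Real.sqrt_nonneg _),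
      Real.sq_sqrt h0]
  · filter_upwards [hpow] with ω hω u hu
    refine Real.abs_le_sqrt (Real.le_sqrt_of_sq_le ?_)
    rw [← pow_mul]
    exact hω u hu

/-- The path `t ↦ t W(t²)` in the direction `e`, read off at the times `k / N`. -/
noncomputable def gridPath (N : ℕ) (e : EuclideanSpace ℝ (Fin 2)) (w : ℝ≥0 → ℝ) :
    SkorokhodSpace 2 :=
  floorPath N 2 fun k => ((k : ℝ) / N * w (((k : ℕ) / N) ^ 2)) • e

theorem aestronglyMeasurable_floorPath {N : ℕ} {f : Ω → Fin (N + 1) → EuclideanSpace ℝ (Fin 2)}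
    (hf : ∀ k, AEMeasurable (fun ω => f ω k) P) :
    AEStronglyMeasurable (fun ω => floorPath N 2 (f ω)) P :=
  (continuous_floorPath N 2).comp_aestronglyMeasurable (aemeasurable_pi_iff.2 hf).aestronglyMeasurable

/-- The function s ↦ s w(s²) is uniformly continuous on [0, 1], and ⌊Nt⌋/N is within 1/N of t. -/
theorem tendsto_gridPath {w : ℝ≥0 → ℝ} (hw : Continuous w) (e : EuclideanSpace ℝ (Fin 2))
    {z : SkorokhodSpace 2} (hz : ∀ t, z t = ((t : ℝ) * w (unitInterval.toNNReal t ^ 2)) • e) :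
    Tendsto (fun N => gridPath N e w) atTop (𝓝 z) := by
  set φ : ℝ → EuclideanSpace ℝ (Fin 2) := fun s => (s * w (s.toNNReal ^ 2)) • e with hφ
  have hφc : Continuous φ := by
    have : Continuous fun s : ℝ => s.toNNReal := continuous_real_toNNReal
    fun_prop
  have hφu := isCompact_Icc.uniformContinuousOn_of_continuous (s := Icc (0 : ℝ) 1) hφc.continuousOn
  rw [Metric.tendsto_atTop]
  intro ε hε
  obtain ⟨δ, hδ, hδε⟩ := Metric.uniformContinuousOn_iff.1 hφu (ε / 2) (by positivity)
  obtain ⟨N₀, hN₀⟩ := exists_nat_gt (1 / δ)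
  refine ⟨N₀ + 1, fun N hN => ?_⟩
  have hN1 : (0 : ℝ) < N := by
    have : 0 < N := by omega
    exact_mod_cast this
  have hNδ : 1 / (N : ℝ) < δ := by
    rw [div_lt_comm₀ hN1 hδ]
    refine hN₀.trans_le ?_
    exact_mod_cast (by omega : N₀ ≤ N)
  rw [dist_eq_norm]
  refine lt_of_le_of_lt (SkorokhodSpace.norm_le fun t => ?_) (half_lt_self hε)
  set k := ⌊(N : ℝ) * t⌋₊ with hk
  have hk1 : (k : ℝ) ≤ N * t := Nat.floor_le (mul_nonneg hN1.le t.2.1)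
  have hk2 : (N : ℝ) * t < k + 1 := Nat.lt_floor_add_one _
  have hkt : (k : ℝ) / N ≤ t := by rw [div_le_iff₀ hN1]; linarith
  have hleft : gridPath N e w t = φ (k / N) := by
    rw [hφ, gridPath, floorPath_apply]
    simp only
    congr 4
    rw [← hk, Real.toNNReal_div (by positivity), Real.toNNReal_natCast, Real.toNNReal_natCast]
  have hright : z t = φ t := by
    rw [hz, hφ]
    simp only
    congr 4
    ext
    simp [t.2.1]
  have heq : (gridPath N e w - z : SkorokhodSpace 2) t = φ (k / N) - φ t := by
    rw [← hleft, ← hright]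
    rfl
  rw [heq, ← dist_eq_norm]
  refine (hδε _ ⟨by positivity, hkt.trans t.2.2⟩ _ t.2 ?_).le
  rw [Real.dist_eq, abs_sub_comm, abs_of_nonneg (sub_nonneg.2 hkt)]
  refine lt_of_le_of_lt ?_ hNδ
  rw [sub_le_iff_le_add, ← add_div, le_div_iff₀ hN1]
  linarith

/-- In the nonseparable space D², measurability of coordinates is not enough; Z is an almost sure
norm limit of maps that factor through finite-dimensional spaces. -/
theorem aestronglyMeasurable_limit {W : ℝ≥0 → Ω → ℝ} (hW : IsBrownianReal W P)
    {e : EuclideanSpace ℝ (Fin 2)} {Z : Ω → SkorokhodSpace 2}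
    (hZ : ∀ᵐ ω ∂P, ∀ t, Z ω t = ((t : ℝ) * W (unitInterval.toNNReal t ^ 2) ω) • e) :
    AEStronglyMeasurable Z P := by
  refine aestronglyMeasurable_of_tendsto_ae atTop (f := fun N ω => gridPath N e (W · ω))
    (fun N => aestronglyMeasurable_floorPath fun k => ?_) ?_
  · exact ((hW.aemeasurable _).const_mul _).smul_const e
  · filter_upwards [hZ, hW.cont] with ω h1 h2
    exact tendsto_gridPath h2 e h1

/-- The times `2 k / n²`. -/
noncomputable def stepTime (n k : ℕ) : ℝ≥0 := 2 * (k : ℝ≥0) / (n : ℝ≥0) ^ 2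

/-- The times `m (m - 1) / n²`, at which the variance of the number of edges among the first `m`
vertices is matched. -/
noncomputable def gridTime (n m : ℕ) : ℝ≥0 := stepTime n (m.choose 2)

/-- The Gaussian counterpart of the rescaled number of edges, in the direction `e`. -/
noncomputable def stepPath (n : ℕ) (e : EuclideanSpace ℝ (Fin 2)) (w : ℝ≥0 → ℝ) :
    SkorokhodSpace 2 :=
  floorPath n 2 fun m => (((m : ℝ) - 2) / n * w (gridTime n m)) • e

theorem coe_gridTime (n m : ℕ) : (gridTime n m : ℝ) = (m : ℝ) * (m - 1) / (n : ℝ) ^ 2 := by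
  rw [gridTime, stepTime]
  push_cast
  rw [Nat.cast_choose_two, mul_div_cancel₀ _ two_ne_zero]

theorem gridTime_le_one {n m : ℕ} (h : m ≤ n) : gridTime n m ≤ 1 := by
  rw [← NNReal.coe_le_coe, coe_gridTime, NNReal.coe_one]
  refine div_le_one_of_le₀ ?_ (by positivity)
  have h1 : (m : ℝ) ≤ n := by exact_mod_cast h
  have h2 : (0 : ℝ) ≤ m := Nat.cast_nonneg m
  nlinarith

theorem gridTime_eq_zero {n m : ℕ} (h : m < 2) : gridTime n m = 0 := by
  rw [gridTime, Nat.choose_eq_zero_of_lt h, stepTime, Nat.cast_zero, mul_zero, zero_div]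

/-- For m < 2 the factor (m-2)/n is negative and may exceed 1 in absolute value, but the grid time
is then 0, where w vanishes. -/
theorem abs_stepPath_coeff_le {n m : ℕ} (h : m ≤ n) {w : ℝ≥0 → ℝ} (hw0 : w 0 = 0) {r : ℝ}
    (hr : ∀ u ≤ 1, |w u| ≤ r) : |((m : ℝ) - 2) / n * w (gridTime n m)| ≤ r := by
  have hr0 : 0 ≤ r := (abs_nonneg _).trans (hr 0 zero_le_one)
  rcases lt_or_ge m 2 with hm | hm
  · rw [gridTime_eq_zero hm, hw0, mul_zero, abs_zero]
    exact hr0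
  · have hm' : (2 : ℝ) ≤ m := by exact_mod_cast hm
    have hmn : (m : ℝ) ≤ n := by exact_mod_cast h
    rw [abs_mul, abs_of_nonneg (div_nonneg (by linarith) (by linarith))]
    calc ((m : ℝ) - 2) / n * |w (gridTime n m)| ≤ 1 * r := by
          gcongr
          · exact div_le_one_of_le₀ (by linarith) (by linarith)
          · exact hr _ (gridTime_le_one h)
      _ = r := one_mul r

theorem exists_sq_eq_gridTime_add {n : ℕ} (hn : 1 ≤ n) (t : I) :
    ∃ u ≤ 3 / (n : ℝ≥0), unitInterval.toNNReal t ^ 2 = gridTime n ⌊(n : ℝ) * t⌋₊ + u := by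
  have hn1 : (1 : ℝ) ≤ n := by exact_mod_cast hn
  set m := ⌊(n : ℝ) * t⌋₊ with hm
  have ht0 : (0 : ℝ) ≤ t := t.2.1
  have ht1 : (t : ℝ) ≤ 1 := t.2.2
  have h1 : (m : ℝ) ≤ n * t := Nat.floor_le (by positivity)
  have h2 : (n : ℝ) * t < m + 1 := Nat.lt_floor_add_one _
  have hmn : m ≤ n := Nat.lt_succ_iff.1 (floor_mul_lt_succ n t)
  have hm0 : (0 : ℝ) ≤ m := Nat.cast_nonneg m
  have hle : gridTime n m ≤ unitInterval.toNNReal t ^ 2 := by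
    rw [← NNReal.coe_le_coe, coe_gridTime, div_le_iff₀ (by positivity)]
    push_cast
    rw [unitInterval.coe_toNNReal]
    nlinarith
  refine ⟨unitInterval.toNNReal t ^ 2 - gridTime n m, ?_, (add_tsub_cancel_of_le hle).symm⟩
  rw [← NNReal.coe_le_coe, NNReal.coe_sub hle, coe_gridTime]
  push_cast
  rw [unitInterval.coe_toNNReal]
  -- For m < n use nt < m + 1 and (m+1)² - m(m-1) = 3m + 1; for m = n use t ≤ 1 instead.
  have key : ((n : ℝ) * t) ^ 2 ≤ m * (m - 1) + 3 * n := by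
    rcases hmn.lt_or_eq with h | h
    · have h3 : (m : ℝ) + 1 ≤ n := by exact_mod_cast h
      nlinarith
    · have h3 : ((n : ℝ) * t) ^ 2 ≤ (n : ℝ) ^ 2 :=
        pow_le_pow_left₀ (by positivity) (mul_le_of_le_one_right (by positivity) ht1) 2
      rw [h]
      linarith
  rw [sub_le_iff_le_add, ← sub_le_iff_le_add', le_div_iff₀ (by positivity)]
  have h4 : 3 / (n : ℝ) * n ^ 2 = 3 * n := by field_simp
  rw [sub_mul, h4, ← mul_pow, mul_comm (t : ℝ)]
  linarith

/-- The prefactors t and (m-2)/n differ by at most 3/n, since nt - m + 2 lies in [2, 3); the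
arguments of w differ by at most 3/n. If m < 2, the discretized path vanishes and t < 2/n. -/
theorem norm_sub_stepPath_le {n : ℕ} (hn : 1 ≤ n) {e : EuclideanSpace ℝ (Fin 2)} (he : ‖e‖ ≤ 1)
    {w : ℝ≥0 → ℝ} (hw0 : w 0 = 0) {z : SkorokhodSpace 2}
    (hz : ∀ t, z t = ((t : ℝ) * w (unitInterval.toNNReal t ^ 2)) • e) {q₁ q₂ : ℝ}
    (h₁ : ∀ u ≤ 1, |w u| ≤ q₁)
    (h₂ : ∀ m : Fin (n + 1), ∀ u ≤ 3 / (n : ℝ≥0),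
      |w (gridTime n m + u) - w (gridTime n m)| ≤ q₂) :
    ‖z - stepPath n e w‖ ≤ 3 / n * q₁ + q₂ := by
  have hn1 : (1 : ℝ) ≤ n := by exact_mod_cast hn
  have hq₁ : 0 ≤ q₁ := (abs_nonneg _).trans (h₁ 0 zero_le_one)
  have hq₂ : 0 ≤ q₂ := (abs_nonneg _).trans (h₂ 0 0 zero_le)
  refine SkorokhodSpace.norm_le fun t => ?_
  have ht0 : (0 : ℝ) ≤ t := t.2.1
  have hs1 : unitInterval.toNNReal t ^ 2 ≤ 1 := pow_le_one₀ zero_le (by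
    rw [← NNReal.coe_le_coe, unitInterval.coe_toNNReal]
    exact t.2.2)
  obtain ⟨u, hu, htu⟩ := exists_sq_eq_gridTime_add hn t
  have hm : ⌊(n : ℝ) * t⌋₊ < n + 1 := floor_mul_lt_succ n t
  have heq : (z - stepPath n e w : SkorokhodSpace 2) t = ((t : ℝ) * w (unitInterval.toNNReal t ^ 2)
      - ((⌊(n : ℝ) * t⌋₊ : ℝ) - 2) / n * w (gridTime n ⌊(n : ℝ) * t⌋₊)) • e := by
    rw [sub_smul, ← hz]
    rfl
  have h₂' := h₂ ⟨_, hm⟩ u hu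
  simp only at h₂'
  rw [← htu] at h₂'
  have h₁' := h₁ _ hs1
  set m := ⌊(n : ℝ) * t⌋₊ with hmdef
  set x := w (unitInterval.toNNReal t ^ 2) with hx
  have f1 : (m : ℝ) ≤ n * t := Nat.floor_le (by positivity)
  have f2 : (n : ℝ) * t < m + 1 := Nat.lt_floor_add_one _
  have f3 : (m : ℝ) ≤ n := by exact_mod_cast Nat.lt_succ_iff.1 hm
  rw [heq, norm_smul]
  refine (mul_le_of_le_one_right (norm_nonneg _) he).trans ?_
  rw [Real.norm_eq_abs]
  rcases lt_or_ge m 2 with h | h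
  · rw [gridTime_eq_zero h, hw0, mul_zero, sub_zero, abs_mul, abs_of_nonneg ht0]
    have h3 : (m : ℝ) + 1 ≤ 2 := by exact_mod_cast h
    have h4 : (t : ℝ) ≤ 3 / n := by
      rw [le_div_iff₀ (by linarith)]
      linarith
    have : (t : ℝ) * |x| ≤ 3 / n * q₁ := by gcongr
    linarith
  · have h3 : (2 : ℝ) ≤ m := by exact_mod_cast h
    have hdec : (t : ℝ) * x - ((m : ℝ) - 2) / n * w (gridTime n m)
        = ((t : ℝ) - ((m : ℝ) - 2) / n) * x + ((m : ℝ) - 2) / n * (x - w (gridTime n m)) := by ring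
    rw [hdec]
    refine (abs_add_le _ _).trans ?_
    rw [abs_mul, abs_mul]
    have h4 : 0 ≤ ((m : ℝ) - 2) / n := div_nonneg (by linarith) (by linarith)
    have h5 : ((m : ℝ) - 2) / n ≤ 1 := div_le_one_of_le₀ (by linarith) (by linarith)
    have h6 : |(t : ℝ) - ((m : ℝ) - 2) / n| ≤ 3 / n := by
      have h7 : (t : ℝ) - ((m : ℝ) - 2) / n = (n * t - m + 2) / n := by field_simp; ring
      rw [h7, abs_div, abs_of_pos (by linarith : (0 : ℝ) < n), abs_of_nonneg (by linarith)]
      gcongr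
      linarith
    rw [abs_of_nonneg h4]
    have h8 : |(t : ℝ) - ((m : ℝ) - 2) / n| * |x| ≤ 3 / n * q₁ := by gcongr
    have h9 : ((m : ℝ) - 2) / n * |x - w (gridTime n m)| ≤ 1 * q₂ := by gcongr
    linarith

theorem norm_limit_le {e : EuclideanSpace ℝ (Fin 2)} (he : ‖e‖ ≤ 1) {w : ℝ≥0 → ℝ}
    {z : SkorokhodSpace 2} (hz : ∀ t, z t = ((t : ℝ) * w (unitInterval.toNNReal t ^ 2)) • e)
    {r : ℝ} (hr : ∀ u ≤ 1, |w u| ≤ r) : ‖z‖ ≤ r := by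
  refine SkorokhodSpace.norm_le fun t => ?_
  have hs1 : unitInterval.toNNReal t ^ 2 ≤ 1 := pow_le_one₀ zero_le (by
    rw [← NNReal.coe_le_coe, unitInterval.coe_toNNReal]
    exact t.2.2)
  rw [hz, norm_smul, Real.norm_eq_abs, abs_mul, abs_of_nonneg t.2.1]
  refine (mul_le_of_le_one_right (mul_nonneg t.2.1 (abs_nonneg _)) he).trans ?_
  exact (mul_le_of_le_one_left (abs_nonneg _) t.2.2).trans (hr _ hs1)

theorem norm_stepPath_le {n : ℕ} {e : EuclideanSpace ℝ (Fin 2)} (he : ‖e‖ ≤ 1) {w : ℝ≥0 → ℝ}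
    (hw0 : w 0 = 0) {r : ℝ} (hr : ∀ u ≤ 1, |w u| ≤ r) : ‖stepPath n e w‖ ≤ r := by
  refine norm_floorPath_le fun m => ?_
  rw [norm_smul]
  exact (mul_le_of_le_one_right (norm_nonneg _) he).trans
    (abs_stepPath_coeff_le (Nat.lt_succ_iff.1 m.2) hw0 hr)

theorem integrable_comp_of_norm_le {d : ℕ} {g : SkorokhodSpace d → ℝ} (hg : MemM2 g)
    [IsFiniteMeasure P] {Z : Ω → SkorokhodSpace d} (hZ : AEStronglyMeasurable Z P) {r : Ω → ℝ}
    (hr : Integrable (fun ω => r ω ^ 4) P) (hr0 : ∀ ω, 0 ≤ r ω) (hZr : ∀ᵐ ω ∂P, ‖Z ω‖ ≤ r ω) :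
    Integrable (fun ω => g (Z ω)) P := by
  refine (((integrable_const (2 : ℝ)).add hr).const_mul (normM2 g).toReal).mono'
    (hg.memM.continuous.comp_aestronglyMeasurable hZ) ?_
  filter_upwards [hZr] with ω hω
  refine (hg.abs_le _).trans (mul_le_mul_of_nonneg_left ?_ ENNReal.toReal_nonneg)
  have h1 : ‖Z ω‖ ^ 3 ≤ r ω ^ 3 := pow_le_pow_left₀ (norm_nonneg _) hω 3
  have h2 : r ω ^ 3 ≤ 1 + r ω ^ 4 := by
    rcases le_total (r ω) 1 with h | h
    · exact (pow_le_one₀ (hr0 ω) h).trans (le_add_of_nonneg_right (by positivity))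
    · exact (pow_le_pow_right₀ h (by norm_num)).trans (le_add_of_nonneg_left zero_le_one)
  simp only [Pi.add_apply]
  linarith

theorem aestronglyMeasurable_stepPath {W : ℝ≥0 → Ω → ℝ} (hW : IsBrownianReal W P) (n : ℕ)
    (e : EuclideanSpace ℝ (Fin 2)) : AEStronglyMeasurable (fun ω => stepPath n e (W · ω)) P :=
  aestronglyMeasurable_floorPath fun _ => ((hW.aemeasurable _).const_mul _).smul_const e

/-- Cauchy–Schwarz for the increments of a functional in `M²`. -/
theorem abs_integral_sub_le_of_norm_le {d : ℕ} {g : SkorokhodSpace d → ℝ} (hg : MemM2 g)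
    [IsProbabilityMeasure P] {Y Z : Ω → SkorokhodSpace d}
    (hY : Integrable (fun ω => g (Y ω)) P) (hZ : Integrable (fun ω => g (Z ω)) P)
    {r q : Ω → ℝ} (hr : MemLp r 2 P) (hq : MemLp q 2 P) (hr0 : ∀ ω, 0 ≤ r ω) (hq0 : ∀ ω, 0 ≤ q ω)
    (hYr : ∀ᵐ ω ∂P, ‖Y ω‖ ≤ r ω) (hZr : ∀ᵐ ω ∂P, ‖Z ω‖ ≤ r ω)
    (hYZ : ∀ᵐ ω ∂P, ‖Y ω - Z ω‖ ≤ q ω) :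
    |∫ ω, g (Y ω) ∂P - ∫ ω, g (Z ω) ∂P|
      ≤ (normM2 g).toReal * ((1 + √(∫ ω, r ω ^ 2 ∂P)) * √(∫ ω, q ω ^ 2 ∂P)) := by
  have hi1 : Integrable (fun ω => r ω * q ω) P := hr.integrable_mul hq
  have hi0 : Integrable q P := hq.integrable (by norm_num)
  have hbound : ∀ᵐ ω ∂P, ‖g (Y ω) - g (Z ω)‖ ≤ (normM2 g).toReal * (q ω + r ω * q ω) := by
    filter_upwards [hYr, hZr, hYZ] with ω h1 h2 h3
    refine (hg.abs_sub_le h1 h2).trans ?_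
    have := hr0 ω
    have h4 : (normM2 g).toReal * (1 + r ω) * ‖Y ω - Z ω‖
        ≤ (normM2 g).toReal * (1 + r ω) * q ω := by gcongr
    refine h4.trans (le_of_eq (by ring))
  rw [← integral_sub hY hZ]
  refine (norm_integral_le_of_norm_le ((hi0.add hi1).const_mul _) hbound).trans ?_
  rw [integral_const_mul]
  refine mul_le_mul_of_nonneg_left ?_ ENNReal.toReal_nonneg
  rw [integral_add' hi0 hi1, add_mul, one_mul]
  exact add_le_add (integral_le_sqrt_integral_sq hq (ae_of_all _ hq0))
    (integral_mul_le_sqrt_mul_sqrt hr hq (ae_of_all _ hr0) (ae_of_all _ hq0))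

theorem sqrt_integral_add_sq_le [IsProbabilityMeasure P] {f h : Ω → ℝ} (hf : MemLp f 2 P)
    (hh : MemLp h 2 P) (hf0 : ∀ ω, 0 ≤ f ω) (hh0 : ∀ ω, 0 ≤ h ω) :
    √(∫ ω, (f ω + h ω) ^ 2 ∂P) ≤ √(∫ ω, f ω ^ 2 ∂P) + √(∫ ω, h ω ^ 2 ∂P) := by
  have hcs := integral_mul_le_sqrt_mul_sqrt hf hh (ae_of_all _ hf0) (ae_of_all _ hh0)
  refine Real.sqrt_le_iff.2 ⟨by positivity, ?_⟩
  have h1 : ∫ ω, (f ω + h ω) ^ 2 ∂P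
      = ∫ ω, f ω ^ 2 ∂P + 2 * ∫ ω, f ω * h ω ∂P + ∫ ω, h ω ^ 2 ∂P := by
    have hfh : Integrable (fun ω => 2 * (f ω * h ω)) P := (hf.integrable_mul hh).const_mul 2
    have hffh : Integrable (fun ω => f ω ^ 2 + 2 * (f ω * h ω)) P := hf.integrable_sq.add hfh
    rw [← integral_const_mul, ← integral_add hf.integrable_sq hfh,
      ← integral_add hffh hh.integrable_sq]
    exact integral_congr_ae (ae_of_all _ fun ω => by simp only; ring)
  have hf2 := Real.sq_sqrt (integral_nonneg fun ω => sq_nonneg (f ω) : 0 ≤ ∫ ω, f ω ^ 2 ∂P)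
  have hh2 := Real.sq_sqrt (integral_nonneg fun ω => sq_nonneg (h ω) : 0 ≤ ∫ ω, h ω ^ 2 ∂P)
  rw [h1]
  nlinarith

/-- The functional of the limit is close to the functional of its discretization. -/
theorem abs_integral_limit_sub_stepPath_le {n : ℕ} (hn : 1 ≤ n) {g : SkorokhodSpace 2 → ℝ}
    (hg : MemM2 g) {e : EuclideanSpace ℝ (Fin 2)} (he : ‖e‖ ≤ 1) {W : ℝ≥0 → Ω → ℝ}
    (hW : IsBrownianReal W P) {Z : Ω → SkorokhodSpace 2}
    (hZ : ∀ᵐ ω ∂P, ∀ t, Z ω t = ((t : ℝ) * W (unitInterval.toNNReal t ^ 2) ω) • e) :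
    Integrable (fun ω => g (Z ω)) P ∧
    |∫ ω, g (Z ω) ∂P - ∫ ω, g (stepPath n e (W · ω)) ∂P|
      ≤ (normM2 g).toReal * ((13 * √(Real.log n) + 50) / √n) := by
  have := hW.isGaussianProcess.isProbabilityMeasure
  have hn1 : (1 : ℝ) ≤ n := by exact_mod_cast hn
  -- Three bounds on W: r gives integrability, q₁ bounds the supremum on [0, 1] in L², and q₂ bounds
  -- the oscillations on the n + 1 grid intervals. Only q₂ brings in log n.
  obtain ⟨r, hri, hr0, hr⟩ := exists_integrable_pow_four_abs_le hW
  obtain ⟨q₁, hq₁m, hq₁0, hq₁i, hq₁⟩ := exists_memLp_abs_sub_le hW one_pos fun _ : Unit => 0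
  obtain ⟨q₂, hq₂m, hq₂0, hq₂i, hq₂⟩ := exists_memLp_abs_sub_le hW (L := 3 / (n : ℝ≥0))
    (by positivity) fun m : Fin (n + 1) => gridTime n m
  have hq₁' : ∀ᵐ ω ∂P, ∀ u ≤ 1, |W u ω| ≤ q₁ ω := by
    filter_upwards [hq₁, hW.eval_zero_ae_eq_zero] with ω h h0 u hu
    simpa [h0] using h () u hu
  have hIZ : Integrable (fun ω => g (Z ω)) P := by
    refine integrable_comp_of_norm_le hg (aestronglyMeasurable_limit hW hZ) hri hr0 ?_
    filter_upwards [hZ, hr] with ω h1 h2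
    exact norm_limit_le he h1 h2
  have hIA : Integrable (fun ω => g (stepPath n e (W · ω))) P := by
    refine integrable_comp_of_norm_le hg (aestronglyMeasurable_stepPath hW n e) hri hr0 ?_
    filter_upwards [hW.eval_zero_ae_eq_zero, hr] with ω h1 h2
    exact norm_stepPath_le he h1 h2
  refine ⟨hIZ, ?_⟩
  refine (abs_integral_sub_le_of_norm_le hg hIZ hIA hq₁m ((hq₁m.const_mul (3 / n)).add hq₂m) hq₁0
    (fun ω => add_nonneg (mul_nonneg (by positivity) (hq₁0 ω)) (hq₂0 ω)) ?_ ?_ ?_).trans ?_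
  · filter_upwards [hZ, hq₁'] with ω h1 h2
    exact norm_limit_le he h1 h2
  · filter_upwards [hW.eval_zero_ae_eq_zero, hq₁'] with ω h1 h2
    exact norm_stepPath_le he h1 h2
  · filter_upwards [hW.eval_zero_ae_eq_zero, hq₁', hq₂, hZ] with ω h0 h1 h2 h3
    exact norm_sub_stepPath_le hn he h0 h3 h1 h2
  · refine mul_le_mul_of_nonneg_left ?_ ENNReal.toReal_nonneg
    have hs := sqrt_integral_add_sq_le (hq₁m.const_mul (3 / n)) hq₂m
      (fun ω => mul_nonneg (by positivity) (hq₁0 ω)) hq₂0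
    simp only [mul_pow, integral_const_mul] at hs
    rw [Real.sqrt_mul (by positivity), Real.sqrt_sq (by positivity)] at hs
    set α := √(∫ ω, q₁ ω ^ 2 ∂P) with hα
    set β := √(∫ ω, q₂ ω ^ 2 ∂P) with hβ
    have hsn : 1 ≤ √(n : ℝ) := Real.one_le_sqrt.2 hn1
    have hsn2 : √(n : ℝ) ^ 2 = n := Real.sq_sqrt (by linarith)
    have hαle : α ≤ 2.65 := by
      refine Real.sqrt_le_iff.2 ⟨by norm_num, hq₁i.trans ?_⟩
      have := log_four_mul_sqrt_two_le
      simp only [Fintype.card_unit, Nat.cast_one, one_mul, NNReal.coe_one, mul_one]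
      linarith
    -- Uses n + 1 ≤ 2n and log(8√2) < 5/2.
    have hlog : Real.log (Fintype.card (Fin (n + 1)) * (4 * √2)) ≤ Real.log n + 5 / 2 := by
      have h1 : (Fintype.card (Fin (n + 1)) : ℝ) * (4 * √2) ≤ n * (2 * (4 * √2)) := by
        rw [Fintype.card_fin, ← mul_assoc (n : ℝ)]
        refine mul_le_mul_of_nonneg_right ?_ (by positivity)
        push_cast
        linarith
      refine (Real.log_le_log (by rw [Fintype.card_fin]; positivity) h1).trans ?_
      rw [Real.log_mul (by positivity) (by positivity), Real.log_mul (by norm_num) (by positivity)]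
      linarith [log_four_mul_sqrt_two_le, Real.log_two_lt_d9]
    have hlog0 : 0 ≤ Real.log n := Real.log_nonneg hn1
    have hsl : √(Real.log n) ^ 2 = Real.log n := Real.sq_sqrt hlog0
    -- Here 3.5² ≥ 12 and 5.5² ≥ 30, against 12 (log n + 5/2).
    have hβle : β ≤ (3.5 * √(Real.log n) + 5.5) / √n := by
      refine Real.sqrt_le_iff.2 ⟨by positivity, hq₂i.trans ?_⟩
      rw [div_pow, hsn2]
      have h2 : 4 * ((3 / (n : ℝ≥0) : ℝ≥0) : ℝ) * Real.log (Fintype.card (Fin (n + 1)) * (4 * √2))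
          ≤ 4 * (3 / n) * (Real.log n + 5 / 2) := by
        push_cast at hlog ⊢
        gcongr
      refine h2.trans ?_
      rw [show 4 * (3 / (n : ℝ)) * (Real.log n + 5 / 2) = (12 * (Real.log n + 5 / 2)) / n by ring]
      gcongr
      nlinarith [Real.sqrt_nonneg (Real.log n)]
    have hα0 : 0 ≤ α := Real.sqrt_nonneg _
    have h3n : 3 / (n : ℝ) ≤ 3 / √n := by
      gcongr
      nlinarith
    calc (1 + α) * √(∫ ω, (3 / n * q₁ ω + q₂ ω) ^ 2 ∂P)
        ≤ (1 + 2.65) * (3 / √n * 2.65 + (3.5 * √(Real.log n) + 5.5) / √n) := by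
          refine mul_le_mul (by linarith) (hs.trans (add_le_add ?_ hβle)) (Real.sqrt_nonneg _)
            (by norm_num)
          exact mul_le_mul h3n hαle hα0 (by positivity)
      _ = ((1 + 2.65) * (3 * 2.65 + (3.5 * √(Real.log n) + 5.5))) / √n := by ring
      _ ≤ (13 * √(Real.log n) + 50) / √n := by
          gcongr
          nlinarith [Real.sqrt_nonneg (Real.log n)]

end Coupling

/-! ### Polynomials in independent centred variables -/

section Chaos

set_option linter.unusedSectionVars false

variable {Ω : Type*} [MeasurableSpace Ω] {P : Measure Ω} {E : Type*} [Fintype E] [DecidableEq E]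
  {X : E → Ω → ℝ}

/-- A centred variable is orthogonal to every function of the other independent variables. -/
theorem integral_mul_coord_eq_zero (hm : ∀ e, Measurable (X e)) (hX : iIndepFun X P) {e : E}
    (h0 : ∫ ω, X e ω ∂P = 0) {Y : (E → ℝ) → ℝ} (hY : Measurable Y)
    (hYe : ∀ x y, Y (Function.update x e y) = Y x) :
    ∫ ω, Y (fun f => X f ω) * X e ω ∂P = 0 := by
  -- Y as a function of the other coordinates, with 0 put in place of coordinate e; by `hYe` this
  -- changes nothing.
  let φ : (↥(Finset.univ.erase e) → ℝ) → ℝ := fun z =>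
    Y fun f => if h : f ∈ Finset.univ.erase e then z ⟨f, h⟩ else 0
  have hφ : Measurable φ := by
    refine hY.comp (measurable_pi_iff.2 fun f => ?_)
    by_cases h : f ∈ Finset.univ.erase e
    · simp only [h, dite_true]
      fun_prop
    · simp only [h, dite_false]
      fun_prop
  have hind := (hX.indepFun_finset (Finset.univ.erase e) {e} (by simp) hm).comp hφ
    (measurable_pi_apply (⟨e, Finset.mem_singleton_self e⟩ : ({e} : Finset E)))
  have heq : ∀ ω, φ (fun i => X i ω) = Y fun f => X f ω := fun ω => by
    rw [← hYe (fun f => X f ω) 0]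
    refine congrArg Y (funext fun f => ?_)
    by_cases h : f = e
    · subst h
      simp
    · simp [h]
  have h1 := hind.integral_fun_mul_eq_mul_integral
    (hφ.comp (measurable_pi_lambda _ fun i => hm i)).aestronglyMeasurable
    ((measurable_pi_apply _).comp (measurable_pi_lambda _ fun i : ({e} : Finset E) => hm i)
      ).aestronglyMeasurable
  simp only [Function.comp_apply, heq] at h1
  rw [h1, h0, mul_zero]

/-- A finite family of functions of the coordinates, graded by `lev`, such that each member is
centred given everything of a lower level. -/
structure IsGradedChaos {A : Type*} (lev : A → ℕ) (T : A → (E → ℝ) → ℝ) : Prop where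
  measurable : ∀ a, Measurable (T a)
  abs_le : ∀ a x, (∀ e, |x e| ≤ 1) → |T a x| ≤ 1
  factor : ∀ a, ∃ (e : E) (c : (E → ℝ) → ℝ), Measurable c ∧ (∀ x, T a x = c x * x e) ∧
    (∀ x y, c (Function.update x e y) = c x) ∧
    ∀ b, lev b < lev a → ∀ x y, T b (Function.update x e y) = T b x

variable {A : Type*} [Fintype A] {lev : A → ℕ} {T : A → (E → ℝ) → ℝ}

/-- The partial sum of the members of level less than `m`. -/
noncomputable def levelSum (lev : A → ℕ) (T : A → (E → ℝ) → ℝ) (m : ℕ) (x : E → ℝ) : ℝ :=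
  ∑ a with lev a < m, T a x

theorem levelSum_succ (m : ℕ) (x : E → ℝ) :
    levelSum lev T (m + 1) x = levelSum lev T m x + ∑ a with lev a = m, T a x := by
  classical
  unfold levelSum
  rw [← Finset.sum_union]
  · refine Finset.sum_congr (Finset.ext fun a => ?_) fun _ _ => rfl
    simp only [Finset.mem_filter, Finset.mem_univ, true_and, Finset.mem_union]
    omega
  · refine Finset.disjoint_left.2 fun a h1 h2 => ?_
    simp only [Finset.mem_filter, Finset.mem_univ, true_and] at h1 h2
    omega

theorem IsGradedChaos.measurable_levelSum (hT : IsGradedChaos lev T) (m : ℕ) :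
    Measurable (levelSum lev T m) :=
  Finset.measurable_fun_sum _ fun a _ => hT.measurable a

theorem IsGradedChaos.memLp (hT : IsGradedChaos lev T) [IsFiniteMeasure P]
    (hm : ∀ e, Measurable (X e)) (hb : ∀ e ω, |X e ω| ≤ 1) (a : A) :
    MemLp (fun ω => T a fun e => X e ω) 2 P :=
  MemLp.of_bound ((hT.measurable a).comp (measurable_pi_lambda _ hm)).aestronglyMeasurable 1
    (ae_of_all _ fun ω => hT.abs_le a _ fun e => hb e ω)

theorem IsGradedChaos.memLp_levelSum (hT : IsGradedChaos lev T) [IsFiniteMeasure P]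
    (hm : ∀ e, Measurable (X e)) (hb : ∀ e ω, |X e ω| ≤ 1) (m : ℕ) :
    MemLp (fun ω => levelSum lev T m fun e => X e ω) 2 P :=
  memLp_finsetSum _ fun a _ => hT.memLp hm hb a

/-- The level sums are a martingale: each member of level k has a centred factor x e that appears
neither in its cofactor nor in any lower level. It is therefore orthogonal to the running maximum
times the sign, both functions of lower levels. -/
theorem IsGradedChaos.integral_partialSups_sq_le (hT : IsGradedChaos lev T)
    [IsProbabilityMeasure P] (hm : ∀ e, Measurable (X e)) (hb : ∀ e ω, |X e ω| ≤ 1)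
    (hX : iIndepFun X P) (h0 : ∀ e, ∫ ω, X e ω ∂P = 0) (n : ℕ) :
    ∫ ω, partialSups (fun m => |levelSum lev T m fun e => X e ω|) n ^ 2 ∂P
      ≤ 4 * ∫ ω, (levelSum lev T n fun e => X e ω) ^ 2 ∂P := by
  refine integral_partialSups_abs_sq_le (fun m => hT.memLp_levelSum hm hb m) fun k _ => ?_
  set φ : (E → ℝ) → ℝ := fun x =>
    partialSups (fun m => |levelSum lev T m x|) k * realSign (levelSum lev T k x) with hφ
  have hφm : Measurable φ := by
    have hS := fun m => hT.measurable_levelSum m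
    exact (measurable_partialSups_comp (fun m => (hS m).abs) k).mul (measurable_realSign.comp (hS k))
  have hSdep : ∀ (e : E), (∀ b, lev b < k → ∀ x y, T b (Function.update x e y) = T b x) →
      ∀ j ≤ k, ∀ x y, levelSum lev T j (Function.update x e y) = levelSum lev T j x :=
    fun e he j hj x y => Finset.sum_congr rfl fun b hb =>
      he b ((Finset.mem_filter.1 hb).2.trans_le hj) x y
  have hφdep : ∀ (e : E), (∀ b, lev b < k → ∀ x y, T b (Function.update x e y) = T b x) →
      ∀ x y, φ (Function.update x e y) = φ x := fun e he x y => by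
    simp only [hφ]
    rw [hSdep e he k le_rfl, partialSups_congr_le fun j hj => by rw [hSdep e he j hj]]
  have hterm : ∀ a, lev a = k → ∫ ω, φ (fun e => X e ω) * T a (fun e => X e ω) ∂P = 0 := by
    rintro a rfl
    obtain ⟨e, c, hcm, hTc, hc, hlow⟩ := hT.factor a
    have := integral_mul_coord_eq_zero hm hX (h0 e) (Y := fun x => φ x * c x) (hφm.mul hcm)
      fun x y => by simp only [hφdep e hlow, hc]
    simpa only [hTc, mul_assoc] using this
  have hφ2 : MemLp (fun ω => φ fun e => X e ω) 2 P := by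
    have h1 : MemLp (fun ω => partialSups (fun m => |levelSum lev T m fun e => X e ω|) k) 2 P :=
      memLp_partialSups (fun m => (hT.memLp_levelSum hm hb m).abs) k
    refine h1.of_le (hφm.comp (measurable_pi_lambda _ hm)).aestronglyMeasurable
      (ae_of_all _ fun ω => ?_)
    rw [norm_mul]
    exact mul_le_of_le_one_right (norm_nonneg _) (abs_realSign_le _)
  calc _ = ∫ ω, ∑ a with lev a = k, φ (fun e => X e ω) * T a (fun e => X e ω) ∂P := by
        refine integral_congr_ae (ae_of_all _ fun ω => ?_)
        simp only
        rw [levelSum_succ, add_sub_cancel_left, ← Finset.mul_sum]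
    _ = ∑ a with lev a = k, ∫ ω, φ (fun e => X e ω) * T a (fun e => X e ω) ∂P :=
        integral_finsetSum _ fun a _ => hφ2.integrable_mul (hT.memLp hm hb a)
    _ = 0 := Finset.sum_eq_zero fun a ha => hterm a (Finset.mem_filter.1 ha).2

/-- Expand the square: each member correlates positively with at most D members, and every
correlation is at most 1. -/
theorem IsGradedChaos.integral_levelSum_sq_le (hT : IsGradedChaos lev T)
    [IsProbabilityMeasure P] (hm : ∀ e, Measurable (X e)) (hb : ∀ e ω, |X e ω| ≤ 1) {D : ℕ}
    (N : A → Finset A) (hN : ∀ a, (N a).card ≤ D)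
    (horth : ∀ a b, b ∉ N a → ∫ ω, T a (fun e => X e ω) * T b (fun e => X e ω) ∂P = 0) (n : ℕ) :
    ∫ ω, (levelSum lev T n fun e => X e ω) ^ 2 ∂P ≤ Fintype.card A * D := by
  classical
  have hi : ∀ a b, Integrable (fun ω => T a (fun e => X e ω) * T b (fun e => X e ω)) P :=
    fun a b => (hT.memLp hm hb a).integrable_mul (hT.memLp hm hb b)
  have h1 : ∀ a b, ∫ ω, T a (fun e => X e ω) * T b (fun e => X e ω) ∂P
      ≤ if b ∈ N a then 1 else 0 := fun a b => by
    split_ifs with h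
    · refine (le_abs_self _).trans (abs_integral_le_of_abs_le fun ω => ?_)
      rw [abs_mul]
      exact mul_le_one₀ (hT.abs_le a _ fun e => hb e ω) (abs_nonneg _)
        (hT.abs_le b _ fun e => hb e ω)
    · exact (horth a b h).le
  calc ∫ ω, (levelSum lev T n fun e => X e ω) ^ 2 ∂P
      = ∑ a with lev a < n, ∑ b with lev b < n,
          ∫ ω, T a (fun e => X e ω) * T b (fun e => X e ω) ∂P := by
        simp only [levelSum, sq, Finset.sum_mul_sum]
        rw [integral_finsetSum _ fun a _ => integrable_finsetSum _ fun b _ => hi a b]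
        exact Finset.sum_congr rfl fun a _ => integral_finsetSum _ fun b _ => hi a b
    _ ≤ ∑ a with lev a < n, ∑ b with lev b < n, (if b ∈ N a then (1 : ℝ) else 0) :=
        Finset.sum_le_sum fun a _ => Finset.sum_le_sum fun b _ => h1 a b
    _ ≤ ∑ a with lev a < n, (D : ℝ) := by
        refine Finset.sum_le_sum fun a _ => ?_
        rw [Finset.sum_boole]
        refine Nat.cast_le.2 ((Finset.card_le_card fun b hb => ?_).trans (hN a))
        exact (Finset.mem_filter.1 hb).2
    _ ≤ Fintype.card A * D := by
        rw [Finset.sum_const, nsmul_eq_mul]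
        refine mul_le_mul_of_nonneg_right (Nat.cast_le.2 ?_) (Nat.cast_nonneg _)
        exact (Finset.card_le_univ _)

end Chaos

/-! ### Edges and two-stars -/

section Graph

/-- The pairs `i < j` of vertices, stored by their larger element. -/
abbrev Edge (n : ℕ) : Type := (j : Fin n) × Fin (j : ℕ)

variable {n : ℕ}

/-- The smaller end of an edge. -/
def Edge.lower (e : Edge n) : Fin n := ⟨e.2, e.2.2.trans e.1.2⟩

theorem Edge.lower_lt (e : Edge n) : e.lower < e.1 := e.2.2

theorem Edge.ext' {e f : Edge n} (h1 : (e.1 : ℕ) = f.1) (h2 : (e.2 : ℕ) = f.2) : e = f := by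
  obtain ⟨⟨j, hj⟩, ⟨i, hi⟩⟩ := e
  obtain ⟨⟨k, hk⟩, ⟨l, hl⟩⟩ := f
  simp only at h1 h2
  subst h1 h2
  rfl

/-- The edge joining two distinct vertices. -/
def edgeOf (i j : Fin n) (h : i ≠ j) : Edge n :=
  if h' : i < j then ⟨j, ⟨i, h'⟩⟩ else ⟨i, ⟨j, lt_of_le_of_ne (not_lt.1 h') fun e => h (Fin.ext e).symm⟩⟩

theorem edgeOf_fst (i j : Fin n) (h : i ≠ j) : ((edgeOf i j h).1 : ℕ) = max (i : ℕ) j := by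
  unfold edgeOf
  split_ifs with h'
  · exact (max_eq_right (Fin.lt_def.1 h').le).symm
  · exact (max_eq_left (Fin.le_def.1 (not_lt.1 h'))).symm

theorem edgeOf_snd (i j : Fin n) (h : i ≠ j) : ((edgeOf i j h).2 : ℕ) = min (i : ℕ) j := by
  by_cases h' : i < j
  · rw [show edgeOf i j h = ⟨j, ⟨i, h'⟩⟩ from dif_pos h']
    exact (min_eq_left (Fin.lt_def.1 h').le).symm
  · have h'' : (j : ℕ) < i := lt_of_le_of_ne (Fin.le_def.1 (not_lt.1 h')) fun e => h (Fin.ext e).symm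
    rw [show edgeOf i j h = ⟨i, ⟨j, h''⟩⟩ from dif_neg h']
    exact (min_eq_right h''.le).symm

theorem edgeOf_comm (i j : Fin n) (h : i ≠ j) : edgeOf i j h = edgeOf j i h.symm :=
  Edge.ext' (by rw [edgeOf_fst, edgeOf_fst, max_comm]) (by rw [edgeOf_snd, edgeOf_snd, min_comm])

theorem edgeOf_lower (e : Edge n) : edgeOf e.lower e.1 e.lower_lt.ne = e :=
  Edge.ext' (by rw [edgeOf_fst]; exact max_eq_right e.lower_lt.le)
    (by rw [edgeOf_snd]; exact min_eq_left e.lower_lt.le)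

theorem eq_or_eq_of_edgeOf_eq {i j k l : Fin n} {h : i ≠ j} {h' : k ≠ l}
    (he : edgeOf i j h = edgeOf k l h') : i = k ∧ j = l ∨ i = l ∧ j = k := by
  have h1 := edgeOf_fst i j h
  have h2 := edgeOf_snd i j h
  rw [he, edgeOf_fst] at h1
  rw [he, edgeOf_snd] at h2
  simp only [Fin.ext_iff]
  omega

/-- The symmetric array with zero diagonal built from a vector indexed by the edges. -/
def edgeVal (x : Edge n → ℝ) (i j : Fin n) : ℝ := if h : i ≠ j then x (edgeOf i j h) else 0

theorem edgeVal_comm (x : Edge n → ℝ) (i j : Fin n) : edgeVal x i j = edgeVal x j i := by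
  unfold edgeVal
  by_cases h : i = j
  · rw [h]
  · rw [dif_pos h, dif_pos (Ne.symm h), edgeOf_comm]

theorem edgeVal_self (x : Edge n → ℝ) (i : Fin n) : edgeVal x i i = 0 := dif_neg (by simp)

/-- Ordered triples of distinct vertices. -/
abbrev Triple (n : ℕ) : Type :=
  {q : Fin n × Fin n × Fin n // q.1 ≠ q.2.1 ∧ q.2.1 ≠ q.2.2 ∧ q.1 ≠ q.2.2}

namespace Triple

/-- The largest vertex. -/
def level (q : Triple n) : ℕ := max (max (q.1.1 : ℕ) q.1.2.1) q.1.2.2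

/-- The first edge of a two-star. -/
def edge₁ (q : Triple n) : Edge n := edgeOf q.1.1 q.1.2.1 q.2.1

/-- The second edge of a two-star. -/
def edge₂ (q : Triple n) : Edge n := edgeOf q.1.2.1 q.1.2.2 q.2.2.1

/-- The two-star with its ends exchanged. -/
def reverse (q : Triple n) : Triple n :=
  ⟨(q.1.2.2, q.1.2.1, q.1.1), q.2.2.1.symm, q.2.1.symm, q.2.2.2.symm⟩

theorem edge₁_ne_edge₂ (q : Triple n) : q.edge₁ ≠ q.edge₂ := fun h => by
  obtain ⟨h1, h2, h3⟩ := q.2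
  rcases eq_or_eq_of_edgeOf_eq h with ⟨h4, h5⟩ | ⟨h4, h5⟩
  · exact h1 h4
  · exact h3 h4

theorem edge₁_fst (q : Triple n) : (q.edge₁.1 : ℕ) = max (q.1.1 : ℕ) q.1.2.1 := edgeOf_fst _ _ _

theorem edge₂_fst (q : Triple n) : (q.edge₂.1 : ℕ) = max (q.1.2.1 : ℕ) q.1.2.2 := edgeOf_fst _ _ _

/-- The two edges determine a two-star up to orientation: their common vertex is the centre. -/
theorem eq_or_eq_reverse {a b : Triple n} (h1 : a.edge₁ = b.edge₁ ∨ a.edge₁ = b.edge₂)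
    (h2 : a.edge₂ = b.edge₁ ∨ a.edge₂ = b.edge₂) : b = a ∨ b = a.reverse := by
  obtain ⟨⟨i, j, k⟩, ha1, ha2, ha3⟩ := a
  obtain ⟨⟨i', j', k'⟩, hb1, hb2, hb3⟩ := b
  simp only at ha1 ha2 ha3 hb1 hb2 hb3
  simp only [Subtype.mk.injEq, Prod.mk.injEq, reverse]
  have e1 : i = i' ∧ j = j' ∨ i = j' ∧ j = i' ∨ i = j' ∧ j = k' ∨ i = k' ∧ j = j' := by
    rcases h1 with h | h <;> rcases eq_or_eq_of_edgeOf_eq h with h | h <;> tauto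
  have e2 : j = i' ∧ k = j' ∨ j = j' ∧ k = i' ∨ j = j' ∧ k = k' ∨ j = k' ∧ k = j' := by
    rcases h2 with h | h <;> rcases eq_or_eq_of_edgeOf_eq h with h | h <;> tauto
  grind

end Triple

theorem isGradedChaos_edge : IsGradedChaos (fun e : Edge n => (e.1 : ℕ)) fun e x => x e where
  measurable e := measurable_pi_apply e
  abs_le e x hx := hx e
  factor e := ⟨e, fun _ => 1, measurable_const, fun x => (one_mul _).symm, fun _ _ => rfl,
    fun f hf x y => Function.update_of_ne (fun h => by simp [h] at hf) _ _⟩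

/-- The largest vertex lies on one of the two edges. That edge has the level of the two-star, so no
two-star of lower level contains it; the other edge is the cofactor. -/
theorem isGradedChaos_twoStar :
    IsGradedChaos (Triple.level (n := n)) fun q x => x q.edge₁ * x q.edge₂ where
  measurable q := (measurable_pi_apply _).mul (measurable_pi_apply _)
  abs_le q x hx := by
    rw [abs_mul]
    exact mul_le_one₀ (hx _) (abs_nonneg _) (hx _)
  factor q := by
    have hlow : ∀ e : Edge n, (e.1 : ℕ) = q.level → ∀ b : Triple n, b.level < q.level →
        ∀ (x : Edge n → ℝ) (y : ℝ), Function.update x e y b.edge₁ * Function.update x e y b.edge₂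
          = x b.edge₁ * x b.edge₂ := fun e he b hb x y => by
      have h1 := b.edge₁_fst
      have h2 := b.edge₂_fst
      unfold Triple.level at hb he
      rw [Function.update_of_ne, Function.update_of_ne]
      · rintro rfl; omega
      · rintro rfl; omega
    have h1 := q.edge₁_fst
    have h2 := q.edge₂_fst
    rcases (by unfold Triple.level; omega :
      (q.edge₁.1 : ℕ) = q.level ∨ (q.edge₂.1 : ℕ) = q.level) with h | h
    · exact ⟨q.edge₁, fun x => x q.edge₂, measurable_pi_apply _, fun x => mul_comm _ _,
        fun x y => Function.update_of_ne q.edge₁_ne_edge₂.symm _ _, hlow _ h⟩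
    · exact ⟨q.edge₂, fun x => x q.edge₁, measurable_pi_apply _, fun x => rfl,
        fun x y => Function.update_of_ne q.edge₁_ne_edge₂ _ _, hlow _ h⟩

/-- The sum of the coordinates over the edges among the first `m` vertices. -/
noncomputable abbrev edgeSum (m : ℕ) (x : Edge n → ℝ) : ℝ :=
  levelSum (fun e : Edge n => (e.1 : ℕ)) (fun e x => x e) m x

/-- The sum over the two-stars among the first `m` vertices. -/
noncomputable abbrev twoStarSum (m : ℕ) (x : Edge n → ℝ) : ℝ :=
  levelSum (Triple.level (n := n)) (fun q x => x q.edge₁ * x q.edge₂) m x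

theorem card_edge_le (n : ℕ) : (Fintype.card (Edge n) : ℝ) ≤ (n : ℝ) ^ 2 := by
  have : Fintype.card (Edge n) ≤ n * n := by
    rw [Fintype.card_sigma]
    refine (Finset.sum_le_card_nsmul _ _ n fun j _ => ?_).trans (by simp)
    rw [Fintype.card_fin]
    exact j.2.le
  rw [sq]
  exact_mod_cast this

/-! ### Second moments of the running maxima -/

section Moments

variable {Ω : Type*} [MeasurableSpace Ω] {P : Measure Ω} [IsProbabilityMeasure P]
  {X : Edge n → Ω → ℝ}

theorem integral_partialSups_edgeSum_sq_le (hm : ∀ e, Measurable (X e)) (hb : ∀ e ω, |X e ω| ≤ 1)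
    (hX : iIndepFun X P) (h0 : ∀ e, ∫ ω, X e ω ∂P = 0) :
    ∫ ω, partialSups (fun m => |edgeSum m fun e => X e ω|) n ^ 2 ∂P ≤ 4 * (n : ℝ) ^ 2 := by
  refine (isGradedChaos_edge.integral_partialSups_sq_le hm hb hX h0 n).trans ?_
  refine mul_le_mul_of_nonneg_left ?_ (by norm_num)
  refine (isGradedChaos_edge.integral_levelSum_sq_le (P := P) hm hb (D := 1) (fun e => {e}) (by simp)
    (fun a b hab => ?_) n).trans ?_
  · rw [Finset.mem_singleton] at hab
    exact integral_mul_coord_eq_zero hm hX (h0 b) (Y := fun x => x a) (measurable_pi_apply _)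
      fun x y => Function.update_of_ne (Ne.symm hab) _ _
  · rw [Nat.cast_one, mul_one]
    exact card_edge_le n

theorem integral_partialSups_twoStarSum_sq_le (hm : ∀ e, Measurable (X e))
    (hb : ∀ e ω, |X e ω| ≤ 1) (hX : iIndepFun X P) (h0 : ∀ e, ∫ ω, X e ω ∂P = 0) :
    ∫ ω, partialSups (fun m => |twoStarSum m fun e => X e ω|) n ^ 2 ∂P ≤ 8 * (n : ℝ) ^ 3 := by
  refine (isGradedChaos_twoStar.integral_partialSups_sq_le hm hb hX h0 n).trans ?_
  have key : ∀ (a b : Triple n) (e f : Edge n), e ≠ f → e ≠ b.edge₁ → e ≠ b.edge₂ →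
      ∫ ω, X f ω * (X b.edge₁ ω * X b.edge₂ ω) * X e ω ∂P = 0 := fun a b e f h1 h2 h3 =>
    integral_mul_coord_eq_zero hm hX (h0 e) (Y := fun x => x f * (x b.edge₁ * x b.edge₂))
      (by fun_prop) fun x y => by
        simp only [Function.update_of_ne h1.symm, Function.update_of_ne h2.symm,
          Function.update_of_ne h3.symm]
  have h1 := isGradedChaos_twoStar.integral_levelSum_sq_le (P := P) hm hb (D := 2)
    (fun q => {q, q.reverse}) (fun q => Finset.card_le_two) (fun a b hab => ?_) n
  · have hc : Fintype.card (Triple n) ≤ n ^ 3 := by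
      refine (Fintype.card_subtype_le _).trans (le_of_eq ?_)
      rw [Fintype.card_prod, Fintype.card_prod, Fintype.card_fin]
      ring
    have hc' : (Fintype.card (Triple n) : ℝ) ≤ (n : ℝ) ^ 3 := by exact_mod_cast hc
    push_cast at h1
    linarith
  -- Unless b is a or its reverse, some edge of a is missing from b; integrating out that edge gives
  -- zero.
  · rw [Finset.mem_insert, Finset.mem_singleton] at hab
    by_cases h : a.edge₁ = b.edge₁ ∨ a.edge₁ = b.edge₂
    · have h' : ¬ (a.edge₂ = b.edge₁ ∨ a.edge₂ = b.edge₂) := fun h2 =>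
        hab (Triple.eq_or_eq_reverse h h2)
      push Not at h'
      rw [← key a b a.edge₂ a.edge₁ a.edge₁_ne_edge₂.symm h'.1 h'.2]
      exact integral_congr_ae (ae_of_all _ fun ω => by simp only; ring)
    · push Not at h
      rw [← key a b a.edge₁ a.edge₂ a.edge₁_ne_edge₂ h.1 h.2]
      exact integral_congr_ae (ae_of_all _ fun ω => by simp only; ring)

end Moments

end Graph

/-! ### Decomposition of the edge and two-star process -/

section Decomposition

variable {n : ℕ}

theorem mem_firstVertices {m : ℕ} {i : Fin n} : i ∈ firstVertices n m ↔ (i : ℕ) < m := by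
  simp [firstVertices]

theorem card_firstVertices {m : ℕ} (h : m ≤ n) : (firstVertices n m).card = m := by
  have : (firstVertices n m).card = (Finset.range m).card := by
    refine Finset.card_nbij (fun i => (i : ℕ)) (fun i hi => ?_) (fun i _ j _ => Fin.ext) fun k hk => ?_
    · exact Finset.mem_range.2 (mem_firstVertices.1 hi)
    · have hk' : k < m := Finset.mem_range.1 hk
      exact ⟨⟨k, hk'.trans_le h⟩, mem_firstVertices.2 hk', rfl⟩
  rw [this, Finset.card_range]

theorem sum_edgeVal (m : ℕ) (x : Edge n → ℝ) :
    ∑ i ∈ firstVertices n m, ∑ j ∈ firstVertices n m, edgeVal x i j = 2 * edgeSum m x := by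
  set V := firstVertices n m with hV
  have hsplit : ∀ i j : Fin n, edgeVal x i j
      = (if i < j then edgeVal x i j else 0) + if j < i then edgeVal x j i else 0 := fun i j => by
    rcases lt_trichotomy i j with h | h | h
    · rw [if_pos h, if_neg h.asymm, add_zero]
    · rw [h, edgeVal_self, if_neg (lt_irrefl _), add_zero]
    · rw [if_neg h.asymm, if_pos h, zero_add, edgeVal_comm]
  have hL : ∑ i ∈ V, ∑ j ∈ V, (if i < j then edgeVal x i j else 0) = edgeSum m x := by
    rw [← Finset.sum_product' V V (f := fun i j => if i < j then edgeVal x i j else 0),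
      ← Finset.sum_filter]
    symm
    refine Finset.sum_nbij (fun e : Edge n => (e.lower, e.1)) (fun e he => ?_)
      (fun e _ f _ h => ?_) (fun q hq => ?_) fun e _ => ?_
    · have h1 : (e.1 : ℕ) < m := (Finset.mem_filter.1 he).2
      have h2 := Fin.lt_def.1 e.lower_lt
      simp only [Finset.mem_filter, Finset.mem_product, hV, mem_firstVertices]
      exact ⟨⟨h2.trans h1, h1⟩, e.lower_lt⟩
    · simp only [Prod.mk.injEq] at h
      exact Edge.ext' (congrArg Fin.val h.2) (congrArg Fin.val h.1)
    · obtain ⟨i, j⟩ := q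
      simp only [Finset.coe_filter, Finset.mem_product, hV, mem_firstVertices, mem_ofPred_eq] at hq
      refine ⟨⟨j, ⟨i, hq.2⟩⟩, ?_, rfl⟩
      simp only [Finset.coe_filter, Finset.mem_univ, true_and, mem_ofPred_eq]
      exact hq.1.2
    · exact (by rw [edgeVal, dif_pos e.lower_lt.ne, edgeOf_lower] : x e = edgeVal x e.lower e.1)
  calc ∑ i ∈ V, ∑ j ∈ V, edgeVal x i j
      = ∑ i ∈ V, ∑ j ∈ V, (if i < j then edgeVal x i j else 0)
        + ∑ i ∈ V, ∑ j ∈ V, (if j < i then edgeVal x j i else 0) := by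
        rw [← Finset.sum_add_distrib]
        refine Finset.sum_congr rfl fun i _ => ?_
        rw [← Finset.sum_add_distrib]
        exact Finset.sum_congr rfl fun j _ => hsplit i j
    _ = 2 * edgeSum m x := by
        rw [Finset.sum_comm (f := fun i j => if j < i then edgeVal x j i else 0), hL]
        ring

theorem sum_mul_edgeVal (m : ℕ) (x : Edge n → ℝ) :
    ∑ i ∈ firstVertices n m, ∑ j ∈ firstVertices n m, ∑ k ∈ firstVertices n m,
      (if i ≠ j ∧ j ≠ k ∧ i ≠ k then edgeVal x i j * edgeVal x j k else 0) = twoStarSum m x := by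
  set V := firstVertices n m with hV
  have h1 : ∀ i, ∑ j ∈ V, ∑ k ∈ V,
      (if i ≠ j ∧ j ≠ k ∧ i ≠ k then edgeVal x i j * edgeVal x j k else 0)
      = ∑ q ∈ V ×ˢ V, if i ≠ q.1 ∧ q.1 ≠ q.2 ∧ i ≠ q.2 then edgeVal x i q.1 * edgeVal x q.1 q.2
        else 0 := fun i => (Finset.sum_product' V V (f := fun j k =>
          if i ≠ j ∧ j ≠ k ∧ i ≠ k then edgeVal x i j * edgeVal x j k else 0)).symm
  simp only [h1]
  rw [← Finset.sum_product' V (V ×ˢ V) (f := fun i q =>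
    if i ≠ q.1 ∧ q.1 ≠ q.2 ∧ i ≠ q.2 then edgeVal x i q.1 * edgeVal x q.1 q.2 else 0),
    ← Finset.sum_filter]
  symm
  refine Finset.sum_nbij (fun q : Triple n => q.1) (fun q hq => ?_)
    (fun q _ r _ h => Subtype.ext h) (fun q hq => ?_) fun q _ => ?_
  · have hl : q.level < m := (Finset.mem_filter.1 hq).2
    unfold Triple.level at hl
    simp only [Finset.mem_filter, Finset.mem_product, hV, mem_firstVertices]
    exact ⟨⟨by omega, by omega, by omega⟩, q.2⟩
  · obtain ⟨i, j, k⟩ := q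
    simp only [Finset.coe_filter, Finset.mem_product, hV, mem_firstVertices, mem_ofPred_eq] at hq
    refine ⟨⟨(i, j, k), hq.2⟩, Finset.mem_coe.2 (Finset.mem_filter.2 ⟨Finset.mem_univ _, ?_⟩), rfl⟩
    unfold Triple.level
    simp only
    omega
  · rw [edgeVal, edgeVal, dif_pos q.2.1, dif_pos q.2.2.1]
    rfl

theorem card_filter_ne_ne {m : ℕ} (hmn : m ≤ n) {i j : Fin n} (hi : i ∈ firstVertices n m)
    (hj : j ∈ firstVertices n m) (hij : i ≠ j) :
    (((firstVertices n m).filter fun k => j ≠ k ∧ i ≠ k).card : ℝ) = (m : ℝ) - 2 := by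
  have h1 : (firstVertices n m).filter (fun k => j ≠ k ∧ i ≠ k)
      = ((firstVertices n m).erase i).erase j := by
    ext k
    simp only [Finset.mem_filter, Finset.mem_erase]
    tauto
  have h2 : ((firstVertices n m).erase i).card = m - 1 := by
    rw [Finset.card_erase_of_mem hi, card_firstVertices hmn]
  have h3 : j ∈ (firstVertices n m).erase i := Finset.mem_erase.2 ⟨hij.symm, hj⟩
  have h4 : 1 < m := by
    have h5 := mem_firstVertices.1 hi
    have h6 := mem_firstVertices.1 hj
    have h7 : (i : ℕ) ≠ j := fun h => hij (Fin.ext h)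
    omega
  rw [h1, Finset.card_erase_of_mem h3, h2, Nat.sub_sub, Nat.cast_sub h4]
  norm_num

/-- Every ordered pair of distinct vertices has m - 2 choices of third vertex. This matches the
factor ⌊nt⌋ - 2 in T_n and makes the linear part of V_n exactly 2p times that of T_n. -/
theorem sum_distinct_edgeVal {m : ℕ} (hmn : m ≤ n) (x : Edge n → ℝ) :
    ∑ i ∈ firstVertices n m, ∑ j ∈ firstVertices n m, ∑ k ∈ firstVertices n m,
      (if i ≠ j ∧ j ≠ k ∧ i ≠ k then edgeVal x i j else 0) = 2 * ((m : ℝ) - 2) * edgeSum m x := by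
  rw [mul_comm 2, mul_assoc, ← sum_edgeVal, Finset.mul_sum]
  refine Finset.sum_congr rfl fun i hi => ?_
  rw [Finset.mul_sum]
  refine Finset.sum_congr rfl fun j hj => ?_
  by_cases h : i = j
  · rw [h, edgeVal_self]
    simp
  · simp only [ne_eq, h, not_false_eq_true, true_and]
    rw [← Finset.sum_filter, Finset.sum_const, nsmul_eq_mul]
    congr 1
    exact card_filter_ne_ne hmn hi hj h

theorem sum_distinct_edgeVal' {m : ℕ} (hmn : m ≤ n) (x : Edge n → ℝ) :
    ∑ i ∈ firstVertices n m, ∑ j ∈ firstVertices n m, ∑ k ∈ firstVertices n m,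
      (if i ≠ j ∧ j ≠ k ∧ i ≠ k then edgeVal x j k else 0) = 2 * ((m : ℝ) - 2) * edgeSum m x := by
  rw [← sum_distinct_edgeVal hmn]
  set V := firstVertices n m
  calc _ = ∑ i ∈ V, ∑ k ∈ V, ∑ j ∈ V,
        (if i ≠ j ∧ j ≠ k ∧ i ≠ k then edgeVal x j k else 0) :=
        Finset.sum_congr rfl fun i _ => Finset.sum_comm
    _ = ∑ k ∈ V, ∑ i ∈ V, ∑ j ∈ V,
        (if i ≠ j ∧ j ≠ k ∧ i ≠ k then edgeVal x j k else 0) := Finset.sum_comm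
    _ = ∑ k ∈ V, ∑ j ∈ V, ∑ i ∈ V,
        (if i ≠ j ∧ j ≠ k ∧ i ≠ k then edgeVal x j k else 0) :=
        Finset.sum_congr rfl fun i _ => Finset.sum_comm
    _ = _ := Finset.sum_congr rfl fun k _ => Finset.sum_congr rfl fun j _ =>
        Finset.sum_congr rfl fun i _ => by
          rw [edgeVal_comm x j k]
          exact if_congr (by constructor <;> rintro ⟨h1, h2, h3⟩ <;>
            exact ⟨h2.symm, h1.symm, h3.symm⟩) rfl rfl

end Decomposition

/-! ### The edge indicators of a binomial random graph -/

section BinomialRandomGraph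

variable {n : ℕ}

/-- There are finitely many graphs, so measurable singletons make every function of the graph
measurable, and integrable for finite measures. -/
instance : MeasurableSingletonClass (SimpleGraph (Fin n)) where
  measurableSet_singleton G := by
    have : ({G} : Set (SimpleGraph (Fin n))) = SimpleGraph.edgeSet ⁻¹' {G.edgeSet} := by
      ext H
      simp
    rw [this]
    exact SimpleGraph.measurable_edgeSet (Set.toFinite _).measurableSet

/-- The centred edge indicators of a graph. -/
noncomputable def centredEdge (p : ℝ) (e : Edge n) (H : SimpleGraph (Fin n)) : ℝ :=
  edgeIndicator H e.lower e.1 - p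

theorem edgeIndicator_comm (H : SimpleGraph (Fin n)) (i j : Fin n) :
    edgeIndicator H i j = edgeIndicator H j i := by
  classical
  unfold edgeIndicator
  exact if_congr (H.adj_comm i j) rfl rfl

theorem edgeIndicator_eq (p : ℝ) (H : SimpleGraph (Fin n)) {i j : Fin n} (h : i ≠ j) :
    edgeIndicator H i j = edgeVal (fun e => centredEdge p e H) i j + p := by
  rw [edgeVal, dif_pos h, centredEdge, sub_add_cancel]
  rcases lt_or_gt_of_ne h with h' | h'
  · rw [show edgeOf i j h = ⟨j, ⟨i, h'⟩⟩ from dif_pos h']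
    rfl
  · rw [edgeOf_comm, show edgeOf j i h.symm = ⟨i, ⟨j, h'⟩⟩ from dif_pos h', edgeIndicator_comm]
    rfl

theorem abs_centredEdge_le (p : I) (e : Edge n) (H : SimpleGraph (Fin n)) :
    |centredEdge (p : ℝ) e H| ≤ 1 := by
  have h0 := p.2.1
  have h1 := p.2.2
  rw [centredEdge, edgeIndicator, abs_le]
  split_ifs <;> constructor <;> linarith

theorem measurable_centredEdge (p : ℝ) (e : Edge n) : Measurable (centredEdge p e) :=
  measurable_of_finite _

open Classical in
theorem edgeIndicator_fromEdgeSet (q : Sym2 (Fin n) → Prop) {i j : Fin n} (h : i ≠ j) :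
    edgeIndicator (SimpleGraph.fromEdgeSet {i | q i}) i j = if q s(i, j) then 1 else 0 := by
  simp [edgeIndicator, h]

/-- The law of the indicators from which the binomial random graph is built. -/
noncomputable def coinMeasure (n : ℕ) (p : I) (i : Sym2 (Fin n)) : Measure Prop :=
  unitInterval.toNNReal p • Measure.dirac (i ∈ (Sym2.diagSetᶜ : Set (Sym2 (Fin n))))
    + unitInterval.toNNReal (σ p) • Measure.dirac False

instance (p : I) (i : Sym2 (Fin n)) : IsProbabilityMeasure (coinMeasure n p i) := by
  unfold coinMeasure
  infer_instance

theorem binomialRandom_eq_map_infinitePi (p : I) : SimpleGraph.binomialRandom (Fin n) p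
    = (Measure.infinitePi (coinMeasure n p)).map fun q => SimpleGraph.fromEdgeSet {i | q i} := by
  rw [SimpleGraph.binomialRandom_eq_map, setBernoulli_eq_map,
    Measure.map_map (measurable_of_finite _) (measurable_of_finite _)]
  rfl

/-- The indicators are distinct coordinates of a product measure, since e ↦ {lower e, e.1} is
injective. Independence passes to the image measure because it depends on the joint law only. -/
theorem iIndepFun_centredEdge (p : I) :
    iIndepFun (centredEdge (p : ℝ)) (SimpleGraph.binomialRandom (Fin n) p) := by
  classical
  have hinj : Function.Injective fun e : Edge n => s(e.lower, e.1) := fun e f h => by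
    have h1 := Fin.lt_def.1 e.lower_lt
    have h2 := Fin.lt_def.1 f.lower_lt
    rcases Sym2.eq_iff.1 h with ⟨h3, h4⟩ | ⟨h3, h4⟩
    · exact Edge.ext' (congrArg Fin.val h4) (congrArg Fin.val h3)
    · rw [h3, h4] at h1
      omega
  have h : iIndepFun (fun (e : Edge n) (q : Sym2 (Fin n) → Prop) =>
      (if q s(e.lower, e.1) then 1 else 0 : ℝ) - p) (Measure.infinitePi (coinMeasure n p)) :=
    (iIndepFun_infinitePi (P := coinMeasure n p) (X := fun _ (q : Prop) => (if q then 1 else 0 : ℝ) - p)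
      fun _ => measurable_of_finite _).precomp hinj
  have hfun : (fun (e : Edge n) (q : Sym2 (Fin n) → Prop) =>
      (if q s(e.lower, e.1) then 1 else 0 : ℝ) - p)
      = fun e q => centredEdge (p : ℝ) e (SimpleGraph.fromEdgeSet {i | q i}) := by
    funext e q
    rw [centredEdge, edgeIndicator_fromEdgeSet q e.lower_lt.ne]
  rw [hfun, iIndepFun_iff_map_fun_eq_pi_map fun e => (measurable_of_finite _).aemeasurable] at h
  rw [iIndepFun_iff_map_fun_eq_pi_map fun e => (measurable_centredEdge _ e).aemeasurable,
    binomialRandom_eq_map_infinitePi, Measure.map_map (measurable_of_finite _) (measurable_of_finite _)]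
  simp only [Function.comp_def]
  rw [h]
  congr 1
  funext e
  rw [Measure.map_map (measurable_of_finite _) (measurable_of_finite _)]
  rfl

theorem integral_edgeIndicator (p : I) {i j : Fin n} (h : i ≠ j) :
    ∫ H, edgeIndicator H i j ∂SimpleGraph.binomialRandom (Fin n) p = p := by
  classical
  rw [binomialRandom_eq_map_infinitePi, integral_map (measurable_of_finite _).aemeasurable
    (measurable_of_finite _).aestronglyMeasurable]
  simp only [edgeIndicator_fromEdgeSet _ h]
  have h1 := integral_map (μ := Measure.infinitePi (coinMeasure n p))
    (φ := fun q : Sym2 (Fin n) → Prop => q s(i, j)) (f := fun q => if q then (1 : ℝ) else 0)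
    (measurable_pi_apply _).aemeasurable (measurable_of_finite _).aestronglyMeasurable
  rw [← h1, show (fun q : Sym2 (Fin n) → Prop => q s(i, j)) = Function.eval s(i, j) from rfl,
    Measure.infinitePi_map_eval, coinMeasure, integral_add_measure (Integrable.of_finite)
      (Integrable.of_finite), integral_smul_nnreal_measure, integral_smul_nnreal_measure,
    integral_dirac, integral_dirac]
  simp [h, NNReal.smul_def]

theorem integral_centredEdge (p : I) (e : Edge n) :
    ∫ H, centredEdge (p : ℝ) e H ∂SimpleGraph.binomialRandom (Fin n) p = 0 := by
  unfold centredEdge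
  rw [integral_sub .of_finite .of_finite, integral_edgeIndicator p e.lower_lt.ne]
  simp

theorem integral_centredEdge_sq (p : I) (e : Edge n) :
    ∫ H, centredEdge (p : ℝ) e H ^ 2 ∂SimpleGraph.binomialRandom (Fin n) p = p * (1 - p) := by
  have h : ∀ H, centredEdge (p : ℝ) e H ^ 2
      = (1 - 2 * p) * edgeIndicator H e.lower e.1 + (p : ℝ) ^ 2 := fun H => by
    rw [centredEdge, edgeIndicator]
    split_ifs <;> ring
  simp only [h]
  rw [integral_add .of_finite .of_finite, integral_const_mul,
    integral_edgeIndicator p e.lower_lt.ne]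
  simp
  ring

end BinomialRandomGraph

/-! ### Decomposition of the process -/

section Decomposition

variable {n : ℕ}

/-- The linear part of the edge and two-star process. -/
noncomputable def edgePath (n : ℕ) (v : EuclideanSpace ℝ (Fin 2)) (x : Edge n → ℝ) :
    SkorokhodSpace 2 :=
  floorPath n 2 fun m => (((m : ℝ) - 2) / (n : ℝ) ^ 2 * edgeSum (m : ℕ) x) • v

/-- The quadratic part of the edge and two-star process. -/
noncomputable def starPath (n : ℕ) (x : Edge n → ℝ) : SkorokhodSpace 2 :=
  floorPath n 2 fun m => (1 / (2 * (n : ℝ) ^ 2) * twoStarSum (m : ℕ) x) • !₂[0, 1]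

/-- The deterministic constant is left unnamed: it is the expectation, and cancels on centring. -/
theorem exists_edgeStat_eq (n : ℕ) (p : ℝ) (t : I) : ∃ c : ℝ, ∀ H : SimpleGraph (Fin n),
    edgeStat H t = ((⌊(n : ℝ) * t⌋₊ : ℝ) - 2) / (n : ℝ) ^ 2
      * edgeSum ⌊(n : ℝ) * t⌋₊ (fun e => centredEdge p e H) + c := by
  set m := ⌊(n : ℝ) * t⌋₊ with hm
  refine ⟨((m : ℝ) - 2) / (2 * (n : ℝ) ^ 2) * ∑ i ∈ firstVertices n m, ∑ j ∈ firstVertices n m,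
    if i ≠ j then p else 0, fun H => ?_⟩
  have h : ∀ i j : Fin n, edgeIndicator H i j
      = edgeVal (fun e => centredEdge p e H) i j + if i ≠ j then p else 0 := fun i j => by
    by_cases h : i = j
    · rw [h, edgeVal_self, if_neg (by simp), edgeIndicator, if_neg (by simp), add_zero]
    · rw [if_pos h, ← edgeIndicator_eq p H h]
  simp only [edgeStat, ← hm, h, Finset.sum_add_distrib]
  rw [sum_edgeVal]
  by_cases hn : (n : ℝ) = 0
  · simp [hn]
  · field_simp

/-- The expansion of (x + p)(x' + p) over two-stars: the two cross terms have equal sums, which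
produces 2p. -/
theorem exists_twoStarStat_eq (n : ℕ) (p : ℝ) (t : I) : ∃ c : ℝ, ∀ H : SimpleGraph (Fin n),
    twoStarStat H t = 1 / (2 * (n : ℝ) ^ 2)
        * twoStarSum ⌊(n : ℝ) * t⌋₊ (fun e => centredEdge p e H)
      + 2 * p * (((⌊(n : ℝ) * t⌋₊ : ℝ) - 2) / (n : ℝ) ^ 2
        * edgeSum ⌊(n : ℝ) * t⌋₊ (fun e => centredEdge p e H)) + c := by
  have hmn := Nat.lt_succ_iff.1 (floor_mul_lt_succ n t)
  set m := ⌊(n : ℝ) * t⌋₊ with hm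
  refine ⟨1 / (2 * (n : ℝ) ^ 2) * ∑ i ∈ firstVertices n m, ∑ j ∈ firstVertices n m,
    ∑ k ∈ firstVertices n m, if i ≠ j ∧ j ≠ k ∧ i ≠ k then p ^ 2 else 0, fun H => ?_⟩
  set x : Edge n → ℝ := fun e => centredEdge p e H
  have h : ∀ i j k : Fin n,
      (if i ≠ j ∧ j ≠ k ∧ i ≠ k then edgeIndicator H i j * edgeIndicator H j k else 0)
      = (if i ≠ j ∧ j ≠ k ∧ i ≠ k then edgeVal x i j * edgeVal x j k else 0)
        + p * (if i ≠ j ∧ j ≠ k ∧ i ≠ k then edgeVal x i j else 0)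
        + p * (if i ≠ j ∧ j ≠ k ∧ i ≠ k then edgeVal x j k else 0)
        + if i ≠ j ∧ j ≠ k ∧ i ≠ k then p ^ 2 else 0 := fun i j k => by
    by_cases h : i ≠ j ∧ j ≠ k ∧ i ≠ k
    · simp only [if_pos h]
      rw [edgeIndicator_eq p H h.1, edgeIndicator_eq p H h.2.1]
      ring
    · simp only [if_neg h]
      ring
  simp only [twoStarStat, ← hm, h, Finset.sum_add_distrib, ← Finset.mul_sum]
  rw [sum_mul_edgeVal, sum_distinct_edgeVal hmn, sum_distinct_edgeVal' hmn]
  by_cases hn : (n : ℝ) = 0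
  · simp [hn]
  · field_simp
    ring

theorem integral_edgeSum_centredEdge (p : I) (m : ℕ) :
    ∫ H, edgeSum m (fun e : Edge n => centredEdge (p : ℝ) e H)
      ∂SimpleGraph.binomialRandom (Fin n) p = 0 := by
  unfold edgeSum levelSum
  rw [integral_finsetSum _ fun _ _ => .of_finite]
  exact Finset.sum_eq_zero fun e _ => integral_centredEdge p e

theorem integral_twoStarSum_centredEdge (p : I) (m : ℕ) :
    ∫ H, twoStarSum m (fun e : Edge n => centredEdge (p : ℝ) e H)
      ∂SimpleGraph.binomialRandom (Fin n) p = 0 := by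
  unfold twoStarSum levelSum
  rw [integral_finsetSum _ fun _ _ => .of_finite]
  exact Finset.sum_eq_zero fun q _ => integral_mul_coord_eq_zero (Y := fun x => x q.edge₁)
    (measurable_centredEdge _) (iIndepFun_centredEdge p) (integral_centredEdge p _)
    (measurable_pi_apply _) fun x y => Function.update_of_ne q.edge₁_ne_edge₂ _ _

theorem edgeTwoStarProcess_eq (p : I) (H : SimpleGraph (Fin n)) :
    edgeTwoStarProcess (SimpleGraph.binomialRandom (Fin n) p) id H
      = edgePath n !₂[1, 2 * (p : ℝ)] (fun e => centredEdge (p : ℝ) e H)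
        + starPath n fun e => centredEdge (p : ℝ) e H := by
  refine Subtype.ext (funext fun t => ?_)
  obtain ⟨c, hc⟩ := exists_edgeStat_eq n (p : ℝ) t
  obtain ⟨d, hd⟩ := exists_twoStarStat_eq n (p : ℝ) t
  have hc' : ∫ H, edgeStat H t ∂SimpleGraph.binomialRandom (Fin n) p = c := by
    simp only [hc]
    rw [integral_add .of_finite .of_finite, integral_const_mul, integral_edgeSum_centredEdge]
    simp
  have hd' : ∫ H, twoStarStat H t ∂SimpleGraph.binomialRandom (Fin n) p = d := by
    simp only [hd]
    rw [integral_add .of_finite .of_finite, integral_add .of_finite .of_finite,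
      integral_const_mul, integral_const_mul, integral_const_mul, integral_edgeSum_centredEdge,
      integral_twoStarSum_centredEdge]
    simp
  change centredPath (SimpleGraph.binomialRandom (Fin n) p) id H t
    = edgePath n !₂[1, 2 * (p : ℝ)] (fun e => centredEdge (p : ℝ) e H) t
      + starPath n (fun e => centredEdge (p : ℝ) e H) t
  rw [edgePath, starPath, floorPath_apply, floorPath_apply, centredPath]
  simp only [id, hc', hd']
  rw [hc, hd]
  ext k
  fin_cases k <;> simp
  ring

/-- The process built from a random graph depends on the graph through its value and its law. -/
theorem edgeTwoStarProcess_eq_of_hasLaw {Ω : Type*} [MeasurableSpace Ω] {P : Measure Ω} {p : I}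
    {G : Ω → SimpleGraph (Fin n)} (hG : HasLaw G (SimpleGraph.binomialRandom (Fin n) p) P) (ω : Ω) :
    edgeTwoStarProcess P G ω
      = edgeTwoStarProcess (SimpleGraph.binomialRandom (Fin n) p) id (G ω) := by
  refine Subtype.ext (funext fun t => ?_)
  change centredPath _ _ _ t = centredPath _ _ _ t
  have h1 := hG.integral_comp (f := fun H => edgeStat H t) (measurable_of_finite _).aestronglyMeasurable
  have h2 := hG.integral_comp (f := fun H => twoStarStat H t)
    (measurable_of_finite _).aestronglyMeasurable
  simp only [Function.comp_def] at h1 h2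
  simp only [centredPath, h1, h2, id]

end Decomposition

/-! ### Comparison of sums of independent variables with matching moments -/

section Lindeberg

variable {V : Type*} [NormedAddCommGroup V] [NormedSpace ℝ V] {E Ω Ω' : Type*} [Fintype E]
  [MeasurableSpace Ω] [MeasurableSpace Ω'] {P : Measure Ω} {P' : Measure Ω'}

theorem integral_comp_sum_smul_eq [IsProbabilityMeasure P] {g : V → ℝ} (hg : Continuous g)
    (h : E → V) {X : E → Ω → ℝ} (hm : ∀ e, AEMeasurable (X e) P) (hX : iIndepFun X P) :
    ∫ ω, g (∑ e, X e ω • h e) ∂P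
      = ∫ x, g (0 + ∑ i, x i • h ((Fintype.equivFin E).symm i))
        ∂Measure.pi fun i => P.map (X ((Fintype.equivFin E).symm i)) := by
  have hX' := hX.precomp (Fintype.equivFin E).symm.injective
  rw [← iIndepFun.map_fun_eq_pi_map (fun i => hm _) hX', integral_map]
  · refine integral_congr_ae (ae_of_all _ fun ω => ?_)
    simp only [zero_add]
    rw [← (Fintype.equivFin E).symm.sum_comp]
  · exact aemeasurable_pi_lambda _ fun i => hm _
  · have : Continuous fun x : Fin (Fintype.card E) → ℝ =>
        g (0 + ∑ i, x i • h ((Fintype.equivFin E).symm i)) := by fun_prop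
    exact this.aestronglyMeasurable

/-- Lindeberg's bound for two independent families whose first two moments agree. -/
theorem abs_integral_sum_smul_sub_le [IsProbabilityMeasure P] [IsProbabilityMeasure P'] {g : V → ℝ}
    (hgc : Continuous g) {N : ℝ} (hN : 0 ≤ N) (hg : ∀ w, |g w| ≤ N * (1 + ‖w‖ ^ 3))
    (hT : ∀ w h : V, ∃ a b c : ℝ, ∀ y : ℝ,
      |g (w + y • h) - (a + b * y + c * y ^ 2)| ≤ N * ‖h‖ ^ 3 * |y| ^ 3)
    (h : E → V) {X : E → Ω → ℝ} {Y : E → Ω' → ℝ} (hXm : ∀ e, AEMeasurable (X e) P)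
    (hYm : ∀ e, AEMeasurable (Y e) P') (hX : iIndepFun X P) (hY : iIndepFun Y P')
    (hX3 : ∀ e, Integrable (fun ω => |X e ω| ^ 3) P)
    (hY3 : ∀ e, Integrable (fun ω => |Y e ω| ^ 3) P')
    (h1 : ∀ e, ∫ ω, X e ω ∂P = ∫ ω, Y e ω ∂P') (h2 : ∀ e, ∫ ω, X e ω ^ 2 ∂P = ∫ ω, Y e ω ^ 2 ∂P') :
    |∫ ω, g (∑ e, X e ω • h e) ∂P - ∫ ω, g (∑ e, Y e ω • h e) ∂P'|
      ≤ ∑ e, N * ‖h e‖ ^ 3 * (∫ ω, |X e ω| ^ 3 ∂P + ∫ ω, |Y e ω| ^ 3 ∂P') := by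
  let φ := (Fintype.equivFin E).symm
  have := fun i => Measure.isProbabilityMeasure_map (μ := P) (hXm (φ i))
  have := fun i => Measure.isProbabilityMeasure_map (μ := P') (hYm (φ i))
  have e1 : ∀ (f : ℝ → ℝ), Continuous f → ∀ i,
      ∫ y, f y ∂P.map (X (φ i)) = ∫ ω, f (X (φ i) ω) ∂P := fun f hf i =>
    integral_map (hXm _) hf.aestronglyMeasurable
  have e2 : ∀ (f : ℝ → ℝ), Continuous f → ∀ i,
      ∫ y, f y ∂P'.map (Y (φ i)) = ∫ ω, f (Y (φ i) ω) ∂P' := fun f hf i =>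
    integral_map (hYm _) hf.aestronglyMeasurable
  have hc : Continuous fun y : ℝ => |y| ^ 3 := by fun_prop
  rw [integral_comp_sum_smul_eq hgc h hXm hX, integral_comp_sum_smul_eq hgc h hYm hY]
  refine (lindeberg_replacement hgc hN hg hT (fun i => h (φ i)) (fun i => P.map (X (φ i)))
    (fun i => P'.map (Y (φ i))) (fun i => ?_) (fun i => ?_) (fun i => ?_) (fun i => ?_) 0).trans
    (le_of_eq ?_)
  · exact (integrable_map_measure hc.aestronglyMeasurable (hXm _)).2 (hX3 _)
  · exact (integrable_map_measure hc.aestronglyMeasurable (hYm _)).2 (hY3 _)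
  · exact (e1 _ continuous_id i).trans ((h1 _).trans (e2 _ continuous_id i).symm)
  · rw [e1 _ (continuous_pow 2), e2 _ (continuous_pow 2)]
    exact h2 _
  · simp only [e1 _ hc, e2 _ hc]
    exact φ.sum_comp fun e => N * ‖h e‖ ^ 3 * (∫ ω, |X e ω| ^ 3 ∂P + ∫ ω, |Y e ω| ^ 3 ∂P')

/-- Indeed |y|³ ≤ (y² + y⁴)/2, which is below the second-order expansion of exp(y²). -/
theorem abs_cube_le_exp_sq (y : ℝ) : |y| ^ 3 ≤ Real.exp (y ^ 2) := by
  have h1 := Real.quadratic_le_exp_of_nonneg (sq_nonneg y)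
  have h2 : |y| ^ 2 = y ^ 2 := sq_abs y
  have h3 := sq_nonneg (|y| - y ^ 2)
  have h4 : |y| ^ 3 = |y| * y ^ 2 := by rw [pow_succ', h2]
  nlinarith [sq_nonneg y]

/-- Dominated by E exp(X²) = (1 - 2v)^{-1/2} ≤ √2. The restriction on v fits the variance p(1-p). -/
theorem integrable_abs_cube_of_hasLaw {X : Ω → ℝ} {v : ℝ≥0} (hX : HasLaw X (gaussianReal 0 v) P)
    (hv : (v : ℝ) ≤ 1 / 4) :
    Integrable (fun ω => |X ω| ^ 3) P ∧ ∫ ω, |X ω| ^ 3 ∂P ≤ 3 / 2 := by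
  have hv' : 2 * 1 * (v : ℝ) < 1 := by linarith
  have hi := integrable_exp_mul_sq_of_hasLaw hX hv'
  have hle : ∀ ω, |X ω| ^ 3 ≤ Real.exp (1 * X ω ^ 2) := fun ω => by
    rw [one_mul]
    exact abs_cube_le_exp_sq _
  have h3 : Integrable (fun ω => |X ω| ^ 3) P := by
    refine hi.mono' ((continuous_abs.pow 3).measurable.comp_aemeasurable
      hX.aemeasurable).aestronglyMeasurable (ae_of_all _ fun ω => ?_)
    rw [Real.norm_of_nonneg (by positivity)]
    exact hle ω
  refine ⟨h3, (integral_mono h3 hi hle).trans ?_⟩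
  have h5 := hX.integral_comp (f := fun x => Real.exp (1 * x ^ 2))
    (by fun_prop : Measurable fun x : ℝ => Real.exp (1 * x ^ 2)).aestronglyMeasurable
  simp only [Function.comp_def] at h5
  rw [h5, integral_exp_mul_sq_gaussianReal hv', Real.sqrt_le_left (by norm_num)]
  rw [inv_le_comm₀ (by linarith) (by norm_num)]
  linarith

end Lindeberg

/-! ### Norms of the linear and quadratic parts -/

section EdgePath

variable {n : ℕ}

theorem Edge.two_le_of_fst_lt {e : Edge n} {m : ℕ} (h : (e.1 : ℕ) < m) : 2 ≤ m := by
  have := Fin.lt_def.1 e.lower_lt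
  omega

/-- The coefficient of an edge in the linear part of the process. -/
noncomputable def edgeDirection (v : EuclideanSpace ℝ (Fin 2)) (e : Edge n) : SkorokhodSpace 2 :=
  floorPath n 2 fun m => if (e.1 : ℕ) < m then (((m : ℝ) - 2) / (n : ℝ) ^ 2) • v else 0

theorem abs_sub_two_div_le {m : ℕ} (h2 : 2 ≤ m) (hmn : m ≤ n) :
    |((m : ℝ) - 2) / (n : ℝ) ^ 2| ≤ 1 / (n : ℝ) := by
  have h2' : (2 : ℝ) ≤ m := by exact_mod_cast h2
  have hmn' : (m : ℝ) ≤ n := by exact_mod_cast hmn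
  have hn : (0 : ℝ) < n := by linarith
  rw [abs_of_nonneg (div_nonneg (by linarith) (by positivity)), div_le_div_iff₀ (by positivity) hn]
  nlinarith

theorem norm_edgeDirection_le (v : EuclideanSpace ℝ (Fin 2)) (e : Edge n) :
    ‖edgeDirection v e‖ ≤ 1 / n * ‖v‖ := by
  refine norm_floorPath_le fun m => ?_
  split_ifs with h
  · rw [norm_smul, Real.norm_eq_abs]
    exact mul_le_mul_of_nonneg_right
      (abs_sub_two_div_le (Edge.two_le_of_fst_lt h) (Nat.lt_succ_iff.1 m.2)) (norm_nonneg _)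
  · rw [norm_zero]
    positivity

theorem edgePath_eq_sum (v : EuclideanSpace ℝ (Fin 2)) (x : Edge n → ℝ) :
    edgePath n v x = ∑ e, x e • edgeDirection v e := by
  unfold edgePath edgeDirection
  simp only [← map_smul, ← map_sum]
  congr 1
  funext m
  rw [Finset.sum_apply, edgeSum, levelSum, Finset.mul_sum, Finset.sum_smul, Finset.sum_filter]
  refine Finset.sum_congr rfl fun e _ => ?_
  simp only [Pi.smul_apply]
  split_ifs
  · rw [smul_smul, mul_comm]
  · rw [smul_zero]

theorem norm_edgePath_le (v : EuclideanSpace ℝ (Fin 2)) (x : Edge n → ℝ) :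
    ‖edgePath n v x‖ ≤ ‖v‖ / n * partialSups (fun m => |edgeSum m x|) n := by
  have h0 : 0 ≤ partialSups (fun m => |edgeSum m x|) n :=
    (abs_nonneg _).trans (le_partialSups (fun m => |edgeSum m x|) n)
  refine norm_floorPath_le fun m => ?_
  rw [norm_smul, Real.norm_eq_abs, abs_mul]
  by_cases h2 : 2 ≤ (m : ℕ)
  · have h1 := le_partialSups_of_le (fun m => |edgeSum m x|) (Nat.lt_succ_iff.1 m.2)
    have h3 := abs_sub_two_div_le h2 (Nat.lt_succ_iff.1 m.2)
    calc _ ≤ 1 / (n : ℝ) * partialSups (fun m => |edgeSum m x|) n * ‖v‖ := by gcongr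
      _ = _ := by ring
  -- Fewer than two vertices span no edge, so the negative factor m - 2 does not matter.
  · have : edgeSum (m : ℕ) x = 0 := Finset.sum_eq_zero fun e he =>
      absurd (Edge.two_le_of_fst_lt (Finset.mem_filter.1 he).2) h2
    rw [this, abs_zero, mul_zero, zero_mul]
    positivity

theorem norm_starPath_le (x : Edge n → ℝ) :
    ‖starPath n x‖ ≤ 1 / (2 * (n : ℝ) ^ 2) * partialSups (fun m => |twoStarSum m x|) n := by
  refine norm_floorPath_le fun m => ?_
  have h1 := le_partialSups_of_le (fun m => |twoStarSum m x|) (Nat.lt_succ_iff.1 m.2)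
  have h2 : ‖(!₂[0, 1] : EuclideanSpace ℝ (Fin 2))‖ = 1 := by
    simp [EuclideanSpace.norm_eq]
  rw [norm_smul, Real.norm_eq_abs, abs_mul, abs_of_nonneg (by positivity), h2, mul_one]
  gcongr

theorem norm_direction_sq (p : ℝ) :
    ‖(!₂[1, 2 * p] : EuclideanSpace ℝ (Fin 2))‖ ^ 2 = 1 + 4 * p ^ 2 := by
  rw [EuclideanSpace.norm_sq_eq]
  simp
  ring

/-- The quadratic part of the process is negligible. -/
theorem abs_integral_process_sub_edgePath_le (hn : 1 ≤ n) {g : SkorokhodSpace 2 → ℝ} (hg : MemM2 g)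
    (p : I) :
    |∫ H, g (edgeTwoStarProcess (SimpleGraph.binomialRandom (Fin n) p) id H)
        ∂SimpleGraph.binomialRandom (Fin n) p
      - ∫ H, g (edgePath n !₂[1, 2 * (p : ℝ)] fun e => centredEdge (p : ℝ) e H)
        ∂SimpleGraph.binomialRandom (Fin n) p| ≤ (normM2 g).toReal * (10 / √n) := by
  set μ := SimpleGraph.binomialRandom (Fin n) p
  set v : EuclideanSpace ℝ (Fin 2) := !₂[1, 2 * (p : ℝ)]
  have hn0 : (0 : ℝ) < n := by exact_mod_cast hn
  have hn1 : (1 : ℝ) ≤ √n := Real.one_le_sqrt.2 (by exact_mod_cast hn)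
  let X : SimpleGraph (Fin n) → Edge n → ℝ := fun H e => centredEdge (p : ℝ) e H
  -- Here s and q dominate the norms of the linear and quadratic parts. Doob gives E s² ≤ 4‖v‖² ≤ 20
  -- and E q² ≤ 2/n.
  let s : SimpleGraph (Fin n) → ℝ := fun H => ‖v‖ / n * partialSups (fun m => |edgeSum m (X H)|) n
  let q : SimpleGraph (Fin n) → ℝ := fun H =>
    1 / (2 * (n : ℝ) ^ 2) * partialSups (fun m => |twoStarSum m (X H)|) n
  have hs0 : ∀ H, 0 ≤ s H := fun H => (norm_nonneg _).trans (norm_edgePath_le v (X H))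
  have hq0 : ∀ H, 0 ≤ q H := fun H => (norm_nonneg _).trans (norm_starPath_le (X H))
  have hv : ‖v‖ ^ 2 ≤ 5 := by
    rw [norm_direction_sq]
    nlinarith [p.2.1, p.2.2]
  have hsi : ∫ H, s H ^ 2 ∂μ ≤ 20 := by
    simp only [s, mul_pow]
    rw [integral_const_mul]
    calc _ ≤ (‖v‖ / n) ^ 2 * (4 * (n : ℝ) ^ 2) := mul_le_mul_of_nonneg_left
          (integral_partialSups_edgeSum_sq_le (measurable_centredEdge _) (abs_centredEdge_le p)
            (iIndepFun_centredEdge p) (integral_centredEdge p)) (by positivity)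
      _ = 4 * ‖v‖ ^ 2 := by field_simp
      _ ≤ 20 := by linarith
  have hqi : ∫ H, q H ^ 2 ∂μ ≤ 2 / n := by
    simp only [q, mul_pow]
    rw [integral_const_mul]
    calc _ ≤ (1 / (2 * (n : ℝ) ^ 2)) ^ 2 * (8 * (n : ℝ) ^ 3) := mul_le_mul_of_nonneg_left
          (integral_partialSups_twoStarSum_sq_le (measurable_centredEdge _) (abs_centredEdge_le p)
            (iIndepFun_centredEdge p) (integral_centredEdge p)) (by positivity)
      _ = 2 / n := by
        field_simp
        norm_num
  have hs2 : √(∫ H, s H ^ 2 ∂μ) ≤ 9 / 2 := (Real.sqrt_le_sqrt hsi).trans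
    (Real.sqrt_le_iff.2 ⟨by norm_num, by norm_num⟩)
  have hq2 : √(∫ H, q H ^ 2 ∂μ) ≤ 1.42 / √n := by
    refine (Real.sqrt_le_sqrt hqi).trans ?_
    rw [Real.sqrt_div (by norm_num)]
    gcongr
    exact Real.sqrt_le_iff.2 ⟨by norm_num, by norm_num⟩
  refine (abs_integral_sub_le_of_norm_le hg (P := μ) .of_finite .of_finite (r := fun H => s H + q H)
    (q := q) .of_discrete .of_discrete (fun H => add_nonneg (hs0 H) (hq0 H)) hq0
    (ae_of_all _ fun H => ?_) (ae_of_all _ fun H => ?_) (ae_of_all _ fun H => ?_)).trans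
    (mul_le_mul_of_nonneg_left ?_ ENNReal.toReal_nonneg)
  · rw [edgeTwoStarProcess_eq]
    exact (norm_add_le _ _).trans (add_le_add (norm_edgePath_le v _) (norm_starPath_le _))
  · exact (norm_edgePath_le v _).trans (le_add_of_nonneg_right (hq0 H))
  · rw [edgeTwoStarProcess_eq, add_sub_cancel_left]
    exact norm_starPath_le _
  · have h1 := sqrt_integral_add_sq_le (P := μ) (f := s) (h := q) .of_discrete .of_discrete hs0 hq0
    have h2 : 1.42 / √(n : ℝ) ≤ 1.42 := div_le_self (by norm_num) hn1
    calc _ ≤ (1 + (9 / 2 + 1.42)) * (1.42 / √(n : ℝ)) := by gcongr; linarith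
      _ ≤ 10 / √n := by rw [← mul_div_assoc]; gcongr; norm_num

end EdgePath

/-! ### The Gaussian edge variables -/

section GaussianEdges

variable {n : ℕ}

/-- The position of an edge in the order in which the vertices are revealed. -/
def edgeRank (e : Edge n) : ℕ := (e.1 : ℕ).choose 2 + e.2

theorem choose_two_succ (j : ℕ) : (j + 1).choose 2 = j.choose 2 + j := by
  rw [Nat.choose_succ_succ' j 1, Nat.choose_one_right, add_comm]

/-- Edges with larger end j fill the ranks from C(j, 2) up to C(j+1, 2) - 1, so blocks for different
j are disjoint. -/
theorem edgeRank_injective : Function.Injective (edgeRank (n := n)) := by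
  have key : ∀ e f : Edge n, (e.1 : ℕ) < f.1 → edgeRank e < edgeRank f := fun e f h => by
    have h1 := Nat.choose_le_choose 2 (Nat.succ_le_of_lt h)
    rw [Nat.succ_eq_add_one, choose_two_succ] at h1
    have h2 := e.2.2
    unfold edgeRank
    omega
  intro e f h
  rcases lt_trichotomy (e.1 : ℕ) f.1 with h1 | h1 | h1
  · exact absurd h (key e f h1).ne
  · refine Edge.ext' h1 ?_
    have h2 : (e.1 : ℕ).choose 2 = (f.1 : ℕ).choose 2 := congrArg (Nat.choose · 2) h1
    unfold edgeRank at h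
    omega
  · exact absurd h.symm (key f e h1).ne

/-- The sum telescopes within each vertex block and then over the blocks. This is why the Gaussian
edge sums are values of a single Brownian path. -/
theorem edgeSum_sub {m : ℕ} (hmn : m ≤ n) (F : ℕ → ℝ) :
    edgeSum m (fun e : Edge n => F (edgeRank e + 1) - F (edgeRank e)) = F (m.choose 2) - F 0 := by
  have hin : ∀ j : Fin n, ∑ i : Fin (j : ℕ), (if (j : ℕ) < m then
      F ((j : ℕ).choose 2 + i + 1) - F ((j : ℕ).choose 2 + i) else 0)
      = if (j : ℕ) < m then F (((j : ℕ) + 1).choose 2) - F ((j : ℕ).choose 2) else 0 := fun j => by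
    split_ifs
    · rw [Fin.sum_univ_eq_sum_range
        (fun i => F ((j : ℕ).choose 2 + i + 1) - F ((j : ℕ).choose 2 + i)) j,
        choose_two_succ]
      exact Finset.sum_range_sub (fun i => F ((j : ℕ).choose 2 + i)) j
    · exact Finset.sum_const_zero
  rw [edgeSum, levelSum, Finset.sum_filter, Fintype.sum_sigma]
  simp only [edgeRank, hin]
  rw [Fin.sum_univ_eq_sum_range
    (fun j => if j < m then F ((j + 1).choose 2) - F (j.choose 2) else 0) n, ← Finset.sum_filter]
  have : (Finset.range n).filter (fun j => j < m) = Finset.range m := by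
    ext j
    simp only [Finset.mem_filter, Finset.mem_range]
    omega
  rw [this, Finset.sum_range_sub (fun j => F (j.choose 2))]
  simp

/-- The increment of `W` attached to an edge, scaled by `c n`. -/
noncomputable def edgeIncrement {Ω : Type*} (c : ℝ) (W : ℝ≥0 → Ω → ℝ) (e : Edge n) (ω : Ω) : ℝ :=
  c * n * (W (stepTime n (edgeRank e + 1)) ω - W (stepTime n (edgeRank e)) ω)

theorem edgePath_edgeIncrement {Ω : Type*} (v : EuclideanSpace ℝ (Fin 2)) (c : ℝ)
    (W : ℝ≥0 → Ω → ℝ) {ω : Ω}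
    (h0 : W 0 ω = 0) :
    edgePath n v (fun e => edgeIncrement c W e ω) = stepPath n (c • v) (W · ω) := by
  unfold edgePath stepPath
  congr 1
  funext m
  have h1 := edgeSum_sub (n := n) (Nat.lt_succ_iff.1 m.2) fun k => c * n * W (stepTime n k) ω
  simp only [← mul_sub] at h1
  have h2 : stepTime n 0 = 0 := by simp [stepTime]
  unfold edgeIncrement
  rw [h1, h2, h0, sub_zero, smul_smul, gridTime]
  congr 1
  by_cases hn : (n : ℝ) = 0
  · simp [hn]
  · field_simp

variable {Ω : Type*} [MeasurableSpace Ω] {P : Measure Ω}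

/-- Distinct edges have distinct ranks, so they use increments of W over non-overlapping intervals.
-/
theorem iIndepFun_edgeIncrement {W : ℝ≥0 → Ω → ℝ} (hW : IsBrownianReal W P) (c : ℝ) :
    iIndepFun (edgeIncrement (n := n) c W) P := by
  have hmono : Monotone (stepTime n) := fun i j hij => by
    unfold stepTime
    gcongr
  exact ((hW.hasIndepIncrements.nat hmono).precomp edgeRank_injective).comp
    (fun _ y => c * n * y) fun _ => by fun_prop

/-- The steps have length 2/n², so the variance is (c n)² · 2/n² = 2c². The choice c = √(p(1-p)/2)
matches the edge variance. -/
theorem hasLaw_edgeIncrement (hn : 1 ≤ n) {W : ℝ≥0 → Ω → ℝ} (hW : IsBrownianReal W P) (c : ℝ)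
    {v : ℝ≥0} (hv : (v : ℝ) = 2 * c ^ 2) (e : Edge n) :
    HasLaw (edgeIncrement c W e) (gaussianReal 0 v) P := by
  have hn0 : (n : ℝ) ≠ 0 := by
    have : (1 : ℝ) ≤ n := by exact_mod_cast hn
    linarith
  have h := gaussianReal_const_mul
    (hW.hasLaw_sub (stepTime n (edgeRank e + 1)) (stepTime n (edgeRank e))) (c * n)
  rw [mul_zero] at h
  refine (congrArg (fun u => HasLaw (edgeIncrement c W e) (gaussianReal 0 u) P) ?_).mpr h
  refine NNReal.coe_injective ?_
  have hd : dist (stepTime n (edgeRank e + 1)).1 (stepTime n (edgeRank e)).1 = 2 / (n : ℝ) ^ 2 := by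
    change dist ((stepTime n (edgeRank e + 1) : ℝ≥0) : ℝ) (stepTime n (edgeRank e) : ℝ≥0) = _
    rw [Real.dist_eq]
    unfold stepTime
    push_cast
    rw [← sub_div, mul_add, add_sub_cancel_left, mul_one, abs_of_nonneg (by positivity)]
  rw [hv, NNReal.coe_mul, coe_nndist, hd]
  change _ = (c * n) ^ 2 * (2 / (n : ℝ) ^ 2)
  field_simp

theorem HasLaw.integral_sq_of_gaussianReal {X : Ω → ℝ} {v : ℝ≥0}
    (hX : HasLaw X (gaussianReal 0 v) P) : ∫ ω, X ω ^ 2 ∂P = v := by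
  have h0 : ∫ ω, X ω ∂P = 0 := by rw [hX.integral_eq, integral_id_gaussianReal]
  rw [← variance_of_integral_eq_zero hX.aemeasurable h0, hX.variance_eq, variance_id_gaussianReal]

/-- The linear part of the process is close to its Gaussian counterpart. -/
theorem abs_integral_edgePath_sub_stepPath_le (hn : 1 ≤ n) {g : SkorokhodSpace 2 → ℝ}
    (hg : MemM2 g) (p : I) {W : ℝ≥0 → Ω → ℝ} (hW : IsBrownianReal W P) :
    |∫ H, g (edgePath n !₂[1, 2 * (p : ℝ)] fun e => centredEdge (p : ℝ) e H)
        ∂SimpleGraph.binomialRandom (Fin n) p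
      - ∫ ω, g (stepPath n (√(p * (1 - p) / 2) • !₂[1, 2 * (p : ℝ)]) (W · ω)) ∂P|
      ≤ (normM2 g).toReal * (30 / √n) := by
  have := hW.isGaussianProcess.isProbabilityMeasure
  set μ := SimpleGraph.binomialRandom (Fin n) p
  set v : EuclideanSpace ℝ (Fin 2) := !₂[1, 2 * (p : ℝ)]
  set c := √((p : ℝ) * (1 - p) / 2)
  set N := (normM2 g).toReal
  have hN : 0 ≤ N := ENNReal.toReal_nonneg
  have hp0 := p.2.1
  have hp1 := p.2.2
  have hn0 : (0 : ℝ) < n := by exact_mod_cast hn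
  have hn1 : (1 : ℝ) ≤ √n := Real.one_le_sqrt.2 (by exact_mod_cast hn)
  have hpp : 0 ≤ (p : ℝ) * (1 - p) := mul_nonneg hp0 (by linarith)
  let s : ℝ≥0 := ⟨p * (1 - p), hpp⟩
  have hs : (s : ℝ) = 2 * c ^ 2 := by
    rw [Real.sq_sqrt (by positivity)]
    change (p : ℝ) * (1 - p) = _
    ring
  have hs4 : (s : ℝ) ≤ 1 / 4 := by
    change (p : ℝ) * (1 - p) ≤ 1 / 4
    nlinarith [sq_nonneg ((p : ℝ) - 1 / 2)]
  have hlaw := fun e : Edge n => hasLaw_edgeIncrement hn hW c hs e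
  have hstep : ∫ ω, g (stepPath n (c • v) (W · ω)) ∂P
      = ∫ ω, g (∑ e : Edge n, edgeIncrement c W e ω • edgeDirection v e) ∂P := by
    refine integral_congr_ae ?_
    filter_upwards [hW.eval_zero_ae_eq_zero] with ω h0
    rw [← edgePath_eq_sum, edgePath_edgeIncrement v c W h0]
  rw [hstep]
  simp only [edgePath_eq_sum]
  refine (abs_integral_sum_smul_sub_le hg.memM.continuous hN hg.abs_le
    hg.exists_abs_sub_quadratic_le (edgeDirection v)
    (fun e => (measurable_centredEdge _ e).aemeasurable) (fun e => (hlaw e).aemeasurable)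
    (iIndepFun_centredEdge p) (iIndepFun_edgeIncrement hW c) (fun e => .of_finite)
    (fun e => (integrable_abs_cube_of_hasLaw (hlaw e) hs4).1) (fun e => ?_) (fun e => ?_)).trans ?_
  · rw [integral_centredEdge, (hlaw e).integral_eq, integral_id_gaussianReal]
  · rw [integral_centredEdge_sq, HasLaw.integral_sq_of_gaussianReal (hlaw e)]
    rfl
  · have hv2 : ‖v‖ ^ 2 ≤ 5 := by
      rw [norm_direction_sq]
      nlinarith
    have hv1 : ‖v‖ ≤ 9 / 4 := by nlinarith [norm_nonneg v]
    have hv3 : ‖v‖ ^ 3 ≤ 12 := by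
      calc ‖v‖ ^ 3 = ‖v‖ * ‖v‖ ^ 2 := by ring
        _ ≤ 9 / 4 * 5 := by gcongr
        _ ≤ 12 := by norm_num
    have hd : ∀ e : Edge n, ‖edgeDirection v e‖ ^ 3 ≤ 12 / (n : ℝ) ^ 3 := fun e => by
      calc ‖edgeDirection v e‖ ^ 3 ≤ (1 / (n : ℝ) * ‖v‖) ^ 3 :=
            pow_le_pow_left₀ (norm_nonneg _) (norm_edgeDirection_le v e) 3
        _ = ‖v‖ ^ 3 / (n : ℝ) ^ 3 := by rw [mul_pow, one_div, inv_pow]; ring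
        _ ≤ 12 / (n : ℝ) ^ 3 := by gcongr
    have hX : ∀ e : Edge n, ∫ H, |centredEdge (p : ℝ) e H| ^ 3 ∂μ ≤ 1 := fun e => by
      refine (integral_mono (.of_finite) (integrable_const (1 : ℝ)) fun H =>
        pow_le_one₀ (abs_nonneg _) (abs_centredEdge_le p e H)).trans ?_
      simp
    have hcard := card_edge_le n
    have hsq : √(n : ℝ) ≤ n := by
      have := Real.sq_sqrt hn0.le
      nlinarith
    -- The third absolute moments are at most 1 for an edge and 3/2 for its Gaussian; 12 bounds
    -- ‖v‖³. The resulting 30/n is weakened to 30/√n.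
    calc _ ≤ ∑ _ : Edge n, N * (12 / (n : ℝ) ^ 3) * (1 + 3 / 2) := Finset.sum_le_sum fun e _ => by
          have h3 := (integrable_abs_cube_of_hasLaw (hlaw e) hs4).2
          have := hX e
          have := hd e
          gcongr
      _ = Fintype.card (Edge n) * (N * (30 / (n : ℝ) ^ 3)) := by
          rw [Finset.sum_const, Finset.card_univ, nsmul_eq_mul]
          ring
      _ ≤ (n : ℝ) ^ 2 * (N * (30 / (n : ℝ) ^ 3)) := by gcongr
      _ = N * (30 / n) := by field_simp
      _ ≤ N * (30 / √n) := by gcongr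

end GaussianEdges

/-! ### The limit process -/

section Limit

/-- The coefficient matrix of Z has rank one: its columns are √(p(1-p)/2) · (1, 2p) times the
coordinates of the unit vector (1, 2p)/√(1+4p²). -/
theorem limitPath_eq {p : ℝ} (b₁ b₂ : ℝ≥0 → ℝ) (t : I) :
    limitPath p b₁ b₂ t = ((t : ℝ) * (1 / √(1 + 4 * p ^ 2) * b₁ (unitInterval.toNNReal t ^ 2)
      + 2 * p / √(1 + 4 * p ^ 2) * b₂ (unitInterval.toNNReal t ^ 2)))
        • √(p * (1 - p) / 2) • !₂[1, 2 * p] := by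
  have h1 : √(p * (1 - p)) = √2 * √(p * (1 - p) / 2) := by
    rw [← Real.sqrt_mul (by norm_num)]
    congr 1
    ring
  have h2 : √(2 * p * (1 - p)) = 2 * √(p * (1 - p) / 2) := by
    rw [show 2 * p * (1 - p) = 2 ^ 2 * (p * (1 - p) / 2) by ring, Real.sqrt_mul (by norm_num),
      Real.sqrt_sq (by norm_num)]
  have h3 : √(2 + 8 * p ^ 2) = √2 * √(1 + 4 * p ^ 2) := by
    rw [← Real.sqrt_mul (by norm_num)]
    congr 1
    ring
  have h4 : √(1 + 4 * p ^ 2) ≠ 0 := (Real.sqrt_pos.2 (by positivity)).ne'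
  have h5 : √(2 : ℝ) ≠ 0 := (Real.sqrt_pos.2 (by norm_num)).ne'
  rw [limitPath]
  ext k
  fin_cases k <;> simp 
  · rw [h1, h2, h3]
    field_simp
  · rw [h2]
    field_simp
    rw [h1]
    ring

/-- Continuity of the Brownian paths makes the limit path càdlàg, so the default value 0 is not
taken. -/
theorem limitProcess_apply {Ω : Type*} {p : ℝ} {B₁ B₂ : ℝ≥0 → Ω → ℝ} {ω : Ω} (h₁ : Continuous (B₁ · ω))
    (h₂ : Continuous (B₂ · ω)) (t : I) :
    limitProcess p B₁ B₂ ω t = limitPath p (B₁ · ω) (B₂ · ω) t := by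
  have hs : Continuous fun t : I => unitInterval.toNNReal t ^ 2 :=
    unitInterval.toNNReal_continuous.pow 2
  have hc : Continuous (limitPath p (B₁ · ω) (B₂ · ω)) := by
    have h : limitPath p (B₁ · ω) (B₂ · ω) = _ := funext (limitPath_eq _ _)
    rw [h]
    have c₁ := h₁.comp hs
    have c₂ := h₂.comp hs
    simp only [Function.comp_def] at c₁ c₂
    fun_prop
  have hcad : IsCadlagPath (limitPath p (B₁ · ω) (B₂ · ω)) := fun t =>
    ⟨hc.continuousWithinAt, _, (hc.tendsto t).mono_left nhdsWithin_le_nhds⟩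
  unfold limitProcess
  rw [dif_pos hcad]
  rfl

end Limit

/-! ### Assembly of the three comparisons -/

theorem mainTheorem5
    {Ω Ω' : Type*} [MeasurableSpace Ω] [MeasurableSpace Ω']
    (P : Measure Ω) [IsProbabilityMeasure P] (P' : Measure Ω') [IsProbabilityMeasure P']
    (n : ℕ) (hn : 1 ≤ n) (p : unitInterval)
    (G : Ω → SimpleGraph (Fin n)) (hG : HasLaw G (SimpleGraph.binomialRandom (Fin n) p) P)
    (B₁ B₂ : ℝ≥0 → Ω' → ℝ) (hB₁ : IsBrownianReal B₁ P') (hB₂ : IsBrownianReal B₂ P')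
    (hB : IndepFun (fun ω t => B₁ t ω) (fun ω t => B₂ t ω) P')
    (g : SkorokhodSpace 2 → ℝ) (hg : MemM2 g) :
    Integrable (fun ω => g (edgeTwoStarProcess P G ω)) P ∧
    Integrable (fun ω => g (limitProcess (p : ℝ) B₁ B₂ ω)) P' ∧
    |(∫ ω, g (edgeTwoStarProcess P G ω) ∂P) - ∫ ω, g (limitProcess (p : ℝ) B₁ B₂ ω) ∂P'| ≤
      (normM2 g).toReal *
        (913 * (n : ℝ) ^ (-(1 / 2) : ℝ) * √(Real.log n) + 112 * (n : ℝ) ^ (-(1 / 2) : ℝ)) := by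
  have hp0 := p.2.1
  have hp1 := p.2.2
  set N := (normM2 g).toReal
  have hN : 0 ≤ N := ENNReal.toReal_nonneg
  let f : SimpleGraph (Fin n) → ℝ := fun H =>
    g (edgeTwoStarProcess (SimpleGraph.binomialRandom (Fin n) p) id H)
  have hf : Measurable f := measurable_of_finite f
  have hGf : (fun ω => g (edgeTwoStarProcess P G ω)) = f ∘ G :=
    funext fun ω => by rw [edgeTwoStarProcess_eq_of_hasLaw hG]; rfl
  have hfi : Integrable f (P.map G) := by
    rw [hG.map_eq]
    exact .of_finite
  have hYi : Integrable (fun ω => g (edgeTwoStarProcess P G ω)) P := by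
    rw [hGf]
    exact hfi.comp_aemeasurable hG.aemeasurable
  have hY : ∫ ω, g (edgeTwoStarProcess P G ω) ∂P
      = ∫ H, f H ∂SimpleGraph.binomialRandom (Fin n) p := by
    rw [hGf]
    exact hG.integral_comp hf.aestronglyMeasurable
  have hq : (0 : ℝ) < 1 + 4 * (p : ℝ) ^ 2 := by positivity
  have hW := isBrownianReal_add hB₁ hB₂ hB (a := 1 / √(1 + 4 * (p : ℝ) ^ 2))
    (b := 2 * (p : ℝ) / √(1 + 4 * (p : ℝ) ^ 2)) (by
      rw [div_pow, div_pow, Real.sq_sqrt hq.le]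
      field_simp
      ring)
  -- The square is p(1-p)/2 · (1 + 4p²) ≤ 5/8.
  have hnorm : ‖√((p : ℝ) * (1 - p) / 2) • (!₂[1, 2 * (p : ℝ)] : EuclideanSpace ℝ (Fin 2))‖ ≤ 1 := by
    have h0 : 0 ≤ (p : ℝ) * (1 - p) / 2 := by
      have := mul_nonneg hp0 (sub_nonneg.2 hp1)
      positivity
    rw [← sq_le_one_iff₀ (norm_nonneg _), norm_smul, mul_pow, norm_direction_sq, Real.norm_eq_abs,
      sq_abs, Real.sq_sqrt h0]
    have h1 : (p : ℝ) * (1 - p) ≤ 1 / 4 := by nlinarith [sq_nonneg ((p : ℝ) - 1 / 2)]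
    have h2 : (p : ℝ) ^ 2 ≤ 1 := pow_le_one₀ hp0 hp1
    nlinarith
  obtain ⟨hZi, hZ⟩ := abs_integral_limit_sub_stepPath_le hn hg hnorm hW
    (Z := limitProcess (p : ℝ) B₁ B₂) (by
      filter_upwards [hB₁.cont, hB₂.cont] with ω h₁ h₂ t
      rw [limitProcess_apply h₁ h₂, limitPath_eq])
  refine ⟨hYi, hZi, ?_⟩
  rw [hY]
  have h1 := abs_integral_process_sub_edgePath_le hn hg p
  have h2 := abs_integral_edgePath_sub_stepPath_le hn hg p hW
  rw [abs_sub_comm] at hZ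
  have h3 := (abs_sub_le _ _ _).trans (add_le_add h1 ((abs_sub_le _ _ _).trans (add_le_add h2 hZ)))
  refine h3.trans ?_
  rw [← mul_add, ← mul_add]
  refine mul_le_mul_of_nonneg_left ?_ hN
  have hs : (n : ℝ) ^ (-(1 / 2) : ℝ) = 1 / √n := by
    rw [Real.rpow_neg (Nat.cast_nonneg n), ← Real.sqrt_eq_rpow, one_div]
  rw [hs]
  have hpos : 0 ≤ 1 / √(n : ℝ) := by positivity
  have hlog : 0 ≤ 1 / √(n : ℝ) * √(Real.log n) := by positivity
  -- Quadratic part 10, Lindeberg 30, discretization 13 √(log n) + 50: the totals 13 and 90 lie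
  -- below 913 and 112.
  have h4 : 10 / √(n : ℝ) + (30 / √n + (13 * √(Real.log n) + 50) / √n)
      = 13 * (1 / √(n : ℝ) * √(Real.log n)) + 90 * (1 / √n) := by ring
  rw [h4]
  linarith
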